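/- **Theorem (CLWE to LWE).** Notation. $D_s$ is the Gaussian distribution on $\mathbb{R}$ with density $e^{-\pi (x/s)^2}/s$; $\mathbb{Z}_q=\{0,\dots,q-1\}$, $\mathbb{T}_q=\mathbb{R}/q\mathbb{Z}=[0,q)$, $\mathbb{T}=\mathbb{T}_1$, and $U(X)$ is the uniform distribution on $X$. For a distribution $\mathcal{S}$ over $\mathbb{Z}^n$, $\mathsf{LWE}(m,\mathbb{Z}_q^n,\mathcal{S},D_\sigma)$ is the distribution of $(\mathbf{a}_i,\langle \mathbf{s},\mathbf{a}_i\rangle+e_i \bmod q)_{i\le m}$ with $\mathbf{s}\sim\mathcal{S}$, $\mathbf{a}_i\sim U(\mathbb{Z}_q^n)$, $e_i\sim D_\sigma$ independent. For a distribution $\mathcal{S}'$ over unit vectors, $\mathsf{CLWE}(m,D_1^n,\mathcal{S}',\gamma,\beta)$ is the distribution of $(\mathbf{a}_i,\gamma\langle \mathbf{a}_i,\mathbf{s}\rangle+e_i \bmod 1)_{i\le m}$ with $\mathbf{s}\sim\mathcal{S}'$, $\mathbf{a}_i\sim D_1^n$, $e_i\sim D_\beta$ independent. Algorithms are programs of a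 probabilistic real RAM (exact real registers, index registers for addresses, unit-cost arithmetic, comparisons, indirect addressing, jumps, independent uniform random numbers in $[0,1]$, no rounding instruction); a program may depend on the parameters and on $\mathcal S$, and a $T$-time algorithm has at most $T$ instructions and halts within $T$ steps on every input. A distinguisher $\mathcal{A}$ between $\mathcal{D}_1,\mathcal{D}_2$ has advantage $|\Pr_{x\sim \mathcal{D}_1}[\mathcal{A}(x)=1]-\Pr_{x\sim \mathcal{D}_2}[\mathcal{A}(x)=1]|$. There is an absolute constant $C\ge 1$ such that the following holds. Let $f,g:\mathbb{N}\to\mathbb{R}$ be functions with $f(\lambda),g(\lambda)=\omega(\log\lambda)$, where $f$ grows at most quasi-polynomially, i.e. $f(\lambda)\le e^{(\log\lambda)^{k}}$ for some $k$ and all large $\lambda$. Then there are a polynomial $p$ and a negligible function $\nu$, depending only on $f$ and $g$, such that for all $\lambda\in\mathbb{N}$, all integers $n,m,q\ge 1$ and all reals $r\ge 1$, $\beta>0$ with $$\gamma=r\sqrt{\ln m+\ln n+f(\lambda)}\quad\text{and}\quad \beta q\ \ge\ 3r\sqrt{\ln m+\ln n+g(\lambda)}$$ (a square root of a negative number, possible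 only for small $\lambda$, is read as $0$), there is a $\sigma$ with $\beta q\le\sigma\le C\beta q$ such that for every distribution $\mathcal{S}$ over $\mathbb{Z}^n$ all of whose support has $\ell_2$-norm $r$, every $T\in\mathbb{N}$ and every $\epsilon\in\mathbb{R}$, with $T'=T+p(n,m,\lfloor\log_2 q\rfloor,\lfloor\log_2\lambda\rfloor)$ (where $\lfloor\log_2 0\rfloor:=0$): 1. (Decision.) If there is no $T'$-time distinguisher between $\mathsf{CLWE}(m,D_1^n,\tfrac1r\mathcal{S},\gamma,\beta)$ and $D_1^{n\times m}\times U(\mathbb{T}^m)$ with advantage at least $\epsilon-\nu(\lambda)$, then there is no $T$-time distinguisher between $\mathsf{LWE}(m,\mathbb{Z}_q^n,\mathcal{S},D_\sigma)$ and $U(\mathbb{Z}_q^{n\times m}\times\mathbb{T}_q^m)$ with advantage at least $\epsilon$. 2. (Search.) If there is no $T'$-time algorithm that, given samples from $\mathsf{CLWE}(m,D_1^n,\tfrac1r\mathcal{S},\gamma,\beta)$, outputs their secret with probability at least $\epsilon-\nu(\lambda)$, then there is no $T$-time algorithm that, given samples from $\mathsf{LWE}(m,\mathbb{Z}_q^n,\mathcal{S},D_\sigma)$,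 outputs their secret with probability at least $\epsilon$. -/

import Mathlib

open MeasureTheory ProbabilityTheory Filter

noncomputable section

/-! ### A probabilistic real RAM

The machine has real registers `R 0, R 1, …`, which hold exact real numbers, and index registers
`N 0, N 1, …`, which hold natural numbers and serve as addresses. One instruction is one step.
There is no instruction for rounding a real number to an integer. -/

/-- Instructions of the machine. -/
inductive RAMInstr : Type
  /-- `R i := c` -/
  | const (i : ℕ) (c : ℝ)
  /-- `R i := R j + R k` -/
  | add (i j k : ℕ)
  /-- `R i := R j - R k` -/
  | sub (i j k : ℕ)
  /-- `R i := R j * R k` -/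
  | mul (i j k : ℕ)
  /-- `R i := R j / R k` (and `0` if `R k = 0`) -/
  | div (i j k : ℕ)
  /-- `R i := 1` if `R j ≤ R k`, and `R i := 0` otherwise -/
  | le (i j k : ℕ)
  /-- indirect read: `R i := R (N j)` -/
  | load (i j : ℕ)
  /-- indirect write: `R (N i) := R j` -/
  | store (i j : ℕ)
  /-- `R i :=` a fresh random number, uniform in `[0, 1]` -/
  | rand (i : ℕ)
  /-- continue at line `t` of the program if `R j > 0`, and at the next line otherwise -/
  | jump (j t : ℕ)
  /-- `N i := c` -/
  | idxConst (i c : ℕ)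
  /-- `N i := N j + N k` -/
  | idxAdd (i j k : ℕ)
  /-- `N i := N j - N k` (and `0` if `N j < N k`) -/
  | idxSub (i j k : ℕ)
  /-- continue at line `t` of the program if `N j > 0`, and at the next line otherwise -/
  | idxJump (j t : ℕ)

/-- A program is a finite list of instructions. -/
abbrev RAMProgram : Type := List RAMInstr

/-- A configuration: the line to be executed next and the contents of the registers. -/
structure RAMConfig : Type where
  pc : ℕ
  reg : ℕ → ℝ
  idx : ℕ → ℕ

/-- One step of the program `P`; `u` is the random number available to this step. A configuration
whose line number lies beyond the end of the program is halted and no longer changes. -/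
def RAMProgram.step (P : RAMProgram) (u : ℝ) (c : RAMConfig) : RAMConfig :=
  match P[c.pc]? with
  | none => c
  | some (.const i x) => ⟨c.pc + 1, Function.update c.reg i x, c.idx⟩
  | some (.add i j k) => ⟨c.pc + 1, Function.update c.reg i (c.reg j + c.reg k), c.idx⟩
  | some (.sub i j k) => ⟨c.pc + 1, Function.update c.reg i (c.reg j - c.reg k), c.idx⟩
  | some (.mul i j k) => ⟨c.pc + 1, Function.update c.reg i (c.reg j * c.reg k), c.idx⟩
  | some (.div i j k) => ⟨c.pc + 1, Function.update c.reg i (c.reg j / c.reg k), c.idx⟩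
  | some (.le i j k) =>
      ⟨c.pc + 1, Function.update c.reg i (if c.reg j ≤ c.reg k then 1 else 0), c.idx⟩
  | some (.load i j) => ⟨c.pc + 1, Function.update c.reg i (c.reg (c.idx j)), c.idx⟩
  | some (.store i j) => ⟨c.pc + 1, Function.update c.reg (c.idx i) (c.reg j), c.idx⟩
  | some (.rand i) => ⟨c.pc + 1, Function.update c.reg i u, c.idx⟩
  | some (.jump j t) => ⟨if 0 < c.reg j then t else c.pc + 1, c.reg, c.idx⟩
  | some (.idxConst i a) => ⟨c.pc + 1, c.reg, Function.update c.idx i a⟩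
  | some (.idxAdd i j k) => ⟨c.pc + 1, c.reg, Function.update c.idx i (c.idx j + c.idx k)⟩
  | some (.idxSub i j k) => ⟨c.pc + 1, c.reg, Function.update c.idx i (c.idx j - c.idx k)⟩
  | some (.idxJump j t) => ⟨if 0 < c.idx j then t else c.pc + 1, c.reg, c.idx⟩

/-- Random tapes: step number `t` has access to the random number `ω t`. -/
abbrev RAMTape : Type := ℕ → unitInterval

/-- The random numbers of the different steps are independent and uniform in `[0, 1]`. -/
def ramTapeMeasure : Measure RAMTape := Measure.infinitePi fun _ : ℕ => (volume : Measure unitInterval)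

/-- The configuration after `t` steps, started at line `0` with `x` in the real registers and zeros in
the index registers. -/
def RAMProgram.run (P : RAMProgram) (x : ℕ → ℝ) (ω : RAMTape) : ℕ → RAMConfig
  | 0 => ⟨0, x, fun _ => 0⟩
  | t + 1 => P.step (ω t) (P.run x ω t)

/-- After `t` steps the program has halted. -/
def RAMProgram.HaltsBy (P : RAMProgram) (x : ℕ → ℝ) (ω : RAMTape) (t : ℕ) : Prop :=
  P.length ≤ (P.run x ω t).pc

/-! ### Algorithms that receive `m` samples in dimension `n` -/

/-- Arrays of `m` samples `(aᵢ, bᵢ)` with `aᵢ ∈ ℝⁿ` and `bᵢ ∈ ℝ`. Elements of `ℤ_q` are represented by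
`0, …, q - 1`, and elements of `ℝ/qℤ` by real numbers in `[0, q)`. -/
abbrev Samples (m n : ℕ) : Type := Fin m → (Fin n → ℝ) × ℝ

/-- The initial contents of the real registers on input `x`: the numbers
`a₀₀, …, a₀₍ₙ₋₁₎, b₀, a₁₀, …, a₁₍ₙ₋₁₎, b₁, …` one after the other, followed by zeros. -/
def Samples.toReg {m n : ℕ} (x : Samples m n) (k : ℕ) : ℝ :=
  if hi : k / (n + 1) < m then
    if hj : k % (n + 1) < n then (x ⟨k / (n + 1), hi⟩).1 ⟨k % (n + 1), hj⟩
    else (x ⟨k / (n + 1), hi⟩).2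
  else 0

/-- `P` is a `T`-time algorithm on arrays of `m` samples in dimension `n`: on every input and for all
outcomes of its random choices it halts within `T` steps. Since a program belongs to fixed parameters
and may contain constants that depend on them, its length is also counted as part of the time. -/
def RAMProgram.RunsInTime (P : RAMProgram) (m n T : ℕ) : Prop :=
  P.length ≤ T ∧ ∀ (x : Samples m n) (ω : RAMTape), P.HaltsBy x.toReg ω T

/-- `P` outputs `1` (it halts, with `1` in `R 0`). -/
def RAMProgram.Accepts (P : RAMProgram) {m n : ℕ} (x : Samples m n) (ω : RAMTape) : Prop :=
  ∃ t, P.HaltsBy x.toReg ω t ∧ (P.run x.toReg ω t).reg 0 = 1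

/-- `P` outputs the vector `v` (it halts, with `v` in `R 0, …, R (n - 1)`). -/
def RAMProgram.Outputs (P : RAMProgram) {m n : ℕ} (x : Samples m n) (ω : RAMTape)
    (v : Fin n → ℝ) : Prop :=
  ∃ t, P.HaltsBy x.toReg ω t ∧ ∀ j : Fin n, (P.run x.toReg ω t).reg j = v j

/-- The probability that `P` outputs `1` on an input drawn from `D`. -/
def RAMProgram.acceptProb (P : RAMProgram) {m n : ℕ} (D : Measure (Samples m n)) : ℝ :=
  (D.prod ramTapeMeasure).real {w | P.Accepts w.1 w.2}

/-- There is a `T`-time distinguisher between `D₁` and `D₂` with advantage at least `ε`. -/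
def HasDistinguisher {m n : ℕ} (D₁ D₂ : Measure (Samples m n)) (T : ℕ) (ε : ℝ) : Prop :=
  ∃ P : RAMProgram, P.RunsInTime m n T ∧ ε ≤ |P.acceptProb D₁ - P.acceptProb D₂|

/-- For a joint distribution `J` of a secret and an array of samples: there is a `T`-time algorithm
that on input the samples outputs the secret with probability at least `ε`. -/
def HasSearchSolver {m n : ℕ} (J : Measure ((Fin n → ℝ) × Samples m n)) (T : ℕ) (ε : ℝ) : Prop :=
  ∃ P : RAMProgram, P.RunsInTime m n T ∧
    ε ≤ (J.prod ramTapeMeasure).real {w | P.Outputs w.1.2 w.2 w.1.1}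

/-! ### Distributions -/

/-- The representative of `x` modulo `q` in `[0, q)`. -/
def realMod (x q : ℝ) : ℝ := x - q * ⌊x / q⌋

/-- The Gaussian distribution `D_s` of width `s` on `ℝ`, with density `exp (-π (x/s)²) / s`, that is,
with variance `s² / (2π)`. -/
def gaussianWidth (s : ℝ) : Measure ℝ := gaussianReal 0 (s ^ 2 / (2 * Real.pi)).toNNReal

/-- The distribution `D_sⁿ` on `ℝⁿ`. -/
def gaussianVec (n : ℕ) (s : ℝ) : Measure (Fin n → ℝ) := Measure.pi fun _ => gaussianWidth s

/-- The uniform distribution on `ℤ_q = {0, …, q - 1}`. -/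
def uniformZMod (q : ℕ) : Measure ℝ := uniformOn ((fun k : ℕ => (k : ℝ)) '' Set.Iio q)

/-- The uniform distribution on `ℤ_qⁿ`. -/
def uniformZModVec (n q : ℕ) : Measure (Fin n → ℝ) := Measure.pi fun _ => uniformZMod q

/-- The uniform distribution on the torus `ℝ/qℤ = [0, q)`. -/
def uniformTorus (q : ℝ) : Measure ℝ := cond volume (Set.Ico 0 q)

/-- The distribution of `s` drawn from `S`, as a distribution on `ℝⁿ`, scaled by `c`. -/
def scaledSecret {n : ℕ} (c : ℝ) (S : PMF (Fin n → ℤ)) : Measure (Fin n → ℝ) :=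
  S.toMeasure.map fun s j => c * (s j : ℝ)

/-- The joint distribution of the secret `s` and the samples `(aᵢ, γ ⟨aᵢ, s⟩ + eᵢ mod q)`, `i < m`,
where `s` is drawn from `S`, the `aᵢ` from `A` and the `eᵢ` from `E`, all independently. -/
def noisyJoint (m : ℕ) {n : ℕ} (q γ : ℝ) (A S : Measure (Fin n → ℝ)) (E : Measure ℝ) :
    Measure ((Fin n → ℝ) × Samples m n) :=
  (S.prod ((Measure.pi fun _ : Fin m => A).prod (Measure.pi fun _ : Fin m => E))).map fun w =>
    (w.1, fun i => (w.2.1 i, realMod (γ * ∑ j, w.2.1 i j * w.1 j + w.2.2 i) q))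

/-- The secret and the samples of `LWE(m, A, S, E)` with modulus `q`. -/
def lweJoint (m : ℕ) {n : ℕ} (q : ℕ) (A : Measure (Fin n → ℝ)) (S : PMF (Fin n → ℤ))
    (E : Measure ℝ) : Measure ((Fin n → ℝ) × Samples m n) :=
  noisyJoint m q 1 A (scaledSecret 1 S) E

/-- The distribution `LWE(m, A, S, E)` with modulus `q`. -/
def lweDist (m : ℕ) {n : ℕ} (q : ℕ) (A : Measure (Fin n → ℝ)) (S : PMF (Fin n → ℤ))
    (E : Measure ℝ) : Measure (Samples m n) :=
  (lweJoint m q A S E).map Prod.snd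

/-- The secret and the samples of `CLWE(m, A, S, γ, β)`. -/
def clweJoint (m : ℕ) {n : ℕ} (A S : Measure (Fin n → ℝ)) (γ β : ℝ) :
    Measure ((Fin n → ℝ) × Samples m n) :=
  noisyJoint m 1 γ A S (gaussianWidth β)

/-- The distribution `CLWE(m, A, S, γ, β)`. -/
def clweDist (m : ℕ) {n : ℕ} (A S : Measure (Fin n → ℝ)) (γ β : ℝ) : Measure (Samples m n) :=
  (clweJoint m A S γ β).map Prod.snd

/-- The null distribution: `m` independent samples `(a, b)` with `a` drawn from `A` and, independently,
`b` uniform in `[0, q)`. -/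
def nullDist (m : ℕ) {n : ℕ} (A : Measure (Fin n → ℝ)) (q : ℝ) : Measure (Samples m n) :=
  Measure.pi fun _ : Fin m => A.prod (uniformTorus q)

/-! ### Asymptotic notation -/

/-- `f(λ) = ω(log λ)`. -/
def IsSuperLog (f : ℕ → ℝ) : Prop :=
  Tendsto (fun l : ℕ => f l / Real.log l) atTop atTop

/-- `f` grows at most quasi-polynomially: `log f(λ)` is bounded by a polynomial in `log λ`. -/
def IsQuasiPolyBounded (f : ℕ → ℝ) : Prop :=
  ∃ k : ℕ, ∀ᶠ l : ℕ in atTop, f l ≤ Real.exp (Real.log l ^ k)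

/-- `ν` is negligible: it decays faster than the inverse of every polynomial. -/
def IsNegligible (ν : ℕ → ℝ) : Prop :=
  Asymptotics.SuperpolynomialDecay atTop (fun l : ℕ => (l : ℝ)) ν

end

/-!
Writing `γ = r τ`, a CLWE sample scaled by `q` is `(a, ⟨s, v⟩ + q e mod q)` with `v = q τ a`.
Round each entry of `v` to an integer `X`, chosen with probability proportional to
`exp (-π ((v - X) / t) ^ 2)`. The sum of these weights over the integers barely depends on `v`,
since `t` exceeds the smoothing parameter of `ℤ`; and `q τ` exceeds the smoothing parameter of
`q ℤ`, so `X mod q` is nearly uniform and nearly independent of `v - X`, which is nearly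
distributed as `D_t`. Hence `(X mod q, ⟨s, v⟩ + q e mod q)` is nearly an LWE sample with error
`⟨s, v - X⟩ + q e`, a Gaussian of squared width `(r t) ^ 2 + (q β) ^ 2` when `‖s‖ = r`; and the
uniform distribution is mapped nearly to the uniform distribution.

All errors enter through a pointwise bound of the law of a single transformed entry by `C` times its
ideal law: over independent entries the constants multiply, and a bound by `1 + δ` between
probability measures gives statistical distance `δ`.

The machine cannot round, so `⌊v⌋` and `v mod q` are found by binary search, which is limited to
`|v| < 2 ^ K`, and `X` is chosen by comparing a uniform random number with partial sums of weights
in the window `|X - ⌊v⌋| ≤ Z`, each weight being computed from `N` terms of an exponential series.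
-/

noncomputable section

/-! ### Straight-line code -/

namespace RAMInstr

/-- Deterministic instructions that compute with the real registers at fixed addresses only. -/
def IsStraight : RAMInstr → Prop
  | const _ _ | add _ _ _ | sub _ _ _ | mul _ _ _ | div _ _ _ | le _ _ _ => True
  | _ => False

/-- The effect of a straight-line instruction on the real registers; by convention the other
instructions have no effect. -/
def exec (R : ℕ → ℝ) : RAMInstr → ℕ → ℝ
  | const i x => Function.update R i x
  | add i j k => Function.update R i (R j + R k)
  | sub i j k => Function.update R i (R j - R k)
  | mul i j k => Function.update R i (R j * R k)
  | div i j k => Function.update R i (R j / R k)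
  | le i j k => Function.update R i (if R j ≤ R k then 1 else 0)
  | _ => R

/-- The register to which a straight-line instruction writes. -/
def dest : RAMInstr → Option ℕ
  | const i _ | add i _ _ | sub i _ _ | mul i _ _ | div i _ _ | le i _ _ => some i
  | _ => none

/-- The same straight-line instruction with `s` added to all register addresses. -/
def shift (s : ℕ) : RAMInstr → RAMInstr
  | const i x => const (s + i) x
  | add i j k => add (s + i) (s + j) (s + k)
  | sub i j k => sub (s + i) (s + j) (s + k)
  | mul i j k => mul (s + i) (s + j) (s + k)
  | div i j k => div (s + i) (s + j) (s + k)
  | le i j k => le (s + i) (s + j) (s + k)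
  | c => c

theorem exec_apply_of_dest_ne {c : RAMInstr} {k : ℕ} (h : c.dest ≠ some k) (R : ℕ → ℝ) :
    c.exec R k = R k := by
  cases c <;> simp_all [exec, dest, Function.update_of_ne, ne_comm]

theorem dest_shift (s : ℕ) (c : RAMInstr) : (c.shift s).dest = c.dest.map (s + ·) := by
  cases c <;> rfl

theorem exec_shift (s : ℕ) (c : RAMInstr) (R : ℕ → ℝ) :
    (fun k => (c.shift s).exec R (s + k)) = c.exec fun k => R (s + k) := by
  have update_shift (i : ℕ) (v : ℝ) : (fun k => Function.update R (s + i) v (s + k)) =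
      Function.update (fun k => R (s + k)) i v :=
    Function.update_comp_eq_of_injective R (add_right_injective s) i v
  cases c <;> simp only [RAMInstr.shift, exec, update_shift]

end RAMInstr

namespace RAMProgram

/-- The effect of straight-line code on the real registers. -/
def exec (c : RAMProgram) (R : ℕ → ℝ) : ℕ → ℝ :=
  c.foldl RAMInstr.exec R

theorem exec_nil (R : ℕ → ℝ) : exec [] R = R := rfl

theorem exec_cons (i : RAMInstr) (c : RAMProgram) (R : ℕ → ℝ) :
    exec (i :: c) R = exec c (i.exec R) := rfl

theorem exec_append (c d : RAMProgram) (R : ℕ → ℝ) : exec (c ++ d) R = d.exec (c.exec R) :=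
  List.foldl_append

/-- `c` is straight-line code that writes to registers in `s` only. -/
def WritesIn (c : RAMProgram) (s : Set ℕ) : Prop :=
  ∀ i ∈ c, ∃ k ∈ s, i.dest = some k

theorem WritesIn.append {c d : RAMProgram} {s : Set ℕ} (hc : c.WritesIn s) (hd : d.WritesIn s) :
    WritesIn (c ++ d) s :=
  List.forall_mem_append.2 ⟨hc, hd⟩

theorem WritesIn.mono {c : RAMProgram} {s s' : Set ℕ} (hc : c.WritesIn s) (h : s ⊆ s') :
    c.WritesIn s' :=
  fun i hi => (hc i hi).imp fun _ hk => ⟨h hk.1, hk.2⟩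

theorem WritesIn.isStraight {c : RAMProgram} {s : Set ℕ} (hc : c.WritesIn s) :
    ∀ i ∈ c, i.IsStraight := by
  intro i hi
  obtain ⟨k, -, hk⟩ := hc i hi
  cases i <;> trivial

theorem WritesIn.exec_apply {c : RAMProgram} {s : Set ℕ} (hc : c.WritesIn s) {k : ℕ}
    (hk : k ∉ s) (R : ℕ → ℝ) : c.exec R k = R k := by
  induction c generalizing R with
  | nil => rfl
  | cons i c ih =>
    obtain ⟨⟨l, hl, hi⟩, hc⟩ := List.forall_mem_cons.1 hc
    rw [exec_cons, ih hc, RAMInstr.exec_apply_of_dest_ne]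
    rintro h
    exact hk (Option.some_injective _ (hi.symm.trans h) ▸ hl)

theorem WritesIn.shift {c : RAMProgram} {t : Set ℕ} (hc : c.WritesIn t) (s : ℕ) :
    WritesIn (c.map (RAMInstr.shift s)) ((s + ·) '' t) := by
  rw [WritesIn, List.forall_mem_map]
  intro i hi
  obtain ⟨k, hk, hdest⟩ := hc i hi
  exact ⟨s + k, ⟨k, hk, rfl⟩, by rw [RAMInstr.dest_shift, hdest]; rfl⟩

theorem exec_shift (s : ℕ) (c : RAMProgram) (R : ℕ → ℝ) :
    (fun k => exec (c.map (RAMInstr.shift s)) R (s + k)) = c.exec fun k => R (s + k) := by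
  induction c generalizing R with
  | nil => rfl
  | cons i c ih => rw [List.map_cons, exec_cons, ih, RAMInstr.exec_shift, exec_cons]

theorem step_of_isStraight {P : RAMProgram} {c : RAMConfig} {i : RAMInstr}
    (hi : P[c.pc]? = some i) (hs : i.IsStraight) (u : ℝ) :
    P.step u c = ⟨c.pc + 1, i.exec c.reg, c.idx⟩ := by
  rw [step, hi]
  cases i <;> first | rfl | exact hs.elim

theorem run_succ (P : RAMProgram) (x : ℕ → ℝ) (ω : RAMTape) (t : ℕ) :
    P.run x ω (t + 1) = P.step (ω t) (P.run x ω t) := rfl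

theorem run_straight {P c : RAMProgram} (hc : ∀ i ∈ c, i.IsStraight) {x R : ℕ → ℝ} {ω : RAMTape}
    {N : ℕ → ℕ} {t p : ℕ} (hP : c <+: P.drop p) (ht : P.run x ω t = ⟨p, R, N⟩) :
    P.run x ω (t + c.length) = ⟨p + c.length, c.exec R, N⟩ := by
  induction c generalizing t p R with
  | nil => exact ht
  | cons i c ih =>
    obtain ⟨d, hd⟩ := hP
    have hget : P[p]? = some i := by
      rw [← List.head?_drop, ← hd]; rfl
    have hdrop : c <+: P.drop (p + 1) := ⟨d, by rw [← List.tail_drop, ← hd]; rfl⟩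
    rw [List.forall_mem_cons] at hc
    have hstep : P.run x ω (t + 1) = ⟨p + 1, i.exec R, N⟩ := by
      rw [run_succ, ht, step_of_isStraight hget hc.1]
    have h := ih hc.2 hdrop hstep
    rwa [show t + 1 + c.length = t + (i :: c).length by simp; omega,
      show p + 1 + c.length = p + (i :: c).length by simp; omega, ← exec_cons] at h

/-- The code that writes fresh random numbers to the `N` registers from `s` on. -/
def sampleCode (s N : ℕ) : RAMProgram :=
  (List.range N).map fun k => .rand (s + k)

theorem run_sampleCode_append {s N t : ℕ} (ht : t ≤ N) (P : RAMProgram) (x : ℕ → ℝ)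
    (ω : RAMTape) :
    (sampleCode s N ++ P : RAMProgram).run x ω t =
      ⟨t, fun k => if s ≤ k ∧ k < s + t then (ω (k - s) : ℝ) else x k, fun _ => 0⟩ := by
  induction t with
  | zero => simp only [add_zero, run, RAMConfig.mk.injEq, true_and, and_true]; grind
  | succ t ih =>
    have hget : (sampleCode s N ++ P : RAMProgram)[t]? = some (.rand (s + t)) := by
      rw [List.getElem?_append_left (by simpa [sampleCode] using ht)]
      simp [sampleCode, Nat.lt_of_succ_le ht]
    rw [run_succ, ih (by omega), step]
    simp only [hget, RAMConfig.mk.injEq, true_and, and_true]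
    funext k
    rcases eq_or_ne k (s + t) with rfl | hk
    · simp
    · rw [Function.update_of_ne hk]
      grind

/-! ### Halting -/

variable {P : RAMProgram} {x : ℕ → ℝ} {ω : RAMTape} {t s : ℕ}

theorem HaltsBy.run_add (h : P.HaltsBy x ω t) (s : ℕ) : P.run x ω (t + s) = P.run x ω t := by
  induction s with
  | zero => rfl
  | succ s ih => rw [← add_assoc, run_succ, ih, step, List.getElem?_eq_none h]

theorem HaltsBy.run_eq (h : P.HaltsBy x ω t) (h' : P.HaltsBy x ω s) :
    P.run x ω t = P.run x ω s := by
  rw [← h.run_add s, add_comm, h'.run_add]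

theorem HaltsBy.mono (h : P.HaltsBy x ω t) (hts : t ≤ s) : P.HaltsBy x ω s := by
  obtain ⟨d, rfl⟩ := Nat.exists_eq_add_of_le hts
  rwa [HaltsBy, h.run_add]

theorem RunsInTime.mono {m n T T' : ℕ} (h : P.RunsInTime m n T) (hT : T ≤ T') :
    P.RunsInTime m n T' :=
  ⟨h.1.trans hT, fun x ω => (h.2 x ω).mono hT⟩

theorem HaltsBy.accepts_iff {m n : ℕ} {x : Samples m n} (h : P.HaltsBy x.toReg ω t) :
    P.Accepts x ω ↔ (P.run x.toReg ω t).reg 0 = 1 :=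
  ⟨fun ⟨_, hs, h1⟩ => by rwa [h.run_eq hs], fun h1 => ⟨t, h, h1⟩⟩

theorem HaltsBy.outputs_iff {m n : ℕ} {x : Samples m n} {v : Fin n → ℝ}
    (h : P.HaltsBy x.toReg ω t) :
    P.Outputs x ω v ↔ ∀ j : Fin n, (P.run x.toReg ω t).reg j = v j :=
  ⟨fun ⟨_, hs, h1⟩ => by rwa [h.run_eq hs], fun h1 => ⟨t, h, h1⟩⟩

end RAMProgram

/-! ### Pre- and postprocessing -/

/-- An instruction of a program of length `len`, to be executed at offset `L`. Jumps beyond the end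
of the program, which halt it, become jumps to the line `L + len`. -/
def RAMInstr.relocate (L len : ℕ) : RAMInstr → RAMInstr
  | .jump j t => .jump j (L + min t len)
  | .idxJump j t => .idxJump j (L + min t len)
  | i => i

namespace RAMProgram

/-- The program that runs `pre`, then `P`, then `post`. -/
def sandwich (pre post P : RAMProgram) : RAMProgram :=
  pre ++ (P.map (RAMInstr.relocate pre.length P.length) ++ post)

variable (pre post P : RAMProgram)

theorem length_sandwich :
    (sandwich pre post P).length = pre.length + P.length + post.length := by
  simp [sandwich, add_assoc]

theorem drop_length_add_length_sandwich :
    (sandwich pre post P).drop (pre.length + P.length) = post := by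
  rw [← List.drop_drop, sandwich, List.drop_left, List.drop_left' (List.length_map _)]

theorem step_sandwich (u : ℝ) {c : RAMConfig} (hc : c.pc < P.length) :
    (sandwich pre post P).step u ⟨pre.length + c.pc, c.reg, c.idx⟩ =
      ⟨pre.length + min (P.step u c).pc P.length, (P.step u c).reg, (P.step u c).idx⟩ := by
  have hP : P[c.pc]? = some P[c.pc] := List.getElem?_eq_getElem hc
  have hget : (sandwich pre post P)[pre.length + c.pc]? =
      some (P[c.pc].relocate pre.length P.length) := by
    rw [sandwich, List.getElem?_append_right (by omega),
      List.getElem?_append_left (by simpa using hc)]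
    simp [hP]
  have hmin : min (c.pc + 1) P.length = c.pc + 1 := min_eq_left hc
  simp only [step, hget, hP]
  cases P[c.pc] <;> simp only [RAMInstr.relocate, hmin, add_assoc]
  all_goals split_ifs <;> simp [hmin]

variable {pre post P} {x y : ℕ → ℝ} {ω : RAMTape}

theorem run_sandwich_of_not_haltsBy
    (hpre : (sandwich pre post P).run x ω pre.length = ⟨pre.length, y, fun _ => 0⟩) {t : ℕ}
    (ht : ∀ s < t, ¬ P.HaltsBy y (fun s => ω (pre.length + s)) s) :
    (sandwich pre post P).run x ω (pre.length + t) =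
      ⟨pre.length + min (P.run y (fun s => ω (pre.length + s)) t).pc P.length,
        (P.run y (fun s => ω (pre.length + s)) t).reg,
        (P.run y (fun s => ω (pre.length + s)) t).idx⟩ := by
  induction t with
  | zero => simpa [run] using hpre
  | succ t ih =>
    have hlt := not_le.1 (ht t t.lt_succ_self)
    rw [← add_assoc, run_succ, ih fun s hs => ht s (hs.trans t.lt_succ_self),
      min_eq_left hlt.le, step_sandwich _ _ _ _ hlt]
    rfl

theorem run_sandwich
    (hpre : (sandwich pre post P).run x ω pre.length = ⟨pre.length, y, fun _ => 0⟩)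
    (hpost : ∀ i ∈ post, i.IsStraight) {T : ℕ}
    (hT : P.HaltsBy y (fun s => ω (pre.length + s)) T) :
    (sandwich pre post P).HaltsBy x ω (pre.length + T + post.length) ∧
      ((sandwich pre post P).run x ω (pre.length + T + post.length)).reg =
        post.exec (P.run y (fun s => ω (pre.length + s)) T).reg := by
  classical
  have hex : ∃ t, P.HaltsBy y (fun s => ω (pre.length + s)) t := ⟨T, hT⟩
  have hle : Nat.find hex ≤ T := Nat.find_le hT
  have hmid := run_sandwich_of_not_haltsBy hpre fun s hs => Nat.find_min hex hs
  have hfirst := Nat.find_spec hex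
  generalize Nat.find hex = t at hle hmid hfirst
  rw [min_eq_right hfirst] at hmid
  have hend := run_straight hpost
    ((drop_length_add_length_sandwich pre post P).symm ▸ List.prefix_rfl) hmid
  have hhalt : (sandwich pre post P).HaltsBy x ω (pre.length + t + post.length) := by
    rw [HaltsBy, hend, length_sandwich]
  have hhalt' := hhalt.mono (Nat.add_le_add_right (Nat.add_le_add_left hle pre.length) _)
  refine ⟨hhalt', ?_⟩
  rw [hhalt'.run_eq hhalt, hend, hT.run_eq hfirst]

end RAMProgram

/-! ### Measurability of runs -/

theorem measurable_update_apply {α β : Type*} [MeasurableSpace α] [MeasurableSpace β]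
    {f : α → ℕ → β} {g : α → β} (i : ℕ) (hf : Measurable f) (hg : Measurable g) :
    Measurable fun a => Function.update (f a) i (g a) := by
  rw [measurable_pi_iff]
  intro j
  rcases eq_or_ne j i with rfl | h
  · simpa only [Function.update_self] using hg
  · simpa only [Function.update_of_ne h] using measurable_pi_iff.1 hf j

theorem measurable_apply_of_countable {α β ι : Type*} [MeasurableSpace α] [MeasurableSpace β]
    [MeasurableSpace ι] [Countable ι] [MeasurableSingletonClass ι] {g : ι → α → β} {f : α → ι}
    (hg : ∀ i, Measurable (g i)) (hf : Measurable f) : Measurable fun a => g (f a) a :=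
  (measurable_from_prod_countable_right (f := fun p : ι × α => g p.1 p.2) hg).comp
    (hf.prodMk measurable_id)

theorem RAMInstr.measurable_exec (c : RAMInstr) : Measurable fun R => c.exec R := by
  cases c with
  | le i j k =>
    exact measurable_update_apply i measurable_id <| Measurable.ite
      (measurableSet_le (measurable_pi_apply j) (measurable_pi_apply k)) (by fun_prop) (by fun_prop)
  | const | add | sub | mul | div =>
    exact measurable_update_apply _ measurable_id (by fun_prop)
  | _ => exact measurable_id

theorem RAMProgram.measurable_exec (c : RAMProgram) : Measurable c.exec := by
  induction c with
  | nil => exact measurable_id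
  | cons i c ih => exact ih.comp i.measurable_exec

/-- Configurations carry the σ-algebra generated by the line number and the registers. -/
instance : MeasurableSpace RAMConfig :=
  MeasurableSpace.comap (fun c => (c.pc, c.reg, c.idx)) inferInstance

namespace RAMConfig

theorem measurable_mk {α : Type*} [MeasurableSpace α] {f : α → ℕ} {g : α → ℕ → ℝ}
    {h : α → ℕ → ℕ} (hf : Measurable f) (hg : Measurable g) (hh : Measurable h) :
    Measurable fun a => (⟨f a, g a, h a⟩ : RAMConfig) :=
  measurable_comap_iff.2 (hf.prodMk (hg.prodMk hh))

theorem measurable_toProd : Measurable fun c : RAMConfig => (c.pc, c.reg, c.idx) :=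
  comap_measurable _

@[fun_prop]
theorem measurable_pc : Measurable pc :=
  measurable_fst.comp measurable_toProd

@[fun_prop]
theorem measurable_reg : Measurable reg :=
  measurable_fst.comp (measurable_snd.comp measurable_toProd)

@[fun_prop]
theorem measurable_idx : Measurable idx :=
  measurable_snd.comp (measurable_snd.comp measurable_toProd)

end RAMConfig

namespace RAMProgram

theorem measurable_step (P : RAMProgram) :
    Measurable fun w : ℝ × RAMConfig => P.step w.1 w.2 := by
  suffices ∀ k : ℕ, Measurable fun w : ℝ × RAMConfig => P.step w.1 ⟨k, w.2.reg, w.2.idx⟩ from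
    measurable_apply_of_countable (f := fun w : ℝ × RAMConfig => w.2.pc) this (by fun_prop)
  intro k
  have hpc (l : ℕ) : Measurable fun _ : ℝ × RAMConfig => l := measurable_const
  have hreg : Measurable fun w : ℝ × RAMConfig => w.2.reg := by fun_prop
  have hreg' (j : ℕ) : Measurable fun w : ℝ × RAMConfig => w.2.reg j := by fun_prop
  have hidx : Measurable fun w : ℝ × RAMConfig => w.2.idx := by fun_prop
  have hidx' (j : ℕ) : Measurable fun w : ℝ × RAMConfig => w.2.idx j := by fun_prop
  rcases h : P[k]? with _ | i
  · simpa only [step, h] using RAMConfig.measurable_mk (hpc k) hreg hidx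
  by_cases hs : i.IsStraight
  · simp only [step_of_isStraight (c := ⟨k, _, _⟩) h hs]
    exact RAMConfig.measurable_mk (hpc _) (i.measurable_exec.comp hreg) hidx
  simp only [step, h]
  cases i with
  | load i j =>
    exact RAMConfig.measurable_mk (hpc _) (measurable_update_apply i hreg
      (measurable_apply_of_countable (g := fun l w => w.2.reg l) hreg' (hidx' j))) hidx
  | store i j =>
    exact RAMConfig.measurable_mk (hpc _) (measurable_apply_of_countable
      (g := fun l (w : ℝ × RAMConfig) => Function.update w.2.reg l (w.2.reg j))
      (fun l => measurable_update_apply l hreg (hreg' j)) (hidx' i)) hidx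
  | rand i =>
    exact RAMConfig.measurable_mk (hpc _) (measurable_update_apply i hreg measurable_fst) hidx
  | jump j t =>
    exact RAMConfig.measurable_mk
      (.ite (measurableSet_lt measurable_const (hreg' j)) (hpc _) (hpc _)) hreg hidx
  | idxJump j t =>
    exact RAMConfig.measurable_mk
      (.ite (measurableSet_lt measurable_const (hidx' j)) (hpc _) (hpc _)) hreg hidx
  | idxConst | idxAdd | idxSub =>
    exact RAMConfig.measurable_mk (hpc _) hreg (measurable_update_apply _ hidx (by fun_prop))
  | _ => exact (hs trivial).elim

theorem measurable_run (P : RAMProgram) (t : ℕ) :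
    Measurable fun w : (ℕ → ℝ) × RAMTape => P.run w.1 w.2 t := by
  induction t with
  | zero => exact RAMConfig.measurable_mk (by fun_prop) (by fun_prop) (by fun_prop)
  | succ t ih =>
    simp only [run_succ]
    exact P.measurable_step.comp (Measurable.prodMk (by fun_prop) ih)

end RAMProgram

theorem Samples.measurable_toReg {m n : ℕ} : Measurable (Samples.toReg : Samples m n → ℕ → ℝ) := by
  rw [measurable_pi_iff]
  intro k
  unfold Samples.toReg
  split_ifs <;> fun_prop

namespace RAMProgram

variable (P : RAMProgram) (m n : ℕ)

theorem measurable_run_toReg (t : ℕ) :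
    Measurable fun w : Samples m n × RAMTape => P.run w.1.toReg w.2 t :=
  (P.measurable_run t).comp (Samples.measurable_toReg.prodMap measurable_id)

theorem measurableSet_haltsBy (t : ℕ) :
    MeasurableSet {w : Samples m n × RAMTape | P.HaltsBy w.1.toReg w.2 t} :=
  measurableSet_le measurable_const (RAMConfig.measurable_pc.comp (P.measurable_run_toReg m n t))

theorem measurableSet_accepts : MeasurableSet {w : Samples m n × RAMTape | P.Accepts w.1 w.2} := by
  simp only [Accepts, Set.ofPred_exists]
  refine MeasurableSet.iUnion fun t => (P.measurableSet_haltsBy m n t).inter ?_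
  exact measurableSet_eq_fun ((measurable_pi_apply 0).comp
    (RAMConfig.measurable_reg.comp (P.measurable_run_toReg m n t))) measurable_const

theorem measurableSet_outputs :
    MeasurableSet {w : ((Fin n → ℝ) × Samples m n) × RAMTape | P.Outputs w.1.2 w.2 w.1.1} := by
  have hdrop : Measurable fun w : ((Fin n → ℝ) × Samples m n) × RAMTape => (w.1.2, w.2) := by
    fun_prop
  simp only [Outputs, Set.ofPred_exists, Set.ofPred_and, Set.ofPred_forall]
  refine MeasurableSet.iUnion fun t => ((P.measurableSet_haltsBy m n t).preimage hdrop).inter ?_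
  refine MeasurableSet.iInter fun j => measurableSet_eq_fun ?_ (by fun_prop)
  exact (measurable_pi_apply (j : ℕ)).comp
    (RAMConfig.measurable_reg.comp ((P.measurable_run_toReg m n t).comp hdrop))

end RAMProgram

/-! ### Reduction modulo a real number -/

theorem realMod_eq_fract (x q : ℝ) (hq : q ≠ 0) : realMod x q = q * Int.fract (x / q) := by
  rw [realMod, Int.fract, mul_sub, mul_div_cancel₀ x hq]

theorem realMod_add_mul_int (x : ℝ) {q : ℝ} (hq : q ≠ 0) (k : ℤ) :
    realMod (x + q * k) q = realMod x q := by
  rw [realMod_eq_fract _ _ hq, realMod_eq_fract _ _ hq, add_div, mul_div_cancel_left₀ _ hq,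
    Int.fract_add_intCast]

theorem realMod_eq_self {x q : ℝ} (h0 : 0 ≤ x) (hq : x < q) : realMod x q = x := by
  rw [realMod_eq_fract _ _ (h0.trans_lt hq).ne', Int.fract_eq_self.2
    ⟨div_nonneg h0 (h0.trans hq.le), (div_lt_one (h0.trans_lt hq)).2 hq⟩,
    mul_div_cancel₀ _ (h0.trans_lt hq).ne']

theorem realMod_one (x : ℝ) : realMod x 1 = Int.fract x := by
  rw [realMod_eq_fract _ _ one_ne_zero, one_mul, div_one]

theorem measurable_realMod (q : ℝ) : Measurable fun x => realMod x q := by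
  unfold realMod
  fun_prop

namespace RAMProgram

/-- Code that reduces `R 0 ∈ [0, 2 ^ K * a)` modulo `a`, by subtracting `2 ^ (K - 1) * a`, …,
`2 * a`, `a` whenever possible. -/
def reduceCode (a : ℝ) : ℕ → RAMProgram
  | 0 => []
  | K + 1 => [.const 2 (2 ^ K * a), .le 3 2 0, .mul 3 3 2, .sub 0 0 3] ++ reduceCode a K

theorem length_reduceCode (a : ℝ) (K : ℕ) : (reduceCode a K).length = 4 * K := by
  induction K with
  | zero => rfl
  | succ K ih => rw [reduceCode, List.length_append, ih, mul_add_one, add_comm]; rfl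

theorem reduceCode_writesIn (a : ℝ) (K : ℕ) : (reduceCode a K).WritesIn {0, 2, 3} := by
  induction K with
  | zero => simp [reduceCode, WritesIn]
  | succ K ih => exact WritesIn.append (by simp [WritesIn, RAMInstr.dest]) ih

theorem exec_reduceCode {a : ℝ} (K : ℕ) (R : ℕ → ℝ) (h0 : 0 ≤ R 0)
    (hR : R 0 < 2 ^ K * a) : exec (reduceCode a K) R 0 = realMod (R 0) a := by
  have ha : 0 < a := pos_of_mul_pos_right (h0.trans_lt hR) (by positivity)
  induction K generalizing R with
  | zero => exact (realMod_eq_self h0 (by simpa using hR)).symm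
  | succ K ih =>
    have hstep : exec [.const 2 (2 ^ K * a), .le 3 2 0, .mul 3 3 2, .sub 0 0 3] R 0 =
        if 2 ^ K * a ≤ R 0 then R 0 - 2 ^ K * a else R 0 := by
      by_cases h : 2 ^ K * a ≤ R 0 <;> simp [exec, RAMInstr.exec, h]
    rw [pow_succ] at hR
    rw [reduceCode, exec_append]
    split_ifs at hstep with h
    · rw [ih _ (by linarith) (by linarith), hstep, ← realMod_add_mul_int (R 0) ha.ne' (-2 ^ K)]
      congr 1
      push_cast
      ring
    · rw [ih _ (by linarith) (by linarith), hstep]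

/-- Code that computes `∑ j < N, a j * R 0 ^ j` in `R 5`, and in `R 7` the number of `j < N` for
which the partial sum up to and including the term number `j` is at most `R 1`. -/
def scanCode (a : ℕ → ℝ) (N : ℕ) : RAMProgram :=
  [.const 5 0, .const 6 1, .const 7 0] ++ (List.range N).flatMap fun j =>
    [.const 2 (a j), .mul 2 2 6, .add 5 5 2, .mul 6 6 0, .le 2 5 1, .add 7 7 2]

theorem scanCode_succ (a : ℕ → ℝ) (N : ℕ) : scanCode a (N + 1) = scanCode a N ++
    [.const 2 (a N), .mul 2 2 6, .add 5 5 2, .mul 6 6 0, .le 2 5 1, .add 7 7 2] := by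
  simp [scanCode, List.range_succ]

theorem length_scanCode (a : ℕ → ℝ) (N : ℕ) : (scanCode a N).length = 6 * N + 3 := by
  induction N with
  | zero => rfl
  | succ N ih => rw [scanCode_succ, List.length_append, ih]; simp; ring

theorem scanCode_writesIn (a : ℕ → ℝ) (N : ℕ) : (scanCode a N).WritesIn {2, 5, 6, 7} := by
  induction N with
  | zero => simp [scanCode, WritesIn, RAMInstr.dest]
  | succ N ih => exact scanCode_succ a N ▸ ih.append (by simp [WritesIn, RAMInstr.dest])

theorem exec_scanCode (a : ℕ → ℝ) (N : ℕ) (R : ℕ → ℝ) :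
    exec (scanCode a N) R 5 = ∑ j ∈ Finset.range N, a j * R 0 ^ j ∧
    exec (scanCode a N) R 6 = R 0 ^ N ∧
    exec (scanCode a N) R 7 =
      {k ∈ Finset.range N | ∑ j ∈ Finset.range (k + 1), a j * R 0 ^ j ≤ R 1}.card := by
  induction N with
  | zero => simp [scanCode, exec, RAMInstr.exec]
  | succ N ih =>
    obtain ⟨hsum, hpow, hcount⟩ := ih
    have h0 : exec (scanCode a N) R 0 = R 0 := (scanCode_writesIn a N).exec_apply (by simp) R
    have h1 : exec (scanCode a N) R 1 = R 1 := (scanCode_writesIn a N).exec_apply (by simp) R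
    rw [scanCode_succ, exec_append]
    generalize exec (scanCode a N) R = R' at *
    simp only [Finset.range_add_one (n := N), Finset.filter_insert, Finset.sum_range_succ] at *
    refine ⟨?_, ?_, ?_⟩
    · simp [exec, RAMInstr.exec, hsum, hpow, add_comm]
    · simp [exec, RAMInstr.exec, hpow, h0, pow_succ]
    · simp [exec, RAMInstr.exec, hsum, hpow, hcount, h1]
      split_ifs <;> simp

end RAMProgram

/-- The parameters of the rounding procedure. -/
structure RoundingParams : Type where
  /-- the modulus -/
  q : ℕ
  /-- the ratio between the width of the numbers to be rounded, after scaling, and the modulus -/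
  τ : ℝ
  /-- the width of the rounding error -/
  t : ℝ
  /-- the number of bits of the integers that can be reduced modulo `q` -/
  K : ℕ
  /-- the number of terms of the exponential series -/
  N : ℕ
  /-- the radius of the truncated discrete Gaussian -/
  Z : ℕ

namespace RoundingParams

variable (p : RoundingParams)

/-- The weight of the integer `j - Z` under the Gaussian of width `t`. -/
def weight (j : ℕ) : ℝ := Real.exp (-Real.pi * (j - p.Z) ^ 2 / p.t ^ 2)

/-- The truncated exponential series for `exp (2π c / t²)`. -/
def expTaylor (c : ℝ) : ℝ :=
  ∑ j ∈ Finset.range p.N, (j.factorial : ℝ)⁻¹ * (2 * Real.pi / p.t ^ 2 * c) ^ j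

/-- The sum of the first `k` among the numbers `weight j * exp (2π j c / t²)`, which up to a factor
that does not depend on `j` are the values of the Gaussian of width `t` at `j - Z - c`. -/
def cumWeight (c : ℝ) (k : ℕ) : ℝ :=
  ∑ j ∈ Finset.range k, p.weight j * p.expTaylor c ^ j

/-- The sample of the truncated discrete Gaussian on `{0, …, 2 * Z}`, centred at `Z + c`, that is
obtained by inversion from the uniform random number `u`. -/
def select (c u : ℝ) : ℕ :=
  {k ∈ Finset.range (2 * p.Z) | p.cumWeight c (k + 1) ≤ u * p.cumWeight c (2 * p.Z + 1)}.card

/-- The integer obtained by randomized rounding of `q * τ * a`. -/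
def roundInt (a u : ℝ) : ℤ :=
  ⌊p.q * p.τ * a⌋ + p.select (Int.fract (p.q * p.τ * a)) u - p.Z

theorem select_le (c u : ℝ) : p.select c u ≤ 2 * p.Z :=
  (Finset.card_filter_le _ _).trans (Finset.card_range _).le

/-- Code that computes `⌊v⌋` in `R 4` and `2π * fract v / t²` in `R 0`, where `v = q * τ * R 0`. -/
def floorCode : RAMProgram :=
  [.const 2 (p.q * p.τ), .mul 0 0 2, .const 2 0, .add 4 0 2, .const 2 (2 ^ p.K), .add 0 0 2] ++
  RAMProgram.reduceCode 1 (p.K + 1) ++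
  [.sub 4 4 0, .const 2 (2 * Real.pi / p.t ^ 2), .mul 0 0 2]

/-- Code that computes `select c (R 1)` in `R 7`, given `2π * c / t²` in `R 0`. -/
def selectCode : RAMProgram :=
  RAMProgram.scanCode (fun j => (j.factorial : ℝ)⁻¹) p.N ++
  [.const 2 0, .add 0 5 2] ++
  RAMProgram.scanCode p.weight (2 * p.Z + 1) ++
  [.mul 1 1 5] ++
  RAMProgram.scanCode p.weight (2 * p.Z)

/-- Code that computes `roundInt (R 0) (R 1)` modulo `q`, as long as all numbers involved are less
than `2 ^ K`. -/
def roundCode : RAMProgram :=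
  p.floorCode ++ p.selectCode ++
  [.add 4 4 7, .const 2 (p.q * 2 ^ p.K - p.Z), .add 0 4 2] ++
  RAMProgram.reduceCode p.q (p.K + 1)

theorem length_roundCode :
    p.roundCode.length = 8 * p.K + 6 * p.N + 24 * p.Z + 38 := by
  simp [roundCode, floorCode, selectCode, RAMProgram.length_reduceCode, RAMProgram.length_scanCode]
  ring

theorem roundCode_writesIn : p.roundCode.WritesIn (Set.Iio 8) := by
  have hreduce (a : ℝ) (K : ℕ) : (RAMProgram.reduceCode a K).WritesIn (Set.Iio 8) :=
    (RAMProgram.reduceCode_writesIn a K).mono (by simp [Set.insert_subset_iff])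
  have hscan (a : ℕ → ℝ) (K : ℕ) : (RAMProgram.scanCode a K).WritesIn (Set.Iio 8) :=
    (RAMProgram.scanCode_writesIn a K).mono (by simp [Set.insert_subset_iff])
  refine .append (.append (.append (.append (.append ?_ (hreduce _ _)) ?_) (.append (.append
    (.append (.append (hscan _ _) ?_) (hscan _ _)) ?_) (hscan _ _))) ?_) (hreduce _ _) <;>
    simp [RAMProgram.WritesIn, RAMInstr.dest]

theorem exec_floorCode (R : ℕ → ℝ) (hR : |p.q * p.τ * R 0| < 2 ^ p.K) :
    p.floorCode.exec R 0 = 2 * Real.pi / p.t ^ 2 * Int.fract (p.q * p.τ * R 0) ∧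
    p.floorCode.exec R 1 = R 1 ∧ p.floorCode.exec R 4 = ⌊p.q * p.τ * R 0⌋ := by
  simp only [floorCode, RAMProgram.exec_append]
  set v : ℝ := p.q * p.τ * R 0 with hv
  set R₁ := RAMProgram.exec
    [.const 2 (p.q * p.τ), .mul 0 0 2, .const 2 0, .add 4 0 2, .const 2 (2 ^ p.K), .add 0 0 2] R
    with hR₁
  have hv0 : R₁ 0 = v + 2 ^ p.K := by simp [hR₁, RAMProgram.exec, RAMInstr.exec, hv, mul_comm]
  have hu : R₁ 1 = R 1 := by simp [hR₁, RAMProgram.exec, RAMInstr.exec]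
  have hv4 : R₁ 4 = v := by simp [hR₁, RAMProgram.exec, RAMInstr.exec, hv, mul_comm]
  set R₂ := RAMProgram.exec (RAMProgram.reduceCode 1 (p.K + 1)) R₁ with hR₂
  have hwrites := RAMProgram.reduceCode_writesIn 1 (p.K + 1)
  rw [← hwrites.exec_apply (k := 1) (by simp) R₁, ← hR₂] at hu
  rw [← hwrites.exec_apply (k := 4) (by simp) R₁, ← hR₂] at hv4
  have hfract : R₂ 0 = Int.fract v := by
    obtain ⟨hlower, hupper⟩ := abs_lt.1 hR
    rw [hR₂, RAMProgram.exec_reduceCode _ _ (by linarith) (by rw [hv0, pow_succ]; linarith), hv0,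
      realMod_one]
    exact_mod_cast Int.fract_add_natCast v (2 ^ p.K)
  simp [RAMProgram.exec_cons, RAMProgram.exec_nil, RAMInstr.exec, hfract, hu, hv4, mul_comm]

theorem exec_selectCode (R : ℕ → ℝ) {c : ℝ} (hc : R 0 = 2 * Real.pi / p.t ^ 2 * c) :
    p.selectCode.exec R 7 = p.select c (R 1) ∧ p.selectCode.exec R 4 = R 4 := by
  have hscan {k : ℕ} (hk : k ∉ ({2, 5, 6, 7} : Set ℕ)) (a : ℕ → ℝ) (N : ℕ) (R : ℕ → ℝ) :
      RAMProgram.exec (RAMProgram.scanCode a N) R k = R k :=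
    (RAMProgram.scanCode_writesIn a N).exec_apply hk R
  have hcum (k : ℕ) (R : ℕ → ℝ) (h0 : R 0 = p.expTaylor c) :
      RAMProgram.exec (RAMProgram.scanCode p.weight k) R 5 = p.cumWeight c k := by
    rw [(RAMProgram.exec_scanCode _ _ _).1, h0, cumWeight]
  simp only [selectCode, RAMProgram.exec_append]
  set R₁ := RAMProgram.exec [.const 2 0, .add 0 5 2]
    (RAMProgram.exec (RAMProgram.scanCode (fun j => (j.factorial : ℝ)⁻¹) p.N) R) with hR₁
  have hbase : R₁ 0 = p.expTaylor c := by
    simp [hR₁, RAMProgram.exec_cons, RAMProgram.exec_nil, RAMInstr.exec, expTaylor,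
      (RAMProgram.exec_scanCode _ _ _).1, hc]
  have hu : R₁ 1 = R 1 := by
    simp [hR₁, RAMProgram.exec_cons, RAMProgram.exec_nil, RAMInstr.exec, hscan]
  have hfloor : R₁ 4 = R 4 := by
    simp [hR₁, RAMProgram.exec_cons, RAMProgram.exec_nil, RAMInstr.exec, hscan]
  set R₂ := RAMProgram.exec [.mul 1 1 5]
    (RAMProgram.exec (RAMProgram.scanCode p.weight (2 * p.Z + 1)) R₁) with hR₂
  have hbase' : R₂ 0 = p.expTaylor c := by
    simp [hR₂, RAMProgram.exec_cons, RAMProgram.exec_nil, RAMInstr.exec, hscan, hbase]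
  have hthreshold : R₂ 1 = R 1 * p.cumWeight c (2 * p.Z + 1) := by
    simp [hR₂, RAMProgram.exec_cons, RAMProgram.exec_nil, RAMInstr.exec, hscan, hcum, hbase, hu]
  have hfloor' : R₂ 4 = R 4 := by
    simp [hR₂, RAMProgram.exec_cons, RAMProgram.exec_nil, RAMInstr.exec, hscan, hfloor]
  refine ⟨?_, (hscan (by simp) _ _ _).trans hfloor'⟩
  rw [(RAMProgram.exec_scanCode _ _ _).2.2, hbase', hthreshold]
  rfl

theorem exec_roundCode (hq : 0 < p.q) (R : ℕ → ℝ)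
    (hR : |p.q * p.τ * R 0| + p.Z + 1 ≤ 2 ^ p.K) :
    p.roundCode.exec R 0 = realMod (p.roundInt (R 0) (R 1)) p.q := by
  obtain ⟨hbase, hu, hfloor⟩ := p.exec_floorCode R (by linarith [p.Z.cast_nonneg (α := ℝ)])
  obtain ⟨hselect, hfloor'⟩ := p.exec_selectCode _ hbase
  simp only [roundCode, RAMProgram.exec_append]
  set R₁ := RAMProgram.exec [.add 4 4 7, .const 2 (p.q * 2 ^ p.K - p.Z), .add 0 4 2]
    (p.selectCode.exec (p.floorCode.exec R)) with hR₁
  have hR₁0 : R₁ 0 = p.roundInt (R 0) (R 1) + p.q * 2 ^ p.K := by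
    simp [hR₁, RAMProgram.exec_cons, RAMProgram.exec_nil, RAMInstr.exec, hselect, hfloor', hfloor,
      hu, roundInt]
    ring
  have hbound : |(p.roundInt (R 0) (R 1) : ℝ)| < 2 ^ p.K := by
    have hle : (p.select (Int.fract (p.q * p.τ * R 0)) (R 1) : ℝ) ≤ 2 * p.Z :=
      mod_cast p.select_le _ _
    have hfloor_le := Int.floor_le (p.q * p.τ * R 0)
    have hlt_floor := Int.lt_floor_add_one (p.q * p.τ * R 0)
    rw [roundInt, abs_lt]
    push_cast
    constructor <;> linarith [le_abs_self (p.q * p.τ * R 0), neg_abs_le (p.q * p.τ * R 0),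
      (p.select (Int.fract (p.q * p.τ * R 0)) (R 1)).cast_nonneg (α := ℝ)]
  have hpow : (2 : ℝ) ^ p.K ≤ p.q * 2 ^ p.K :=
    le_mul_of_one_le_left (by positivity) (mod_cast hq)
  obtain ⟨hlower, hupper⟩ := abs_lt.1 hbound
  rw [RAMProgram.exec_reduceCode _ _ (by linarith) (by rw [hR₁0, pow_succ]; linarith), hR₁0]
  simpa only [Int.cast_pow, Int.cast_ofNat] using
    realMod_add_mul_int _ (Nat.cast_ne_zero.2 hq.ne') (2 ^ p.K)

theorem measurable_expTaylor : Measurable p.expTaylor := by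
  unfold expTaylor
  fun_prop

theorem measurable_cumWeight (k : ℕ) : Measurable fun c => p.cumWeight c k := by
  unfold cumWeight
  exact Finset.measurable_fun_sum _ fun j _ => (p.measurable_expTaylor.pow_const j).const_mul _

theorem measurable_select : Measurable fun w : ℝ × ℝ => p.select w.1 w.2 := by
  simp only [select, Finset.card_filter]
  have hcum (k : ℕ) : Measurable fun w : ℝ × ℝ => p.cumWeight w.1 k :=
    (p.measurable_cumWeight k).comp measurable_fst
  exact Finset.measurable_fun_sum _ fun k _ => Measurable.ite
    (measurableSet_le (hcum _) (measurable_snd.mul (hcum _))) measurable_const measurable_const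

theorem measurable_roundInt : Measurable fun w : ℝ × ℝ => p.roundInt w.1 w.2 := by
  have hv : Measurable fun w : ℝ × ℝ => p.q * p.τ * w.1 := by fun_prop
  have hselect := p.measurable_select.comp (hv.fract.prodMk measurable_snd)
  have hcast : Measurable ((↑) : ℕ → ℤ) := measurable_from_top
  exact ((hv.floor.add (hcast.comp hselect)).sub_const (p.Z : ℤ) :)

end RoundingParams

/-! ### Randomized transformation of the input, entry by entry -/

namespace RAMProgram

/-- Code that clears the `N` registers from `s` on. -/
def clearCode (s N : ℕ) : RAMProgram :=
  (List.range N).map fun k => .const (s + k) 0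

theorem clearCode_writesIn (s N : ℕ) : (clearCode s N).WritesIn {k | s ≤ k} := by
  simp [clearCode, WritesIn, RAMInstr.dest]

theorem exec_clearCode (s N : ℕ) (R : ℕ → ℝ) :
    exec (clearCode s N) R = fun k => if s ≤ k ∧ k < s + N then 0 else R k := by
  induction N with
  | zero => funext k; rw [if_neg (by omega)]; rfl
  | succ N ih =>
    have hsucc : clearCode s (N + 1) = clearCode s N ++ [.const (s + N) 0] := by
      simp [clearCode, List.range_succ]
    rw [hsucc, exec_append, ih, exec_cons, exec_nil, RAMInstr.exec]
    funext k
    rw [Function.update_apply]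
    grind

/-- The number that straight-line code computes in `R 0` from the inputs `a` in `R 0` and `u` in
`R 1`. -/
def eval (c : RAMProgram) (a u : ℝ) : ℝ :=
  c.exec (Function.update (Function.update 0 0 a) 1 u) 0

theorem measurable_eval (c : RAMProgram) : Measurable fun w : ℝ × ℝ => c.eval w.1 w.2 :=
  (measurable_pi_apply 0).comp <| c.measurable_exec.comp <|
    measurable_update_apply 1 (measurable_update_apply 0 measurable_const measurable_fst)
      measurable_snd

/-- Code that replaces `R k` by `c.eval (R k) (R l)`, where `c` writes to `R 0, …, R 7` only. All
registers from `s` on have to be zero; the first eight of them serve as the registers of `c`, and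
`R (s + 8)` serves as a zero. -/
def blockCode (c : RAMProgram) (k l s : ℕ) : RAMProgram :=
  [.add s k (s + 8), .add (s + 1) l (s + 8)] ++ c.map (RAMInstr.shift s) ++
    [.add k s (s + 8)] ++ clearCode s 8

theorem blockCode_isStraight {c : RAMProgram} {t : Set ℕ} (hc : c.WritesIn t) (k l s : ℕ) :
    ∀ i ∈ blockCode c k l s, i.IsStraight := by
  have huniv {c : RAMProgram} {t : Set ℕ} (hc : c.WritesIn t) : c.WritesIn Set.univ :=
    hc.mono (Set.subset_univ t)
  refine WritesIn.isStraight (s := Set.univ) (.append (.append (.append ?_ (huniv (hc.shift s))) ?_)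
    (huniv (clearCode_writesIn s 8))) <;> simp [WritesIn, RAMInstr.dest]

theorem length_blockCode (c : RAMProgram) (k l s : ℕ) :
    (blockCode c k l s).length = c.length + 11 := by
  simp [blockCode, clearCode]

theorem exec_blockCode {c : RAMProgram} (hc : c.WritesIn (Set.Iio 8)) {k l s : ℕ} (hk : k < s)
    (hl : l < s) {R : ℕ → ℝ} (hR : ∀ i, s ≤ i → R i = 0) :
    exec (blockCode c k l s) R = Function.update R k (c.eval (R k) (R l)) := by
  simp only [blockCode, exec_append]
  set R₁ := exec [.add s k (s + 8), .add (s + 1) l (s + 8)] R with hR₁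
  have hinput : (fun i => R₁ (s + i)) =
      Function.update (Function.update (0 : ℕ → ℝ) 0 (R k)) 1 (R l) := by
    funext i
    simp [hR₁, exec_cons, exec_nil, RAMInstr.exec, Function.update_apply, hR, hl.ne]
  have hbelow : ∀ i < s, R₁ i = R i := by
    intro i hi
    simp [hR₁, exec_cons, exec_nil, RAMInstr.exec, Function.update_apply, hi.ne,
      (hi.trans s.lt_succ_self).ne]
  have habove : ∀ i, s + 8 ≤ i → R₁ i = 0 := by
    intro i hi
    simp [hR₁, exec_cons, exec_nil, RAMInstr.exec, Function.update_apply, hR i (by omega),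
      show i ≠ s by omega, show i ≠ s + 1 by omega]
  set R₂ := exec (c.map (RAMInstr.shift s)) R₁
  have houtput : R₂ s = c.eval (R k) (R l) :=
    (congrFun ((exec_shift s c R₁).trans (congrArg c.exec hinput)) 0 :)
  have hframe : ∀ i, i < s ∨ s + 8 ≤ i → R₂ i = R₁ i := fun i hi =>
    (hc.shift s).exec_apply (by rintro ⟨j, hj : j < 8, rfl⟩; dsimp only at hi; omega) R₁
  rw [exec_clearCode, exec_cons, exec_nil, RAMInstr.exec, houtput,
    (hframe (s + 8) (.inr le_rfl)).trans (habove _ le_rfl), add_zero]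
  funext i
  simp only [Function.update_apply]
  grind

/-- Code that replaces, for every `k < N`, the number `R k` by `(c k).eval (R k) u` with a fresh
random number `u`. -/
def mapCode (c : ℕ → RAMProgram) (N : ℕ) : RAMProgram :=
  sampleCode N N ++ ((List.range N).flatMap (fun k => blockCode (c k) k (N + k) (2 * N)) ++
    clearCode N N)

theorem length_mapCode_le {c : ℕ → RAMProgram} {N L : ℕ} (hc : ∀ k < N, (c k).length ≤ L) :
    (mapCode c N).length ≤ N * (L + 13) := by
  have hblocks : ((List.range N).map fun k => (c k).length + 11).sum ≤ N * (L + 11) := by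
    simpa using List.sum_le_card_nsmul ((List.range N).map fun k => (c k).length + 11) (L + 11)
      (by simpa using hc)
  simp only [mapCode, sampleCode, clearCode, List.length_append, List.length_map, List.length_range,
    List.length_flatMap, length_blockCode]
  linarith

theorem exec_flatMap_blockCode {c : ℕ → RAMProgram} (hc : ∀ k, (c k).WritesIn (Set.Iio 8))
    {N l : ℕ} (hl : l ≤ N) {R : ℕ → ℝ} (hR : ∀ i, 2 * N ≤ i → R i = 0) :
    exec ((List.range l).flatMap fun k => blockCode (c k) k (N + k) (2 * N)) R =
      fun i => if i < l then (c i).eval (R i) (R (N + i)) else R i := by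
  induction l with
  | zero => simp [exec]
  | succ l ih =>
    rw [List.range_succ, List.flatMap_append, exec_append, ih (by omega), List.flatMap_singleton,
      exec_blockCode (hc l) (by omega) (by omega) (by grind)]
    funext i
    rw [Function.update_apply]
    grind

theorem run_mapCode_append {c : ℕ → RAMProgram} (hc : ∀ k, (c k).WritesIn (Set.Iio 8)) {N : ℕ}
    (P : RAMProgram) {x : ℕ → ℝ} (hx : ∀ i, N ≤ i → x i = 0) (ω : RAMTape) :
    (mapCode c N ++ P : RAMProgram).run x ω (mapCode c N).length =
      ⟨(mapCode c N).length, fun k => if k < N then (c k).eval (x k) (ω k) else 0, fun _ => 0⟩ := by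
  have hstraight : ∀ i ∈ (List.range N).flatMap (fun k => blockCode (c k) k (N + k) (2 * N)) ++
      clearCode N N, i.IsStraight := by
    refine List.forall_mem_append.2 ⟨fun i hi => ?_, (clearCode_writesIn N N).isStraight⟩
    obtain ⟨k, -, hi⟩ := List.mem_flatMap.1 hi
    exact blockCode_isStraight (hc k) _ _ _ i hi
  have hsample : (sampleCode N N).length = N := by simp [sampleCode]
  rw [mapCode, List.append_assoc, List.length_append, hsample,
    run_straight hstraight ?_ (run_sampleCode_append le_rfl _ x ω)]
  · rw [exec_append, exec_flatMap_blockCode hc le_rfl (by grind), exec_clearCode]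
    simp only [RAMConfig.mk.injEq, true_and, and_true]
    funext k
    grind
  · rw [List.drop_left' hsample]
    exact List.prefix_append _ _

end RAMProgram

/-! ### The reduction as a program -/

namespace RAMProgram

/-- Code that multiplies `R 0, …, R (n - 1)` by `c`. -/
def rescaleCode (n : ℕ) (c : ℝ) : RAMProgram :=
  .const n c :: (List.range n).map fun j => .mul j j n

theorem length_rescaleCode (n : ℕ) (c : ℝ) : (rescaleCode n c).length = n + 1 := by
  simp [rescaleCode]

theorem rescaleCode_isStraight (n : ℕ) (c : ℝ) : ∀ i ∈ rescaleCode n c, i.IsStraight := by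
  simp [rescaleCode, RAMInstr.IsStraight]

theorem exec_rescaleCode (n : ℕ) (c : ℝ) (R : ℕ → ℝ) {j : ℕ} (hj : j < n) :
    exec (rescaleCode n c) R j = R j * c := by
  have hloop : ∀ k ≤ n, ∀ R : ℕ → ℝ, exec ((List.range k).map fun j => .mul j j n) R =
      fun i => if i < k then R i * R n else R i := by
    intro k hk R
    induction k with
    | zero => simp [exec]
    | succ k ih =>
      rw [List.range_succ, List.map_append, exec_append, ih (by omega), List.map_singleton,
        exec_cons, exec_nil, RAMInstr.exec]
      funext i
      rw [Function.update_apply]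
      grind
  rw [rescaleCode, exec_cons, hloop n le_rfl, RAMInstr.exec]
  simp [hj, hj.ne]

end RAMProgram

namespace RoundingParams

variable (p : RoundingParams) {m n : ℕ}

/-- The code for the entry number `k` of an array of samples in dimension `n`: the vectors `a i` are
rounded and the numbers `b i` are multiplied by `q`. -/
def entryCode (n k : ℕ) : RAMProgram :=
  if k % (n + 1) < n then p.roundCode else [.const 2 p.q, .mul 0 0 2]

theorem entryCode_writesIn (n k : ℕ) : (p.entryCode n k).WritesIn (Set.Iio 8) := by
  rw [entryCode]
  split_ifs
  · exact p.roundCode_writesIn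
  · simp [RAMProgram.WritesIn, RAMInstr.dest]

theorem length_entryCode_le (n k : ℕ) :
    (p.entryCode n k).length ≤ 8 * p.K + 6 * p.N + 24 * p.Z + 38 := by
  rw [entryCode]
  split_ifs
  · exact p.length_roundCode.le
  · simp only [List.length_cons, List.length_nil]
    omega

/-- The effect of the entry codes on an array of samples. -/
def transform (x : Samples m n) (u : Fin m → Fin n → unitInterval) : Samples m n :=
  fun i => (fun j => p.roundCode.eval ((x i).1 j) (u i j), p.q * (x i).2)

theorem measurable_transform :
    Measurable fun w : Samples m n × (Fin m → Fin n → unitInterval) => p.transform w.1 w.2 := by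
  refine measurable_pi_iff.2 fun i => Measurable.prodMk (measurable_pi_iff.2 fun j => ?_) ?_
  · have hentry : Measurable fun w : Samples m n × (Fin m → Fin n → unitInterval) =>
        ((w.1 i).1 j, (w.2 i j : ℝ)) := by fun_prop
    exact (p.roundCode.measurable_eval.comp hentry :)
  · fun_prop

theorem toReg_transform (x : Samples m n) (ω : RAMTape) :
    (p.transform x fun i j => ω (i * (n + 1) + j)).toReg = fun k =>
      if k < m * (n + 1) then (p.entryCode n k).eval (x.toReg k) (ω k) else 0 := by
  funext k
  have hlt : k / (n + 1) < m ↔ k < m * (n + 1) := Nat.div_lt_iff_lt_mul n.succ_pos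
  by_cases hk : k < m * (n + 1)
  · by_cases hj : k % (n + 1) < n
    · simp [Samples.toReg, transform, entryCode, hlt, hk, hj, Nat.div_add_mod']
    · simp [Samples.toReg, transform, entryCode, hlt, hk, hj, RAMProgram.eval, RAMProgram.exec,
        RAMInstr.exec, mul_comm]
  · simp [Samples.toReg, hlt, hk]

/-- The program that transforms an array of `m` samples in dimension `n`, then runs `P` on the
result, then `post`. -/
def reduction (m n : ℕ) (post P : RAMProgram) : RAMProgram :=
  RAMProgram.sandwich (RAMProgram.mapCode (p.entryCode n) (m * (n + 1))) post P

/-- A bound for the time that the transformation of an array of `m` samples in dimension `n`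
takes. -/
def transformTime (m n : ℕ) : ℕ := m * (n + 1) * (8 * p.K + 6 * p.N + 24 * p.Z + 51)

/-- The line at which the reduction on `m` samples in dimension `n` has transformed its input. -/
def offset (m n : ℕ) : ℕ := (RAMProgram.mapCode (p.entryCode n) (m * (n + 1))).length

theorem offset_le_transformTime : p.offset m n ≤ p.transformTime m n :=
  RAMProgram.length_mapCode_le fun k _ => p.length_entryCode_le n k

variable {post P : RAMProgram} {T : ℕ}

theorem run_reduction (hpost : ∀ i ∈ post, i.IsStraight) (hP : P.RunsInTime m n T)
    (x : Samples m n) (ω : RAMTape) :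
    (p.reduction m n post P).HaltsBy x.toReg ω (p.offset m n + T + post.length) ∧
    ((p.reduction m n post P).run x.toReg ω (p.offset m n + T + post.length)).reg = post.exec
      (P.run (p.transform x fun i j => ω (i * (n + 1) + j)).toReg
        (fun t => ω (p.offset m n + t)) T).reg := by
  refine RAMProgram.run_sandwich ?_ hpost (hP.2 _ _)
  rw [toReg_transform, RAMProgram.sandwich]
  refine RAMProgram.run_mapCode_append (p.entryCode_writesIn n) _ (fun k hk => ?_) ω
  rw [Samples.toReg, dif_neg]
  rwa [Nat.div_lt_iff_lt_mul n.succ_pos, not_lt]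

theorem runsInTime_reduction (hpost : ∀ i ∈ post, i.IsStraight) (hP : P.RunsInTime m n T) :
    (p.reduction m n post P).RunsInTime m n (T + p.transformTime m n + post.length) := by
  have hle := p.offset_le_transformTime (m := m) (n := n)
  refine ⟨?_, fun x ω => (p.run_reduction hpost hP x ω).1.mono (by omega)⟩
  rw [reduction, RAMProgram.length_sandwich, ← offset]
  have := hP.1
  omega

theorem reduction_accepts_iff (hP : P.RunsInTime m n T) (x : Samples m n) (ω : RAMTape) :
    (p.reduction m n [] P).Accepts x ω ↔
      P.Accepts (p.transform x fun i j => ω (i * (n + 1) + j)) fun t => ω (p.offset m n + t) := by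
  obtain ⟨hhalts, hreg⟩ := p.run_reduction (post := []) (by simp) hP x ω
  rw [hhalts.accepts_iff, (hP.2 _ _).accepts_iff, hreg, RAMProgram.exec_nil]

theorem reduction_outputs_iff (hP : P.RunsInTime m n T) {c : ℝ} (hc : c ≠ 0) (x : Samples m n)
    (ω : RAMTape) (v : Fin n → ℝ) :
    (p.reduction m n (RAMProgram.rescaleCode n c⁻¹) P).Outputs x ω v ↔
      P.Outputs (p.transform x fun i j => ω (i * (n + 1) + j)) (fun t => ω (p.offset m n + t))
        (c • v) := by
  obtain ⟨hhalts, hreg⟩ := p.run_reduction (RAMProgram.rescaleCode_isStraight n c⁻¹) hP x ω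
  rw [hhalts.outputs_iff, (hP.2 _ _).outputs_iff, hreg]
  refine forall_congr' fun j => ?_
  rw [RAMProgram.exec_rescaleCode n _ _ j.2, Pi.smul_apply, smul_eq_mul, ← div_eq_mul_inv,
    div_eq_iff hc, mul_comm]

end RoundingParams

/-! ### Product measures -/

section ProductMeasures

variable {ι α β γ δ : Type*} [Fintype ι] [MeasurableSpace α] [MeasurableSpace β]
  [MeasurableSpace γ] [MeasurableSpace δ]

theorem pi_le_pi_of_le {μ ν : ι → Measure α} (h : ∀ i, μ i ≤ ν i) :
    Measure.pi μ ≤ Measure.pi ν := by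
  rw [Measure.le_iff]
  intro s hs
  rw [Measure.pi_def, Measure.pi_def, toMeasure_apply _ _ hs, toMeasure_apply _ _ hs]
  suffices OuterMeasure.pi (fun i => (μ i).toOuterMeasure) ≤
    OuterMeasure.pi fun i => (ν i).toOuterMeasure from this s
  rw [OuterMeasure.pi, OuterMeasure.pi, OuterMeasure.le_boundedBy]
  exact fun t => (OuterMeasure.boundedBy_le t).trans
    (Finset.prod_le_prod' fun i _ => h i (Function.eval i '' t))

theorem pi_le_smul_pi {μ ν : ι → Measure α} [∀ i, IsFiniteMeasure (ν i)] {c : ENNReal}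
    (hc : c ≠ ⊤) (h : ∀ i, μ i ≤ c • ν i) :
    Measure.pi μ ≤ c ^ Fintype.card ι • Measure.pi ν := by
  have hfinite (i : ι) : IsFiniteMeasure (c • ν i) := (ν i).smul_finite hc
  refine (pi_le_pi_of_le h).trans_eq (Measure.pi_eq fun s _ => ?_)
  simp only [Measure.smul_apply, smul_eq_mul, Measure.pi_pi, Finset.prod_mul_distrib,
    Finset.prod_const, Finset.card_univ]

theorem map_pi_prod_pi {μ : ι → Measure α} {ν : ι → Measure β} [∀ i, IsProbabilityMeasure (μ i)]
    [∀ i, IsProbabilityMeasure (ν i)] {f : α × β → γ} (hf : Measurable f) :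
    ((Measure.pi μ).prod (Measure.pi ν)).map (fun w i => f (w.1 i, w.2 i)) =
      Measure.pi fun i => ((μ i).prod (ν i)).map f := by
  have (i : ι) : IsProbabilityMeasure (((μ i).prod (ν i)).map f) :=
    Measure.isProbabilityMeasure_map hf.aemeasurable
  rw [← Measure.pi_map_pi fun i => hf.aemeasurable,
    ← (measurePreserving_arrowProdEquivProdArrow α β ι μ ν).map_eq,
    Measure.map_map (by fun_prop) (MeasurableEquiv.measurable _)]
  rfl

theorem map_pi_prod_pi_le_smul {μ : Measure α} {ν : Measure β} {μ' : Measure γ} {ν' : Measure δ}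
    [IsProbabilityMeasure μ] [IsProbabilityMeasure ν] [IsFiniteMeasure μ'] [IsFiniteMeasure ν']
    {f : α × β → γ × δ} (hf : Measurable f) {c : ENNReal} (hc : c ≠ ⊤)
    (h : (μ.prod ν).map f ≤ c • μ'.prod ν') :
    ((Measure.pi fun _ : ι => μ).prod (Measure.pi fun _ : ι => ν)).map
      (fun w => ((fun i => (f (w.1 i, w.2 i)).1), fun i => (f (w.1 i, w.2 i)).2)) ≤
      c ^ Fintype.card ι • (Measure.pi fun _ : ι => μ').prod (Measure.pi fun _ : ι => ν') := by
  have hunzip := measurePreserving_arrowProdEquivProdArrow γ δ ι (fun _ => μ') fun _ => ν'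
  rw [← hunzip.map_eq, ← Measure.map_smul]
  refine le_of_eq_of_le ?_ (Measure.map_mono (pi_le_smul_pi hc fun _ => h) hunzip.measurable)
  rw [← map_pi_prod_pi hf, Measure.map_map hunzip.measurable (by fun_prop)]
  rfl

end ProductMeasures

/-! ### Splitting the random tape -/

section InfiniteProduct

variable {ι κ X : Type*} [MeasurableSpace X] (μ : Measure X) [IsProbabilityMeasure μ]

theorem map_comp_infinitePi_of_injective {e : κ → ι} (he : Function.Injective e) :
    (Measure.infinitePi fun _ : ι => μ).map (fun ω k => ω (e k)) =
      Measure.infinitePi fun _ : κ => μ := by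
  classical
  refine Measure.eq_infinitePi _ fun s t ht => ?_
  rw [Measure.map_apply (by fun_prop) (MeasurableSet.pi s.countable_toSet fun i _ => ht i)]
  rcases isEmpty_or_nonempty κ with hκ | hκ
  · simp [Finset.eq_empty_of_isEmpty s]
  have hpreimage : (fun (ω : ι → X) k => ω (e k)) ⁻¹' (s : Set κ).pi t =
      ((s.map ⟨e, he⟩ : Finset ι) : Set ι).pi fun i => t (Function.invFun e i) := by
    ext ω
    simp [Set.mem_pi, Function.leftInverse_invFun he _]
  rw [hpreimage, Measure.infinitePi_pi _ fun i _ => ht _, Finset.prod_map]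
  simp [Function.leftInverse_invFun he _]

theorem measurable_sumElim :
    Measurable fun w : (ι → X) × (κ → X) => (Sum.elim w.1 w.2 : ι ⊕ κ → X) := by
  rw [measurable_pi_iff]
  rintro (k | k) <;> simp only [Sum.elim_inl, Sum.elim_inr] <;> fun_prop

theorem map_sumElim_infinitePi [Countable ι] [Countable κ] :
    ((Measure.infinitePi fun _ : ι => μ).prod (Measure.infinitePi fun _ : κ => μ)).map
      (fun w => (Sum.elim w.1 w.2 : ι ⊕ κ → X)) = Measure.infinitePi fun _ => μ := by
  classical
  refine Measure.eq_infinitePi _ fun s t ht => ?_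
  rw [Measure.map_apply measurable_sumElim
    (MeasurableSet.pi s.countable_toSet fun i _ => ht i)]
  have hpreimage : (fun w : (ι → X) × (κ → X) => (Sum.elim w.1 w.2 : ι ⊕ κ → X)) ⁻¹'
      (s : Set _).pi t = ((s.toLeft : Set ι).pi fun k => t (Sum.inl k)) ×ˢ
        ((s.toRight : Set κ).pi fun k => t (Sum.inr k)) := by
    ext w
    simp [Set.mem_pi, Sum.forall]
  rw [hpreimage, Measure.prod_prod, Measure.infinitePi_pi _ fun i _ => ht _,
    Measure.infinitePi_pi _ fun i _ => ht _]
  conv_rhs => rw [← Finset.toLeft_disjSum_toRight (u := s), Finset.prod_disjSum]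

theorem map_infinitePi_of_injective_sumElim [Countable ι] {κ' : Type*} [Countable κ] [Countable κ']
    {e : κ → ι} {e' : κ' → ι} (he : Function.Injective (Sum.elim e e')) :
    (Measure.infinitePi fun _ : ι => μ).map (fun ω => ((fun k => ω (e k)), fun k => ω (e' k))) =
      (Measure.infinitePi fun _ : κ => μ).prod (Measure.infinitePi fun _ : κ' => μ) := by
  have hsplit : Measurable fun y : κ ⊕ κ' → X =>
      ((fun k => y (Sum.inl k)), fun k => y (Sum.inr k)) := by fun_prop
  have h := congrArg (Measure.map fun y : κ ⊕ κ' → X =>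
    ((fun k => y (Sum.inl k)), fun k => y (Sum.inr k)))
    ((map_comp_infinitePi_of_injective μ he).trans (map_sumElim_infinitePi μ).symm)
  rw [Measure.map_map hsplit (by fun_prop), Measure.map_map hsplit measurable_sumElim] at h
  exact h.trans Measure.map_id

end InfiniteProduct

instance : IsProbabilityMeasure ramTapeMeasure :=
  inferInstanceAs (IsProbabilityMeasure (Measure.infinitePi _))

/-- The distribution of independent random numbers in `[0, 1]`, one for each entry of an `m × n`
matrix. -/
def coinMatrix (m n : ℕ) : Measure (Fin m → Fin n → unitInterval) :=
  Measure.pi fun _ => Measure.pi fun _ => volume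

instance (m n : ℕ) : IsProbabilityMeasure (coinMatrix m n) :=
  inferInstanceAs (IsProbabilityMeasure (Measure.pi _))

theorem measurePreserving_splitTape {m n L : ℕ} (hL : m * (n + 1) ≤ L) :
    MeasurePreserving (fun ω : RAMTape =>
      ((fun (i : Fin m) (j : Fin n) => ω (i * (n + 1) + j)), fun t => ω (L + t)))
      ramTapeMeasure ((coinMatrix m n).prod ramTapeMeasure) := by
  refine ⟨by fun_prop, ?_⟩
  have hinj : Function.Injective (Sum.elim (fun ij : Fin m × Fin n => (ij.1 * (n + 1) + ij.2 : ℕ))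
      (L + ·)) := by
    refine Function.Injective.sumElim ?_ (add_right_injective L) fun ij t => ?_
    · rintro ⟨i, j⟩ ⟨i', j'⟩ h
      have hdiv := congrArg (· / (n + 1)) h
      have hmod := congrArg (· % (n + 1)) h
      simp only [mul_comm _ (n + 1), Nat.mul_add_div n.succ_pos, Nat.mul_add_mod, add_zero,
        Nat.div_eq_of_lt (Nat.lt_succ_of_lt (Fin.is_lt _)),
        Nat.mod_eq_of_lt (Nat.lt_succ_of_lt (Fin.is_lt _))] at hdiv hmod
      exact Prod.ext (Fin.ext hdiv) (Fin.ext hmod)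
    · have := Nat.mul_le_mul_right (n + 1) (Nat.succ_le_of_lt ij.1.2)
      have := ij.2.2
      rw [Nat.succ_mul] at *
      omega
  have h := map_infinitePi_of_injective_sumElim (volume : Measure unitInterval) hinj
  have hcurry : Measure.map (MeasurableEquiv.curry (Fin m) (Fin n) unitInterval)
      (Measure.infinitePi fun _ => volume) = coinMatrix m n := by
    rw [Measure.infinitePi_map_curry fun (_ : Fin m) (_ : Fin n) => (volume : Measure unitInterval)]
    simp only [Measure.infinitePi_eq_pi, coinMatrix]
  rw [← hcurry, ← Measure.map_id (μ := ramTapeMeasure), ramTapeMeasure,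
    Measure.map_prod_map _ _ (by fun_prop) measurable_id, ← h, Measure.map_id,
    Measure.map_map (by fun_prop) (by fun_prop)]
  rfl

/-! ### Statistical distance -/

/-- The statistical distance of two probability measures is at most `δ`: the probabilities of all
events differ by at most `δ`. -/
def TVClose {α : Type*} [MeasurableSpace α] (μ ν : Measure α) (δ : ENNReal) : Prop :=
  ∀ A, MeasurableSet A → μ A ≤ ν A + δ ∧ ν A ≤ μ A + δ

namespace TVClose

variable {α β : Type*} [MeasurableSpace α] [MeasurableSpace β] {μ ν ρ : Measure α}
  {δ δ' : ENNReal}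

theorem of_le_smul [IsProbabilityMeasure μ] [IsProbabilityMeasure ν] {c : ENNReal}
    (hc : c ≤ 1 + δ) (h : μ ≤ c • ν) : TVClose μ ν δ := by
  have hle (A : Set α) : μ A ≤ ν A + δ := calc
    μ A ≤ c * ν A := h A
    _ ≤ (1 + δ) * ν A := by gcongr
    _ = ν A + δ * ν A := by rw [add_mul, one_mul]
    _ ≤ ν A + δ := by gcongr; exact mul_le_of_le_one_right' prob_le_one
  refine fun A hA => ⟨hle A, ?_⟩
  calc ν A = 1 - ν Aᶜ := by rw [prob_compl_eq_one_sub hA, ENNReal.sub_sub_cancel ENNReal.one_ne_top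
        prob_le_one]
    _ ≤ 1 - (μ Aᶜ - δ) := tsub_le_tsub_left (tsub_le_iff_right.2 (hle Aᶜ)) 1
    _ ≤ 1 - μ Aᶜ + δ := tsub_tsub_le_tsub_add
    _ = μ A + δ := by rw [prob_compl_eq_one_sub hA, ENNReal.sub_sub_cancel ENNReal.one_ne_top
        prob_le_one]

theorem trans (h : TVClose μ ν δ) (h' : TVClose ν ρ δ') : TVClose μ ρ (δ + δ') := by
  refine fun A hA => ⟨(h A hA).1.trans ?_, (h' A hA).2.trans ?_⟩
  · rw [add_comm δ, ← add_assoc]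
    exact add_le_add_left (h' A hA).1 δ
  · rw [← add_assoc]
    exact add_le_add_left (h A hA).2 δ'

theorem map (h : TVClose μ ν δ) {f : α → β} (hf : Measurable f) :
    TVClose (μ.map f) (ν.map f) δ := by
  intro A hA
  rw [Measure.map_apply hf hA, Measure.map_apply hf hA]
  exact h _ (hf hA)

theorem map_map {f g : α → β} (hf : Measurable f) (hg : Measurable g)
    (h : μ {a | f a ≠ g a} ≤ δ) : TVClose (μ.map f) (μ.map g) δ := by
  intro A hA
  rw [Measure.map_apply hf hA, Measure.map_apply hg hA]
  have hsub {s t : Set α} (hst : s ⊆ t ∪ {a | f a ≠ g a}) : μ s ≤ μ t + δ :=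
    (measure_mono hst).trans ((measure_union_le _ _).trans (add_le_add_right h _))
  constructor <;> apply hsub <;> intro a ha <;> by_cases hfg : f a = g a <;> simp_all

theorem lintegral {γ : Type*} [MeasurableSpace γ] (σ : Measure γ) [IsProbabilityMeasure σ]
    {f g : γ → ENNReal} (h : ∀ᵐ c ∂σ, f c ≤ g c + δ) : ∫⁻ c, f c ∂σ ≤ ∫⁻ c, g c ∂σ + δ := by
  calc ∫⁻ c, f c ∂σ ≤ ∫⁻ c, g c + δ ∂σ := lintegral_mono_ae h
    _ = ∫⁻ c, g c ∂σ + δ := by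
      rw [lintegral_add_right _ measurable_const, lintegral_const, measure_univ, mul_one]

theorem prod_right [SFinite μ] [SFinite ν] (h : TVClose μ ν δ) (σ : Measure β)
    [IsProbabilityMeasure σ] : TVClose (μ.prod σ) (ν.prod σ) δ := by
  intro A hA
  rw [Measure.prod_apply_symm hA, Measure.prod_apply_symm hA]
  exact ⟨lintegral σ (ae_of_all _ fun b => (h _ (measurable_prodMk_right hA)).1),
    lintegral σ (ae_of_all _ fun b => (h _ (measurable_prodMk_right hA)).2)⟩

theorem abs_measureReal_sub_le [IsFiniteMeasure μ] [IsFiniteMeasure ν] (h : TVClose μ ν δ)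
    (hδ : δ ≠ ⊤) {A : Set α} (hA : MeasurableSet A) : |μ.real A - ν.real A| ≤ δ.toReal := by
  have htoReal {a b : ENNReal} (hb : b ≠ ⊤) (h : a ≤ b + δ) :
      a.toReal ≤ b.toReal + δ.toReal := by
    rw [← ENNReal.toReal_add hb hδ]
    exact ENNReal.toReal_mono (by finiteness) h
  have hle := htoReal (measure_ne_top ν A) (h A hA).1
  have hge := htoReal (measure_ne_top μ A) (h A hA).2
  rw [abs_le]
  constructor <;> simp only [Measure.real] <;> linarith

end TVClose

/-! ### Transfer of algorithms along the transformation -/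

theorem measurePreserving_map_splitTape {α β : Type*} [MeasurableSpace α] [MeasurableSpace β]
    {m n L : ℕ} (hL : m * (n + 1) ≤ L) (D : Measure α) [IsProbabilityMeasure D]
    {f : α × (Fin m → Fin n → unitInterval) → β} (hf : Measurable f) :
    MeasurePreserving (fun w : α × RAMTape =>
      (f (w.1, fun i j => w.2 (i * (n + 1) + j)), fun t => w.2 (L + t)))
      (D.prod ramTapeMeasure) (((D.prod (coinMatrix m n)).map f).prod ramTapeMeasure) := by
  have := Measure.isProbabilityMeasure_map (μ := D.prod (coinMatrix m n)) hf.aemeasurable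
  have hsplit := (measurePreserving_prodAssoc D (coinMatrix m n) ramTapeMeasure).symm.comp
    ((MeasurePreserving.id D).prod (measurePreserving_splitTape hL))
  exact ((hf.measurePreserving _).prod (MeasurePreserving.id ramTapeMeasure)).comp hsplit

namespace RoundingParams

variable (p : RoundingParams) {m n T : ℕ} {P : RAMProgram} {ε : ℝ}

/-- The distribution of the transformed samples if the samples have distribution `D`. -/
def transformLaw (D : Measure (Samples m n)) : Measure (Samples m n) :=
  (D.prod (coinMatrix m n)).map fun w => p.transform w.1 w.2

/-- The distribution of the secret, multiplied by `r`, and the transformed samples if the secret and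
the samples have distribution `J`. -/
def transformJoint (r : ℝ) (J : Measure ((Fin n → ℝ) × Samples m n)) :
    Measure ((Fin n → ℝ) × Samples m n) :=
  (J.prod (coinMatrix m n)).map fun w => (r • w.1.1, p.transform w.1.2 w.2)

theorem measurable_transformJoint (r : ℝ) :
    Measurable fun w : ((Fin n → ℝ) × Samples m n) × (Fin m → Fin n → unitInterval) =>
      (r • w.1.1, p.transform w.1.2 w.2) := by
  have harg : Measurable fun w : ((Fin n → ℝ) × Samples m n) × (Fin m → Fin n → unitInterval) =>
      (w.1.2, w.2) := by fun_prop
  refine Measurable.prodMk (by fun_prop) ?_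
  exact (p.measurable_transform.comp harg :)

instance (D : Measure (Samples m n)) [IsProbabilityMeasure D] :
    IsProbabilityMeasure (p.transformLaw D) :=
  Measure.isProbabilityMeasure_map p.measurable_transform.aemeasurable

instance (r : ℝ) (J : Measure ((Fin n → ℝ) × Samples m n)) [IsProbabilityMeasure J] :
    IsProbabilityMeasure (p.transformJoint r J) :=
  Measure.isProbabilityMeasure_map (p.measurable_transformJoint r).aemeasurable

theorem transformLaw_map_snd (r : ℝ) (J : Measure ((Fin n → ℝ) × Samples m n))
    [IsProbabilityMeasure J] :
    p.transformLaw (J.map Prod.snd) = (p.transformJoint r J).map Prod.snd := by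
  have := Measure.isProbabilityMeasure_map (μ := J) measurable_snd.aemeasurable
  rw [transformLaw, transformJoint,
    Measure.map_map measurable_snd (p.measurable_transformJoint r),
    ← Measure.map_id (μ := coinMatrix m n), Measure.map_prod_map _ _ measurable_snd measurable_id,
    Measure.map_map p.measurable_transform (by fun_prop), Measure.map_id]
  rfl

theorem le_offset (m n : ℕ) : m * (n + 1) ≤ p.offset m n := by
  rw [offset, RAMProgram.mapCode, List.length_append, RAMProgram.sampleCode, List.length_map,
    List.length_range]
  exact Nat.le_add_right _ _

theorem acceptProb_reduction (hP : P.RunsInTime m n T) (D : Measure (Samples m n))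
    [IsProbabilityMeasure D] :
    (p.reduction m n [] P).acceptProb D = P.acceptProb (p.transformLaw D) := by
  rw [RAMProgram.acceptProb, RAMProgram.acceptProb, transformLaw,
    ← (measurePreserving_map_splitTape (p.le_offset m n) D
      p.measurable_transform).measureReal_preimage (P.measurableSet_accepts m n).nullMeasurableSet]
  simp only [p.reduction_accepts_iff hP, Set.preimage_ofPred_eq]

theorem hasDistinguisher_of_transformLaw {D₁ D₂ : Measure (Samples m n)} [IsProbabilityMeasure D₁]
    [IsProbabilityMeasure D₂] (h : HasDistinguisher (p.transformLaw D₁) (p.transformLaw D₂) T ε) :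
    HasDistinguisher D₁ D₂ (T + p.transformTime m n) ε := by
  obtain ⟨P, hP, hadvantage⟩ := h
  refine ⟨p.reduction m n [] P, p.runsInTime_reduction (by simp) hP, ?_⟩
  rwa [p.acceptProb_reduction hP, p.acceptProb_reduction hP]

theorem hasSearchSolver_of_transformJoint {r : ℝ} (hr : r ≠ 0)
    {J : Measure ((Fin n → ℝ) × Samples m n)} [IsProbabilityMeasure J]
    (h : HasSearchSolver (p.transformJoint r J) T ε) :
    HasSearchSolver J (T + p.transformTime m n + (n + 1)) ε := by
  obtain ⟨P, hP, hsuccess⟩ := h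
  refine ⟨p.reduction m n (RAMProgram.rescaleCode n r⁻¹) P, ?_, hsuccess.trans_eq ?_⟩
  · have hruns := p.runsInTime_reduction (RAMProgram.rescaleCode_isStraight n r⁻¹) hP
    rwa [RAMProgram.length_rescaleCode] at hruns
  rw [transformJoint, ← (measurePreserving_map_splitTape (p.le_offset m n) J
    (p.measurable_transformJoint r)).measureReal_preimage
      (P.measurableSet_outputs m n).nullMeasurableSet]
  simp only [p.reduction_outputs_iff hP hr, Set.preimage_ofPred_eq]

end RoundingParams

theorem HasDistinguisher.of_tvClose {m n T : ℕ} {ε : ℝ} {D₁ D₂ D₁' D₂' : Measure (Samples m n)}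
    [IsProbabilityMeasure D₁] [IsProbabilityMeasure D₂] [IsProbabilityMeasure D₁']
    [IsProbabilityMeasure D₂'] {δ : ENNReal} (hδ : δ ≠ ⊤) (h : HasDistinguisher D₁ D₂ T ε)
    (h₁ : TVClose D₁' D₁ δ) (h₂ : TVClose D₂' D₂ δ) :
    HasDistinguisher D₁' D₂' T (ε - 2 * δ.toReal) := by
  obtain ⟨P, hP, hadvantage⟩ := h
  refine ⟨P, hP, ?_⟩
  have hclose {D D' : Measure (Samples m n)} [IsProbabilityMeasure D] [IsProbabilityMeasure D']
      (h : TVClose D' D δ) : |P.acceptProb D' - P.acceptProb D| ≤ δ.toReal :=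
    (h.prod_right ramTapeMeasure).abs_measureReal_sub_le hδ (P.measurableSet_accepts m n)
  have hclose₁ := abs_le.1 (hclose h₁)
  have hclose₂ := abs_le.1 (hclose h₂)
  rw [sub_le_iff_le_add]
  refine hadvantage.trans (abs_le.2 ?_)
  have habs := abs_le.1 (le_refl |P.acceptProb D₁' - P.acceptProb D₂'|)
  constructor <;> linarith

theorem HasSearchSolver.of_tvClose {m n T : ℕ} {ε : ℝ} {J J' : Measure ((Fin n → ℝ) × Samples m n)}
    [IsProbabilityMeasure J] [IsProbabilityMeasure J'] {δ : ENNReal} (hδ : δ ≠ ⊤)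
    (h : HasSearchSolver J T ε) (hJ : TVClose J' J δ) :
    HasSearchSolver J' T (ε - δ.toReal) := by
  obtain ⟨P, hP, hsuccess⟩ := h
  refine ⟨P, hP, ?_⟩
  have hclose := abs_le.1 ((hJ.prod_right ramTapeMeasure).abs_measureReal_sub_le hδ
    (P.measurableSet_outputs m n))
  linarith

/-! ### The distributions of the samples -/

section Distributions

variable {m n : ℕ}

instance (s : ℝ) : IsProbabilityMeasure (gaussianWidth s) :=
  inferInstanceAs (IsProbabilityMeasure (gaussianReal _ _))

instance (n : ℕ) (s : ℝ) : IsProbabilityMeasure (gaussianVec n s) :=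
  inferInstanceAs (IsProbabilityMeasure (Measure.pi _))

instance (q : ℕ) [NeZero q] : IsProbabilityMeasure (uniformZMod q) :=
  isProbabilityMeasure_uniformOn ((Set.finite_Iio q).image _)
    (Set.Nonempty.image _ ⟨0, Set.mem_Iio.2 (NeZero.pos q)⟩)

instance (n q : ℕ) [NeZero q] : IsProbabilityMeasure (uniformZModVec n q) :=
  inferInstanceAs (IsProbabilityMeasure (Measure.pi _))

theorem isProbabilityMeasure_uniformTorus {q : ℝ} (hq : 0 < q) :
    IsProbabilityMeasure (uniformTorus q) := by
  refine cond_isProbabilityMeasure_of_finite ?_ ?_ <;> simp [Real.volume_Ico, hq]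

theorem isProbabilityMeasure_nullDist {q : ℝ} (hq : 0 < q) (A : Measure (Fin n → ℝ))
    [IsProbabilityMeasure A] : IsProbabilityMeasure (nullDist m A q) := by
  have := isProbabilityMeasure_uniformTorus hq
  exact inferInstanceAs (IsProbabilityMeasure (Measure.pi _))

theorem measurable_noisySample (q γ : ℝ) :
    Measurable fun w : (Fin n → ℝ) × (Fin n → ℝ) × ℝ =>
      (w.2.1, realMod (γ * ∑ j, w.2.1 j * w.1 j + w.2.2) q) := by
  have harg : Measurable fun w : (Fin n → ℝ) × (Fin n → ℝ) × ℝ =>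
      γ * ∑ j, w.2.1 j * w.1 j + w.2.2 := by fun_prop
  exact Measurable.prodMk (by fun_prop) ((measurable_realMod q).comp harg :)

/-- The samples `(a i, γ ⟨a i, s⟩ + e i mod q)` as a function of the vectors `a i` and the
noise `e`. -/
def noisySamples (q γ : ℝ) (s : Fin n → ℝ) (w : (Fin m → Fin n → ℝ) × (Fin m → ℝ)) : Samples m n :=
  fun i => (w.1 i, realMod (γ * ∑ j, w.1 i j * s j + w.2 i) q)

theorem measurable_noisySamples (q γ : ℝ) :
    Measurable fun w : (Fin n → ℝ) × (Fin m → Fin n → ℝ) × (Fin m → ℝ) =>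
      noisySamples q γ w.1 w.2 := by
  refine measurable_pi_iff.2 fun i => ?_
  have harg : Measurable fun w : (Fin n → ℝ) × (Fin m → Fin n → ℝ) × (Fin m → ℝ) =>
      (w.1, w.2.1 i, w.2.2 i) := by fun_prop
  exact ((measurable_noisySample q γ).comp harg :)

instance (q γ : ℝ) (A S : Measure (Fin n → ℝ)) [IsProbabilityMeasure A] [IsProbabilityMeasure S]
    (E : Measure ℝ) [IsProbabilityMeasure E] : IsProbabilityMeasure (noisyJoint m q γ A S E) :=
  Measure.isProbabilityMeasure_map
    (measurable_fst.prodMk (measurable_noisySamples q γ)).aemeasurable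

instance (c : ℝ) (S : PMF (Fin n → ℤ)) : IsProbabilityMeasure (scaledSecret c S) :=
  Measure.isProbabilityMeasure_map Measurable.of_discrete.aemeasurable

instance (q : ℕ) (A : Measure (Fin n → ℝ)) [IsProbabilityMeasure A] (S : PMF (Fin n → ℤ))
    (E : Measure ℝ) [IsProbabilityMeasure E] : IsProbabilityMeasure (lweJoint m q A S E) :=
  inferInstanceAs (IsProbabilityMeasure (noisyJoint _ _ _ _ _ _))

instance (A S : Measure (Fin n → ℝ)) [IsProbabilityMeasure A] [IsProbabilityMeasure S] (γ β : ℝ) :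
    IsProbabilityMeasure (clweJoint m A S γ β) :=
  inferInstanceAs (IsProbabilityMeasure (noisyJoint _ _ _ _ _ _))

/-- The distribution of a sample `(a, γ ⟨a, s⟩ + e mod q)` with a fixed secret `s`, where `a` is
drawn from `A` and `e` from `E`. -/
def noisySample (q γ : ℝ) (A : Measure (Fin n → ℝ)) (E : Measure ℝ) (s : Fin n → ℝ) :
    Measure ((Fin n → ℝ) × ℝ) :=
  (A.prod E).map fun w => (w.1, realMod (γ * ∑ j, w.1 j * s j + w.2) q)

theorem map_noisySamples (q γ : ℝ) (A : Measure (Fin n → ℝ)) [IsProbabilityMeasure A]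
    (E : Measure ℝ) [IsProbabilityMeasure E] (s : Fin n → ℝ) :
    ((Measure.pi fun _ : Fin m => A).prod (Measure.pi fun _ : Fin m => E)).map
      (noisySamples q γ s) = Measure.pi fun _ : Fin m => noisySample q γ A E s :=
  map_pi_prod_pi ((measurable_noisySample q γ).comp measurable_prodMk_left :)

theorem noisyJoint_scaledSecret (q γ c : ℝ) (A : Measure (Fin n → ℝ)) [IsProbabilityMeasure A]
    (S : PMF (Fin n → ℤ)) (E : Measure ℝ) [IsProbabilityMeasure E] :
    noisyJoint m q γ A (scaledSecret c S) E =
      (S.toMeasure.prod ((Measure.pi fun _ : Fin m => A).prod (Measure.pi fun _ : Fin m => E))).map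
        fun w => ((fun j => c * w.1 j), noisySamples q γ (fun j => c * w.1 j) w.2) := by
  have hsecret : Measurable fun (s : Fin n → ℤ) (j : Fin n) => c * (s j : ℝ) := .of_discrete
  have hprod := Measure.map_prod_map S.toMeasure
    ((Measure.pi fun _ : Fin m => A).prod (Measure.pi fun _ : Fin m => E)) hsecret measurable_id
  rw [Measure.map_id] at hprod
  rw [noisyJoint, scaledSecret, hprod]
  exact Measure.map_map (measurable_fst.prodMk (measurable_noisySamples q γ)) (by fun_prop)

theorem measurable_noisySamples_intCast (q γ c : ℝ) :
    Measurable fun w : (Fin n → ℤ) × (Fin m → Fin n → ℝ) × (Fin m → ℝ) =>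
      ((fun j => c * (w.1 j : ℝ)), noisySamples q γ (fun j => c * w.1 j) w.2) := by
  have hsecret : Measurable fun (s : Fin n → ℤ) (j : Fin n) => c * (s j : ℝ) := .of_discrete
  exact (measurable_fst.prodMk (measurable_noisySamples q γ)).comp
    ((hsecret.comp measurable_fst).prodMk measurable_snd)

theorem charFun_gaussianWidth (s x : ℝ) :
    charFun (gaussianWidth s) x = Complex.exp (-(s ^ 2 * x ^ 2 / (4 * Real.pi))) := by
  have hvar : 0 ≤ s ^ 2 / (2 * Real.pi) := by positivity
  rw [gaussianWidth, charFun_gaussianReal, Real.coe_toNNReal _ hvar]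
  push_cast
  ring_nf

theorem map_mul_gaussianWidth (s c : ℝ) :
    (gaussianWidth s).map (c * ·) = gaussianWidth (c * s) := by
  refine Measure.ext_of_charFun (funext fun x => ?_)
  rw [charFun_map_mul, charFun_gaussianWidth, charFun_gaussianWidth]
  push_cast
  ring_nf

theorem map_sum_mul_gaussianVec (s : Fin n → ℝ) (t : ℝ) {r : ℝ} (hr : ∑ j, s j ^ 2 = r ^ 2) :
    (gaussianVec n t).map (fun x => ∑ j, x j * s j) = gaussianWidth (r * t) := by
  have hscale : (gaussianVec n t).map (fun x j => s j * x j) =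
      Measure.pi fun j => gaussianWidth (s j * t) := by
    have (j : Fin n) : IsProbabilityMeasure ((gaussianWidth t).map (s j * ·)) :=
      Measure.isProbabilityMeasure_map (by fun_prop)
    simp only [gaussianVec, ← map_mul_gaussianWidth]
    exact Measure.pi_map_pi fun _ => by fun_prop
  have hsum : (gaussianVec n t).map (fun x => ∑ j, x j * s j) =
      (Measure.pi fun j => gaussianWidth (s j * t)).map fun x => ∑ j, x j := by
    rw [← hscale, Measure.map_map (by fun_prop) (by fun_prop)]
    simp only [Function.comp_def, mul_comm]
  rw [hsum]
  refine Measure.ext_of_charFun ?_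
  rw [charFun_map_sum_pi_eq_prod]
  funext x
  simp only [Finset.prod_apply, charFun_gaussianWidth, ← Complex.exp_sum]
  have hr' : (r ^ 2 : ℂ) = ∑ j, (s j : ℂ) ^ 2 := by exact_mod_cast hr.symm
  push_cast
  rw [mul_pow, hr', Finset.sum_neg_distrib, Finset.sum_mul, Finset.sum_mul, Finset.sum_div]
  simp only [mul_pow]

theorem map_noise {t b σ r q : ℝ} (s : Fin n → ℝ) (hs : ∑ j, s j ^ 2 = r ^ 2)
    (hσ : σ ^ 2 = (q * b) ^ 2 + (r * t) ^ 2) :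
    ((gaussianVec n t).prod (gaussianWidth b)).map (fun w => ∑ j, w.1 j * s j + q * w.2) =
      gaussianWidth σ := by
  have hconv : ((gaussianVec n t).prod (gaussianWidth b)).map
      (fun w => ∑ j, w.1 j * s j + q * w.2) =
      ((gaussianVec n t).map fun x => ∑ j, x j * s j).conv ((gaussianWidth b).map (q * ·)) := by
    rw [Measure.conv, Measure.map_prod_map _ _ (by fun_prop) (by fun_prop),
      Measure.map_map (by fun_prop) (by fun_prop)]
    rfl
  rw [hconv, map_sum_mul_gaussianVec s t hs, map_mul_gaussianWidth]
  refine Measure.ext_of_charFun (funext fun x => ?_)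
  rw [charFun_conv, charFun_gaussianWidth, charFun_gaussianWidth, charFun_gaussianWidth,
    ← Complex.exp_add, ← Complex.ofReal_pow σ, hσ]
  push_cast
  ring_nf

theorem map_mul_uniformTorus {q : ℝ} (hq : 0 < q) :
    (uniformTorus 1).map (q * ·) = uniformTorus q := by
  ext A hA
  have hpreimage : Set.Ico 0 1 ∩ (q * ·) ⁻¹' A = (q * ·) ⁻¹' (Set.Ico 0 q ∩ A) := by
    ext x
    simp [mul_nonneg_iff_of_pos_left hq, mul_lt_iff_lt_one_right hq]
  rw [Measure.map_apply (by fun_prop) hA, uniformTorus, uniformTorus,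
    cond_apply measurableSet_Ico, cond_apply measurableSet_Ico, hpreimage,
    Real.volume_preimage_mul_left hq.ne', Real.volume_Ico, Real.volume_Ico,
    abs_of_pos (inv_pos.2 hq), sub_zero, sub_zero, ENNReal.ofReal_one, inv_one, one_mul,
    ENNReal.ofReal_inv_of_pos hq]

end Distributions

/-! ### The transformation of the samples -/

theorem measurePreserving_prodRightComm {α β γ : Type*} [MeasurableSpace α] [MeasurableSpace β]
    [MeasurableSpace γ] (μ : Measure α) (ν : Measure β) (ρ : Measure γ) [SFinite μ] [SFinite ν]
    [SFinite ρ] : MeasurePreserving (fun w : (α × β) × γ => ((w.1.1, w.2), w.1.2))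
      ((μ.prod ν).prod ρ) ((μ.prod ρ).prod ν) :=
  (measurePreserving_prodAssoc μ ρ ν).symm.comp
    (((MeasurePreserving.id μ).prod Measure.measurePreserving_swap).comp
      (measurePreserving_prodAssoc μ ν ρ))

theorem TVClose.map_prod {α β γ δ : Type*} [MeasurableSpace α] [MeasurableSpace β]
    [MeasurableSpace γ] [MeasurableSpace δ] {ε : ENNReal} (σ : Measure γ) [IsProbabilityMeasure σ]
    {μ : Measure α} {ν : Measure β} [SFinite μ] [SFinite ν] {f : γ × α → δ} {g : γ × β → δ}
    (hf : Measurable f) (hg : Measurable g)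
    (h : ∀ᵐ c ∂σ, TVClose (μ.map fun a => f (c, a)) (ν.map fun b => g (c, b)) ε) :
    TVClose ((σ.prod μ).map f) ((σ.prod ν).map g) ε := by
  intro A hA
  rw [Measure.map_apply hf hA, Measure.map_apply hg hA, Measure.prod_apply (hf hA),
    Measure.prod_apply (hg hA)]
  have hclose : ∀ᵐ c ∂σ, μ (Prod.mk c ⁻¹' (f ⁻¹' A)) ≤ ν (Prod.mk c ⁻¹' (g ⁻¹' A)) + ε ∧
      ν (Prod.mk c ⁻¹' (g ⁻¹' A)) ≤ μ (Prod.mk c ⁻¹' (f ⁻¹' A)) + ε := by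
    filter_upwards [h] with c hc
    have hfc : Measurable fun a => f (c, a) := hf.comp measurable_prodMk_left
    have hgc : Measurable fun b => g (c, b) := hg.comp measurable_prodMk_left
    have hcA := hc A hA
    rwa [Measure.map_apply hfc hA, Measure.map_apply hgc hA] at hcA
  exact ⟨lintegral σ (hclose.mono fun _ hc => hc.1), lintegral σ (hclose.mono fun _ hc => hc.2)⟩

theorem measure_exists_entry_le {m n : ℕ} {ρ : Measure ((Fin n → ℝ) × ℝ)} [IsProbabilityMeasure ρ]
    {μ : Measure ℝ} [IsProbabilityMeasure μ] (hρ : ρ.map Prod.fst = Measure.pi fun _ => μ)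
    (s : Set ℝ) :
    (Measure.pi fun _ : Fin m => ρ) {x | ∃ i j, (x i).1 j ∈ s} ≤ m * (n * μ s) := by
  have hentry (i : Fin m) (j : Fin n) :
      MeasurePreserving (fun x : Samples m n => (x i).1 j) (Measure.pi fun _ => ρ) μ :=
    ((measurePreserving_eval _ j).comp ⟨measurable_fst, hρ⟩).comp (measurePreserving_eval _ i)
  calc (Measure.pi fun _ : Fin m => ρ) {x | ∃ i j, (x i).1 j ∈ s}
      = (Measure.pi fun _ : Fin m => ρ) (⋃ i, ⋃ j, (fun x => (x i).1 j) ⁻¹' s) := by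
        congr 1
        ext x
        simp
    _ ≤ ∑ _i : Fin m, ∑ _j : Fin n, μ s := (measure_iUnion_fintype_le _ _).trans
        (Finset.sum_le_sum fun i _ => (measure_iUnion_fintype_le _ _).trans
          (Finset.sum_le_sum fun j _ => (hentry i j).measure_preimage_le s))
    _ = m * (n * μ s) := by simp

namespace RoundingParams

variable (p : RoundingParams) {m n : ℕ}

/-- The residue modulo `q` of the integer obtained by randomized rounding, and the rounding
error. -/
def residueError (w : ℝ × unitInterval) : ℝ × ℝ :=
  (realMod (p.roundInt w.1 w.2) p.q, p.q * p.τ * w.1 - p.roundInt w.1 w.2)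

/-- The transformation of a sample by exact randomized rounding. It agrees with the transformation
by `roundCode` unless an entry is so large that the program does not reduce it modulo `q`. -/
def idealRow (w : ((Fin n → ℝ) × ℝ) × (Fin n → unitInterval)) : (Fin n → ℝ) × ℝ :=
  (fun j => (p.residueError (w.1.1 j, w.2 j)).1, p.q * w.1.2)

/-- Up to the factor `C`, the law of the residue of a rounded Gaussian and of the rounding error is
at most the product of the uniform distribution and the Gaussian of width `t`. -/
def IdealUpTo (C : ENNReal) : Prop :=
  ((gaussianWidth 1).prod volume).map p.residueError ≤
    C • (uniformZMod p.q).prod (gaussianWidth p.t)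

theorem measurable_residueError : Measurable p.residueError := by
  have hround : Measurable fun w : ℝ × unitInterval => (p.roundInt w.1 w.2 : ℝ) := by
    have harg : Measurable fun w : ℝ × unitInterval => (w.1, (w.2 : ℝ)) := by fun_prop
    have hint : Measurable fun w : ℝ × unitInterval => p.roundInt w.1 w.2 :=
      (p.measurable_roundInt.comp harg :)
    exact (Measurable.of_discrete (f := ((↑) : ℤ → ℝ))).comp hint
  exact ((measurable_realMod _).comp hround).prodMk ((measurable_fst.const_mul _).sub hround)

theorem measurable_residueError_entry (j : Fin n) :
    Measurable fun w : (Fin n → ℝ) × (Fin n → unitInterval) => p.residueError (w.1 j, w.2 j) :=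
  p.measurable_residueError.comp (by fun_prop)

theorem measurable_idealRow : Measurable (p.idealRow (n := n)) := by
  refine Measurable.prodMk (measurable_pi_iff.2 fun j => ?_) (by fun_prop)
  exact (p.measurable_residueError.comp (by fun_prop)).fst

theorem map_idealRow_le {E : Measure ℝ} [IsProbabilityMeasure E] (hq : 0 < p.q) {C : ENNReal}
    (hC : C ≠ ⊤) (hideal : p.IdealUpTo C) {b : (Fin n → ℝ) × ℝ → ℝ}
    (hb : Measurable b) {b' : ((Fin n → ℝ) × (Fin n → ℝ)) × ℝ → ℝ} (hb' : Measurable b')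
    (h : ∀ (a : Fin n → ℝ) (u : Fin n → unitInterval) (e : ℝ),
      p.q * b (a, e) = b' ((fun j => (p.residueError (a j, u j)).1,
        fun j => (p.residueError (a j, u j)).2), e)) :
    ((((gaussianVec n 1).prod E).map fun w => (w.1, b w)).prod (Measure.pi fun _ => volume)).map
      p.idealRow ≤ C ^ n • (((uniformZModVec n p.q).prod (gaussianVec n p.t)).prod E).map
        fun w => (w.1.1, b' w) := by
  have : NeZero p.q := ⟨hq.ne'⟩
  have hresidues := map_pi_prod_pi_le_smul (ι := Fin n) p.measurable_residueError hC hideal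
  rw [Fintype.card_fin] at hresidues
  have hmeas : Measurable fun w : (Fin n → ℝ) × (Fin n → unitInterval) =>
      ((fun j => (p.residueError (w.1 j, w.2 j)).1), fun j => (p.residueError (w.1 j, w.2 j)).2) :=
    (measurable_pi_iff.2 fun j => (p.measurable_residueError_entry j).fst).prodMk
      (measurable_pi_iff.2 fun j => (p.measurable_residueError_entry j).snd)
  have hout : Measurable fun w : ((Fin n → ℝ) × (Fin n → ℝ)) × ℝ => (w.1.1, b' w) := by fun_prop
  have hprod := Measure.map_mono (Measure.prod_mono hresidues (le_refl E)) hout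
  rw [Measure.prod_smul_left, Measure.map_smul] at hprod
  refine le_of_eq_of_le ?_ hprod
  have hrearrange := measurePreserving_prodRightComm (Measure.pi fun _ : Fin n => gaussianWidth 1) E
    (Measure.pi fun _ : Fin n => (volume : Measure unitInterval))
  have hb1 : Measurable fun w : (Fin n → ℝ) × ℝ => (w.1, b w) := by fun_prop
  calc _ = (((gaussianVec n 1).prod E).prod (Measure.pi fun _ => volume)).map
        fun w => p.idealRow ((w.1.1, b w.1), w.2) := by
        rw [← Measure.map_id (μ := Measure.pi fun _ : Fin n => (volume : Measure unitInterval)),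
          Measure.map_prod_map _ _ hb1 measurable_id, Measure.map_map p.measurable_idealRow
          (by fun_prop), Measure.map_id]
        rfl
    _ = _ := by
        rw [← Measure.map_id (μ := E), Measure.map_prod_map _ _ hmeas measurable_id,
          Measure.map_map hout (by fun_prop), Measure.map_id, ← hrearrange.map_eq,
          Measure.map_map (hout.comp (hmeas.prodMap measurable_id)) hrearrange.measurable]
        congr 1
        funext w
        exact Prod.ext rfl (h _ _ _)

theorem transform_eq_idealRow (hq : 0 < p.q) {x : Samples m n}
    (hx : ∀ i j, |p.q * p.τ * (x i).1 j| + p.Z + 1 ≤ 2 ^ p.K)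
    (u : Fin m → Fin n → unitInterval) : p.transform x u = fun i => p.idealRow (x i, u i) := by
  funext i
  refine Prod.ext (funext fun j => ?_) rfl
  exact p.exec_roundCode hq _ (hx i j)

theorem tvClose_transformLaw_pi (hq : 0 < p.q) {ρ ρ' : Measure ((Fin n → ℝ) × ℝ)}
    [IsProbabilityMeasure ρ] [IsProbabilityMeasure ρ'] (hρ : ρ.map Prod.fst = gaussianVec n 1)
    {c : ENNReal} (hc : c ≠ ⊤)
    (hle : (ρ.prod (Measure.pi fun _ => volume)).map p.idealRow ≤ c • ρ') {δ δ' : ENNReal}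
    (hδ : m * (n * gaussianWidth 1 {a | ¬ |p.q * p.τ * a| + p.Z + 1 ≤ 2 ^ p.K}) ≤ δ)
    (hδ' : c ^ m ≤ 1 + δ') :
    TVClose (p.transformLaw (Measure.pi fun _ : Fin m => ρ)) (Measure.pi fun _ => ρ')
      (δ + δ') := by
  set V := Measure.pi fun _ : Fin n => (volume : Measure unitInterval)
  have := Measure.isProbabilityMeasure_map (μ := ρ.prod V) p.measurable_idealRow.aemeasurable
  have hideal : Measurable fun w : Samples m n × (Fin m → Fin n → unitInterval) =>
      fun i => p.idealRow (w.1 i, w.2 i) :=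
    measurable_pi_iff.2 fun i => p.measurable_idealRow.comp (by fun_prop)
  have hlarge : (Measure.pi fun _ : Fin m => ρ) {x | ∃ i j,
      ¬ |p.q * p.τ * (x i).1 j| + p.Z + 1 ≤ 2 ^ p.K} ≤ δ :=
    (measure_exists_entry_le hρ _).trans hδ
  have hround : TVClose (p.transformLaw (Measure.pi fun _ : Fin m => ρ))
      (Measure.pi fun _ => (ρ.prod V).map p.idealRow) δ := by
    rw [← map_pi_prod_pi p.measurable_idealRow]
    refine TVClose.map_map p.measurable_transform hideal ?_
    refine le_trans (measure_mono fun w hw => ?_)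
      ((measurePreserving_fst.measure_preimage_le _).trans hlarge)
    by_contra hsmall
    simp only [Set.mem_preimage, Set.mem_ofPred_eq, not_exists, not_not] at hsmall
    exact hw (p.transform_eq_idealRow hq hsmall _)
  have hmass := pi_le_smul_pi hc fun _ : Fin m => hle
  rw [Fintype.card_fin] at hmass
  exact hround.trans (TVClose.of_le_smul hδ' hmass)

end RoundingParams

theorem mul_realMod_one {q : ℝ} (hq : q ≠ 0) (x : ℝ) :
    q * realMod x 1 = realMod (q * x) q := by
  rw [realMod, realMod, div_one, one_mul, mul_div_cancel_left₀ x hq, mul_sub]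

theorem realMod_sum_realMod_mul_int {n : ℕ} {q : ℝ} (hq : q ≠ 0) (x : Fin n → ℝ) (s : Fin n → ℤ)
    (y : ℝ) :
    realMod (∑ j, realMod (x j) q * s j + y) q = realMod (∑ j, x j * s j + y) q := by
  have hsum : ∑ j, x j * s j + y =
      ∑ j, realMod (x j) q * s j + y + q * (∑ j, ⌊x j / q⌋ * s j : ℤ) := by
    push_cast
    rw [Finset.mul_sum, add_right_comm, ← Finset.sum_add_distrib]
    congr 1
    refine Finset.sum_congr rfl fun j _ => ?_
    rw [realMod]
    ring
  rw [hsum, realMod_add_mul_int _ hq]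

theorem measurable_noisySample_const {n : ℕ} (q γ : ℝ) (s : Fin n → ℝ) :
    Measurable fun w : (Fin n → ℝ) × ℝ => (w.1, realMod (γ * ∑ j, w.1 j * s j + w.2) q) :=
  (measurable_noisySample q γ).comp measurable_prodMk_left

theorem measurable_noisySamples_const {m n : ℕ} (q γ : ℝ) (s : Fin n → ℝ) :
    Measurable (noisySamples (m := m) q γ s) :=
  (measurable_noisySamples q γ).comp measurable_prodMk_left

instance {n : ℕ} (q γ : ℝ) (A : Measure (Fin n → ℝ)) [IsProbabilityMeasure A] (E : Measure ℝ)
    [IsProbabilityMeasure E] (s : Fin n → ℝ) : IsProbabilityMeasure (noisySample q γ A E s) :=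
  Measure.isProbabilityMeasure_map (measurable_noisySample_const q γ s).aemeasurable

theorem map_fst_noisySample {n : ℕ} (q γ : ℝ) (A : Measure (Fin n → ℝ)) (E : Measure ℝ)
    [IsProbabilityMeasure E] (s : Fin n → ℝ) : (noisySample q γ A E s).map Prod.fst = A := by
  rw [noisySample, Measure.map_map measurable_fst (measurable_noisySample_const q γ s)]
  exact Measure.map_fst_prod.trans (by simp)

theorem map_noise_eq_noisySample {n : ℕ} (A : Measure (Fin n → ℝ)) [IsProbabilityMeasure A]
    {t β σ r q : ℝ} (s : Fin n → ℝ) (hs : ∑ j, s j ^ 2 = r ^ 2)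
    (hσ : σ ^ 2 = (q * β) ^ 2 + (r * t) ^ 2) :
    ((A.prod (gaussianVec n t)).prod (gaussianWidth β)).map (fun w => (w.1.1,
      realMod (1 * ∑ j, w.1.1 j * s j + (∑ j, w.1.2 j * s j + q * w.2)) q)) =
      noisySample q 1 A (gaussianWidth σ) s := by
  have hnoise : Measurable fun w : (Fin n → ℝ) × ℝ => ∑ j, w.1 j * s j + q * w.2 := by fun_prop
  have hassoc := measurePreserving_prodAssoc A (gaussianVec n t) (gaussianWidth β)
  rw [noisySample, ← map_noise s hs hσ, ← Measure.map_id (μ := A),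
    Measure.map_prod_map _ _ measurable_id hnoise, Measure.map_id, ← hassoc.map_eq,
    Measure.map_map (by fun_prop) hassoc.measurable,
    Measure.map_map (measurable_noisySample_const q 1 s) (by fun_prop)]
  rfl

namespace RoundingParams

variable (p : RoundingParams) {m n : ℕ}

theorem tvClose_transformLaw_clwe (hq : 0 < p.q) {C : ENNReal} (hC : C ≠ ⊤) (hideal : p.IdealUpTo C)
    {δ δ' : ENNReal}
    (hδ : m * (n * gaussianWidth 1 {a | ¬ |p.q * p.τ * a| + p.Z + 1 ≤ 2 ^ p.K}) ≤ δ)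
    (hδ' : (C ^ n) ^ m ≤ 1 + δ') {γ c r β σ : ℝ} (hγ : γ * c = p.τ) (s : Fin n → ℤ)
    (hs : ∑ j, (s j : ℝ) ^ 2 = r ^ 2) (hσ : σ ^ 2 = (p.q * β) ^ 2 + (r * p.t) ^ 2) :
    TVClose (p.transformLaw (Measure.pi fun _ : Fin m =>
        noisySample 1 γ (gaussianVec n 1) (gaussianWidth β) fun j => c * s j))
      (Measure.pi fun _ =>
        noisySample p.q 1 (uniformZModVec n p.q) (gaussianWidth σ) fun j => s j) (δ + δ') := by
  have : NeZero p.q := ⟨hq.ne'⟩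
  have hq' : (p.q : ℝ) ≠ 0 := by exact_mod_cast hq.ne'
  rw [← map_noise_eq_noisySample (uniformZModVec n p.q) _ hs hσ]
  have hout : Measurable fun w : ((Fin n → ℝ) × (Fin n → ℝ)) × ℝ =>
      realMod (1 * ∑ j, w.1.1 j * s j + (∑ j, w.1.2 j * s j + p.q * w.2)) p.q :=
    (measurable_realMod _).comp (by fun_prop)
  have := Measure.isProbabilityMeasure_map (μ := ((uniformZModVec n p.q).prod
    (gaussianVec n p.t)).prod (gaussianWidth β)) (measurable_fst.fst.prodMk hout).aemeasurable
  refine p.tvClose_transformLaw_pi hq (map_fst_noisySample _ _ _ _ _) (by finiteness)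
    (p.map_idealRow_le hq hC hideal (measurable_noisySample_const 1 γ _).snd hout
      fun a u e => ?_) hδ hδ'
  have hτ : p.q * (γ * ∑ j, a j * (c * s j) + e) =
      ∑ j, (p.roundInt (a j) (u j) : ℝ) * s j +
        (∑ j, (p.residueError (a j, u j)).2 * s j + p.q * e) := by
    rw [← add_assoc, ← Finset.sum_add_distrib, mul_add, Finset.mul_sum, Finset.mul_sum]
    congr 1
    refine Finset.sum_congr rfl fun j _ => ?_
    rw [residueError]
    linear_combination p.q * a j * s j * hγ
  rw [mul_realMod_one hq', hτ, one_mul]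
  exact (realMod_sum_realMod_mul_int hq' _ _ _).symm

theorem tvClose_transformLaw_null (hq : 0 < p.q) {C : ENNReal} (hC : C ≠ ⊤) (hideal : p.IdealUpTo C)
    {δ δ' : ENNReal}
    (hδ : m * (n * gaussianWidth 1 {a | ¬ |p.q * p.τ * a| + p.Z + 1 ≤ 2 ^ p.K}) ≤ δ)
    (hδ' : (C ^ n) ^ m ≤ 1 + δ') :
    TVClose (p.transformLaw (nullDist m (gaussianVec n 1) 1))
      (nullDist m (uniformZModVec n p.q) p.q) (δ + δ') := by
  have : NeZero p.q := ⟨hq.ne'⟩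
  have hq' : (0 : ℝ) < p.q := by exact_mod_cast hq
  have := isProbabilityMeasure_uniformTorus one_pos
  have := isProbabilityMeasure_uniformTorus hq'
  have hrow : ((gaussianVec n 1).prod (uniformTorus 1)).map (fun w => (w.1, w.2)) =
      (gaussianVec n 1).prod (uniformTorus 1) := Measure.map_id
  have hout : (((uniformZModVec n p.q).prod (gaussianVec n p.t)).prod (uniformTorus 1)).map
      (fun w => (w.1.1, (p.q : ℝ) * w.2)) = (uniformZModVec n p.q).prod (uniformTorus p.q) := by
    have hfst : ((uniformZModVec n p.q).prod (gaussianVec n p.t)).map Prod.fst =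
        uniformZModVec n p.q := Measure.map_fst_prod.trans (by simp)
    rw [← map_mul_uniformTorus hq']
    conv_rhs => rw [← hfst]
    exact (Measure.map_prod_map _ _ measurable_fst (by fun_prop)).symm
  have hle := p.map_idealRow_le (n := n) (E := uniformTorus 1) hq hC hideal measurable_snd
    (b' := fun w => p.q * w.2) (by fun_prop) fun _ _ _ => rfl
  rw [hrow, hout] at hle
  exact p.tvClose_transformLaw_pi hq (Measure.map_fst_prod.trans (by simp)) (by finiteness) hle
    hδ hδ'

theorem measurable_transform_noisySamples (q γ r : ℝ) :
    Measurable fun w : (Fin n → ℤ) × ((Fin m → Fin n → ℝ) × (Fin m → ℝ)) ×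
      (Fin m → Fin n → unitInterval) => ((fun j => (w.1 j : ℝ)),
        p.transform (noisySamples q γ (fun j => 1 / r * w.1 j) w.2.1) w.2.2) := by
  have hsecret : Measurable fun (s : Fin n → ℤ) (j : Fin n) => (s j : ℝ) := .of_discrete
  have hassoc : Measurable fun w : (Fin n → ℤ) × ((Fin m → Fin n → ℝ) × (Fin m → ℝ)) ×
      (Fin m → Fin n → unitInterval) => (w.1, w.2.1) := by fun_prop
  have hsamples := ((measurable_noisySamples_intCast q γ (1 / r)).comp hassoc).snd
  refine (hsecret.comp measurable_fst).prodMk ?_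
  exact (p.measurable_transform.comp (hsamples.prodMk measurable_snd.snd) :)

theorem transformLaw_pi_noisySample (q γ : ℝ) (A : Measure (Fin n → ℝ)) [IsProbabilityMeasure A]
    (E : Measure ℝ) [IsProbabilityMeasure E] (s : Fin n → ℝ) :
    p.transformLaw (Measure.pi fun _ : Fin m => noisySample q γ A E s) =
      (((Measure.pi fun _ : Fin m => A).prod (Measure.pi fun _ : Fin m => E)).prod
        (coinMatrix m n)).map
          ((fun w => p.transform w.1 w.2) ∘ Prod.map (noisySamples q γ s) id) := by
  have hprod := Measure.map_prod_map ((Measure.pi fun _ : Fin m => A).prod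
    (Measure.pi fun _ : Fin m => E)) (coinMatrix m n) (measurable_noisySamples_const q γ s)
    measurable_id
  rw [Measure.map_id] at hprod
  rw [transformLaw, ← map_noisySamples, hprod]
  exact Measure.map_map p.measurable_transform
    ((measurable_noisySamples_const q γ s).prodMap measurable_id)

theorem transformJoint_noisyJoint_scaledSecret {r : ℝ} (hr : r ≠ 0) (q γ : ℝ)
    (A : Measure (Fin n → ℝ)) [IsProbabilityMeasure A] (S : PMF (Fin n → ℤ)) (E : Measure ℝ)
    [IsProbabilityMeasure E] :
    p.transformJoint r (noisyJoint m q γ A (scaledSecret (1 / r) S) E) =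
      (S.toMeasure.prod (((Measure.pi fun _ : Fin m => A).prod
        (Measure.pi fun _ : Fin m => E)).prod (coinMatrix m n))).map fun w =>
          ((fun j => (w.1 j : ℝ)),
            p.transform (noisySamples q γ (fun j => 1 / r * w.1 j) w.2.1) w.2.2) := by
  have hassoc := measurePreserving_prodAssoc S.toMeasure
    ((Measure.pi fun _ : Fin m => A).prod (Measure.pi fun _ : Fin m => E)) (coinMatrix m n)
  have hprod := Measure.map_prod_map (S.toMeasure.prod ((Measure.pi fun _ : Fin m => A).prod
    (Measure.pi fun _ : Fin m => E))) (coinMatrix m n)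
    (measurable_noisySamples_intCast q γ (1 / r)) measurable_id
  rw [Measure.map_id] at hprod
  rw [transformJoint, noisyJoint_scaledSecret, hprod, Measure.map_map
    (p.measurable_transformJoint r) ((measurable_noisySamples_intCast _ _ _).prodMap measurable_id),
    ← hassoc.map_eq, Measure.map_map (p.measurable_transform_noisySamples q γ r) hassoc.measurable]
  congr 1
  funext w
  refine Prod.ext (funext fun j => ?_) rfl
  change r * (1 / r * (w.1.1 j : ℝ)) = w.1.1 j
  rw [← mul_assoc, mul_one_div_cancel hr, one_mul]

theorem tvClose_transformJoint_clwe (hq : 0 < p.q) {C : ENNReal} (hC : C ≠ ⊤)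
    (hideal : p.IdealUpTo C) {δ δ' : ENNReal}
    (hδ : m * (n * gaussianWidth 1 {a | ¬ |p.q * p.τ * a| + p.Z + 1 ≤ 2 ^ p.K}) ≤ δ)
    (hδ' : (C ^ n) ^ m ≤ 1 + δ') {γ r β σ : ℝ} (hr : r ≠ 0) (hγ : γ = r * p.τ)
    (hσ : σ ^ 2 = (p.q * β) ^ 2 + (r * p.t) ^ 2) {S : PMF (Fin n → ℤ)}
    (hS : ∀ s ∈ S.support, ∑ j, (s j : ℝ) ^ 2 = r ^ 2) :
    TVClose (p.transformJoint r (clweJoint m (gaussianVec n 1) (scaledSecret (1 / r) S) γ β))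
      (lweJoint m p.q (uniformZModVec n p.q) S (gaussianWidth σ)) (δ + δ') := by
  have : NeZero p.q := ⟨hq.ne'⟩
  rw [clweJoint, p.transformJoint_noisyJoint_scaledSecret hr, lweJoint, noisyJoint_scaledSecret]
  refine TVClose.map_prod _ (p.measurable_transform_noisySamples _ _ _)
    (measurable_noisySamples_intCast _ _ _) ?_
  have hsupport : ∀ᵐ s ∂S.toMeasure, s ∈ S.support :=
    mem_ae_iff_prob_eq_one₀ (MeasurableSet.of_discrete.nullMeasurableSet) |>.2
      ((S.toMeasure_apply_eq_one_iff .of_discrete).2 subset_rfl)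
  filter_upwards [hsupport] with s hs
  have hγ' : γ * (1 / r) = p.τ := by rw [hγ]; field_simp
  have hsamples := (p.tvClose_transformLaw_clwe hq hC hideal hδ hδ' hγ' s (hS s hs) hσ).map
    (measurable_prodMk_left (x := fun j => (s j : ℝ)))
  rw [p.transformLaw_pi_noisySample, ← map_noisySamples,
    Measure.map_map measurable_prodMk_left
      (p.measurable_transform.comp ((measurable_noisySamples_const _ _ _).prodMap measurable_id)),
    Measure.map_map measurable_prodMk_left (measurable_noisySamples_const _ _ _)] at hsamples
  simp only [one_mul]
  exact hsamples

end RoundingParams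

/-! ### Sums of Gaussian densities over the integers -/

/-- The density of the Gaussian distribution of width `s`. -/
def gaussDensity (s x : ℝ) : ℝ := Real.exp (-Real.pi * x ^ 2 / s ^ 2) / s

theorem gaussDensity_nonneg {s : ℝ} (hs : 0 ≤ s) (x : ℝ) : 0 ≤ gaussDensity s x :=
  div_nonneg (Real.exp_pos _).le hs

theorem summable_gaussDensity {s : ℝ} (hs : 0 < s) (x : ℝ) :
    Summable fun n : ℤ => gaussDensity s (x + n) := by
  have hbound := summable_pow_mul_jacobiTheta₂_term_bound (|x| / s ^ 2) (T := 1 / s ^ 2)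
    (by positivity) 0
  refine (hbound.of_nonneg_of_le (fun n => (Real.exp_pos _).le) fun n => ?_).div_const s
  rw [pow_zero, one_mul, Real.exp_le_exp]
  calc -Real.pi * (x + n) ^ 2 / s ^ 2
      ≤ -Real.pi * ((n : ℝ) ^ 2 - 2 * (|x| * |(n : ℝ)|)) / s ^ 2 := by
        have hcross : -(|x| * |(n : ℝ)|) ≤ x * n := by rw [← abs_mul]; exact neg_abs_le _
        have hsq : (n : ℝ) ^ 2 - 2 * (|x| * |(n : ℝ)|) ≤ (x + n) ^ 2 := by
          nlinarith [sq_nonneg x]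
        gcongr ?_ / _
        exact mul_le_mul_of_nonpos_left hsq (neg_nonpos.2 Real.pi_pos.le)
    _ = -Real.pi * (1 / s ^ 2 * (n : ℝ) ^ 2 - 2 * (|x| / s ^ 2) * ((|n| : ℤ) : ℝ)) := by
        push_cast
        field_simp

theorem exp_neg_pi_mul_sq_le_half {s : ℝ} (hs : 1 ≤ s) : Real.exp (-Real.pi * s ^ 2) ≤ 1 / 2 := by
  have hexp : Real.exp (-Real.pi * s ^ 2) ≤ Real.exp (-1) :=
    Real.exp_le_exp.2 (by nlinarith [Real.pi_gt_three])
  linarith [Real.exp_neg_one_lt_half]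

theorem norm_tsum_le_of_le_geometric_two {E : Type*} [SeminormedAddCommGroup E] {f : ℕ → E} {X : ℝ}
    (hf : ∀ n, ‖f n‖ ≤ X * (1 / 2) ^ n) : ‖∑' n, f n‖ ≤ 2 * X := by
  simpa only [mul_comm X] using tsum_of_norm_bounded (hasSum_geometric_two.mul_left X) hf

theorem norm_tsum_int_sub_zero_le {E : Type*} [NormedAddCommGroup E] [CompleteSpace E] {f : ℤ → E}
    {X : ℝ} (hX0 : 0 ≤ X) (hX : X ≤ 1 / 2) (hf : ∀ n, ‖f n‖ ≤ X ^ n.natAbs) :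
    ‖∑' n, f n - f 0‖ ≤ 4 * X := by
  have hpow (n : ℕ) : X ^ (n + 1) ≤ X * (1 / 2) ^ n := by rw [pow_succ']; gcongr
  have hpos (n : ℕ) : ‖f (n + 1 : ℕ)‖ ≤ X * (1 / 2) ^ n := (hf _).trans (hpow n)
  have hneg (n : ℕ) : ‖f (-(n + 1))‖ ≤ X * (1 / 2) ^ n := by
    refine (hf _).trans (le_of_eq_of_le ?_ (hpow n))
    rw [Int.natAbs_neg]
    rfl
  have hgeom : Summable fun n : ℕ => X * (1 / 2 : ℝ) ^ n := summable_geometric_two.mul_left X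
  have hsum : Summable fun n : ℕ => f n :=
    (summable_nat_add_iff (f := fun n : ℕ => f n) 1).1 (hgeom.of_norm_bounded hpos)
  rw [tsum_of_nat_of_neg_add_one hsum (hgeom.of_norm_bounded hneg), hsum.tsum_eq_zero_add,
    Nat.cast_zero, add_assoc, add_sub_cancel_left]
  refine (norm_add_le _ _).trans ?_
  linarith [norm_tsum_le_of_le_geometric_two hpos, norm_tsum_le_of_le_geometric_two hneg]

theorem tsum_gaussDensity_eq_tsum_exp {s : ℝ} (hs : 0 < s) (x : ℝ) :
    ((∑' n : ℤ, gaussDensity s (x + n) : ℝ) : ℂ) =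
      ∑' n : ℤ, Complex.exp (-Real.pi * ((s ^ 2 : ℝ) : ℂ) * n ^ 2 +
        2 * Real.pi * (-Complex.I * x) * n) := by
  have hsqrt : ((s ^ 2 : ℝ) : ℂ) ^ (1 / 2 : ℂ) = s := by
    rw [show (1 / 2 : ℂ) = ((1 / 2 : ℝ) : ℂ) by norm_num, ← Complex.ofReal_cpow (by positivity),
      ← Real.sqrt_eq_rpow, Real.sqrt_sq hs.le]
  have hI : Complex.I * (-Complex.I * x) = x := by
    rw [← mul_assoc, mul_neg, Complex.I_mul_I, neg_neg, one_mul]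
  rw [Complex.tsum_exp_neg_quadratic (by rw [Complex.ofReal_re]; positivity), hsqrt, hI,
    Complex.ofReal_tsum, ← tsum_mul_left]
  refine tsum_congr fun n => ?_
  rw [gaussDensity, Complex.ofReal_div, Complex.ofReal_exp, div_eq_mul_one_div, mul_comm]
  congr 2
  push_cast
  ring

theorem norm_exp_quadratic (s x : ℝ) (n : ℤ) :
    ‖Complex.exp (-Real.pi * ((s ^ 2 : ℝ) : ℂ) * n ^ 2 + 2 * Real.pi * (-Complex.I * x) * n)‖ =
      Real.exp (-Real.pi * s ^ 2 * n ^ 2) := by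
  rw [Complex.norm_exp, show (-Real.pi * ((s ^ 2 : ℝ) : ℂ) * n ^ 2 +
      2 * Real.pi * (-Complex.I * x) * n) = ((-Real.pi * s ^ 2 * n ^ 2 : ℝ) : ℂ) +
      ((-(2 * Real.pi * x * n) : ℝ) : ℂ) * Complex.I by push_cast; ring,
    Complex.add_re, Complex.ofReal_re, Complex.re_ofReal_mul, Complex.I_re, mul_zero, add_zero]

theorem abs_tsum_gaussDensity_sub_one_le {s : ℝ} (hs : 1 ≤ s) (x : ℝ) :
    |∑' n : ℤ, gaussDensity s (x + n) - 1| ≤ 4 * Real.exp (-Real.pi * s ^ 2) := by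
  set f : ℤ → ℂ := fun n => Complex.exp (-Real.pi * ((s ^ 2 : ℝ) : ℂ) * n ^ 2 +
    2 * Real.pi * (-Complex.I * x) * n) with hf
  have hf0 : f 0 = 1 := by simp [hf]
  have hle (n : ℤ) : ‖f n‖ ≤ Real.exp (-Real.pi * s ^ 2) ^ n.natAbs := by
    have habs : (n.natAbs : ℝ) ≤ (n : ℝ) ^ 2 := by
      rw [Nat.cast_natAbs]
      exact_mod_cast Int.natAbs_le_self_sq n
    rw [norm_exp_quadratic, ← Real.exp_nat_mul, Real.exp_le_exp]
    nlinarith [mul_le_mul_of_nonneg_left habs (by positivity : 0 ≤ Real.pi * s ^ 2)]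
  rw [← Real.norm_eq_abs, ← Complex.norm_real, Complex.ofReal_sub,
    tsum_gaussDensity_eq_tsum_exp (zero_lt_one.trans_le hs), Complex.ofReal_one, ← hf0]
  exact norm_tsum_int_sub_zero_le (Real.exp_pos _).le (exp_neg_pi_mul_sq_le_half hs) hle

theorem tsum_gaussDensity_le {s : ℝ} (hs : 1 ≤ s) (x : ℝ) :
    ∑' n : ℤ, gaussDensity s (x + n) ≤ 1 + 4 * Real.exp (-Real.pi * s ^ 2) := by
  linarith [(abs_le.1 (abs_tsum_gaussDensity_sub_one_le hs x)).2]

theorem gaussDensity_le_geometric {t y : ℝ} {Z i : ℕ} (ht : 1 ≤ t) (hZ : t ^ 2 ≤ Z)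
    (hy : ((Z : ℝ) + i) ^ 2 ≤ y ^ 2) :
    gaussDensity t y ≤ Real.exp (-Real.pi * t ^ 2) * (1 / 2) ^ i := by
  have hquot : t ^ 2 + i ≤ y ^ 2 / t ^ 2 := by
    rw [le_div_iff₀ (by positivity)]
    calc (t ^ 2 + i) * t ^ 2 ≤ (Z + i) * (Z + i) := by
          gcongr
          exact hZ.trans (le_add_of_nonneg_right i.cast_nonneg)
      _ = ((Z : ℝ) + i) ^ 2 := (sq _).symm
      _ ≤ y ^ 2 := hy
  calc gaussDensity t y ≤ Real.exp (-Real.pi * y ^ 2 / t ^ 2) :=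
        div_le_self (Real.exp_pos _).le ht
    _ ≤ Real.exp (-Real.pi * t ^ 2 + i * -Real.pi) := by
        rw [Real.exp_le_exp, mul_div_assoc]
        linarith [mul_le_mul_of_nonneg_left hquot Real.pi_pos.le]
    _ = Real.exp (-Real.pi * t ^ 2) * Real.exp (-Real.pi) ^ i := by
        rw [Real.exp_add, Real.exp_nat_mul]
    _ ≤ Real.exp (-Real.pi * t ^ 2) * (1 / 2) ^ i := by
        have := exp_neg_pi_mul_sq_le_half le_rfl
        rw [one_pow, mul_one] at this
        gcongr

theorem sum_gaussDensity_ge {t c : ℝ} {Z : ℕ} (ht : 1 ≤ t) (hZ : t ^ 2 ≤ Z) (hc0 : 0 ≤ c)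
    (hc1 : c ≤ 1) : 1 - 8 * Real.exp (-Real.pi * t ^ 2) ≤
      ∑ j ∈ Finset.range (2 * Z + 1), gaussDensity t ((j : ℝ) - Z - c) := by
  set X := Real.exp (-Real.pi * t ^ 2)
  set f : ℤ → ℝ := fun n => gaussDensity t ((-Z - c) + n)
  have hnonneg (n : ℤ) : 0 ≤ f n := gaussDensity_nonneg (zero_le_one.trans ht) _
  have hpos (i : ℕ) : ‖f (i + (2 * Z + 1) : ℕ)‖ ≤ X * (1 / 2) ^ i := by
    rw [Real.norm_of_nonneg (hnonneg _)]
    refine gaussDensity_le_geometric ht hZ (pow_le_pow_left₀ (by positivity) ?_ 2)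
    push_cast
    linarith
  have hneg (i : ℕ) : ‖f (-(i + 1))‖ ≤ X * (1 / 2) ^ i := by
    rw [Real.norm_of_nonneg (hnonneg _)]
    refine gaussDensity_le_geometric ht hZ ?_
    rw [← neg_sq (-_ - _ + _)]
    refine pow_le_pow_left₀ (by positivity) ?_ 2
    push_cast
    linarith
  have hgeom : Summable fun n : ℕ => X * (1 / 2 : ℝ) ^ n := summable_geometric_two.mul_left X
  have hsum : Summable fun n : ℕ => f n :=
    (summable_nat_add_iff (f := fun n : ℕ => f n) (2 * Z + 1)).1 (hgeom.of_norm_bounded hpos)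
  have hwindow : ∑ j ∈ Finset.range (2 * Z + 1), f j =
      ∑ j ∈ Finset.range (2 * Z + 1), gaussDensity t ((j : ℝ) - Z - c) :=
    Finset.sum_congr rfl fun j _ => congrArg (gaussDensity t) (by push_cast; ring)
  have htotal := (abs_le.1 (abs_tsum_gaussDensity_sub_one_le ht (-Z - c))).1
  rw [show ∑' n : ℤ, gaussDensity t (-Z - c + n) = ∑' n, f n from rfl,
    tsum_of_nat_of_neg_add_one hsum (hgeom.of_norm_bounded hneg),
    ← hsum.sum_add_tsum_nat_add (2 * Z + 1), hwindow] at htotal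
  have hupper := (Real.le_norm_self _).trans (norm_tsum_le_of_le_geometric_two hpos)
  have hlower := (Real.le_norm_self _).trans (norm_tsum_le_of_le_geometric_two hneg)
  linarith

/-! ### The law of the rounding error -/

theorem card_filter_range_le_bounds {a : ℕ → ℝ} (ha : Monotone a) {n : ℕ} {x : ℝ}
    (h0 : a 0 ≤ x) (hn : x ≤ a (n + 1)) :
    x ∈ Set.Icc (a {k ∈ Finset.range n | a (k + 1) ≤ x}.card)
      (a ({k ∈ Finset.range n | a (k + 1) ≤ x}.card + 1)) := by
  set s := {k ∈ Finset.range n | a (k + 1) ≤ x}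
  have hcard : s.card ≤ n := (Finset.card_filter_le _ _).trans (Finset.card_range n).le
  constructor
  · rcases hj : s.card with _ | j
    · exact h0
    by_contra! hlt
    have hsub : s ⊆ Finset.range j := fun k hk => by
      by_contra hkj
      have hjk : j + 1 ≤ k + 1 := by simpa using hkj
      exact absurd ((ha hjk).trans (Finset.mem_filter.1 hk).2) hlt.not_ge
    have := Finset.card_le_card hsub
    rw [Finset.card_range] at this
    omega
  · rcases hcard.eq_or_lt with hj | hj
    · rwa [hj]
    by_contra! hlt
    have hsub : Finset.range (s.card + 1) ⊆ s := fun k hk => by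
      have hk' : k ≤ s.card := Nat.lt_succ_iff.1 (Finset.mem_range.1 hk)
      exact Finset.mem_filter.2 ⟨Finset.mem_range.2 (hk'.trans_lt hj),
        (ha (Nat.succ_le_succ hk')).trans hlt.le⟩
    have := Finset.card_le_card hsub
    rw [Finset.card_range] at this
    omega

theorem sum_pow_div_factorial_ge_mul_exp {x : ℝ} (hx0 : 0 ≤ x) (hx : x ≤ 1 / 2) {N : ℕ}
    (hN : 0 < N) :
    (1 - 2 / 2 ^ N) * Real.exp x ≤ ∑ j ∈ Finset.range N, x ^ j / j.factorial := by
  have hbound := (abs_le.1 (Real.exp_bound (abs_le.2 ⟨by linarith, by linarith⟩) hN)).2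
  have hfact : (N.succ : ℝ) / (N.factorial * N) ≤ 2 := by
    have hN1 : (1 : ℝ) ≤ N := Nat.one_le_cast.2 hN
    have hfact1 : (1 : ℝ) ≤ N.factorial := Nat.one_le_cast.2 N.factorial_pos
    rw [div_le_iff₀ (by positivity)]
    push_cast
    nlinarith
  have hpow : |x| ^ N * ((N.succ : ℝ) / (N.factorial * N)) ≤ (1 / 2) ^ N * 2 := by
    rw [abs_of_nonneg hx0]
    gcongr
  have hexp : 2 / 2 ^ N * 1 ≤ 2 / 2 ^ N * Real.exp x :=
    mul_le_mul_of_nonneg_left (Real.one_le_exp hx0) (by positivity)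
  rw [div_pow, one_pow, one_div_mul_eq_div] at hpow
  linarith

namespace RoundingParams

variable {p : RoundingParams}

/-- The conditions on the parameters under which the rounding error is close to a Gaussian of width
`t`: its width is not too small, the truncated Gaussian loses little mass, and so does the truncated
exponential series. -/
structure IsAccurate (p : RoundingParams) : Prop where
  t_pos : 0 < p.t
  four_pi_le_sq : 4 * Real.pi ≤ p.t ^ 2
  sq_le_Z : p.t ^ 2 ≤ p.Z
  four_mul_Z_lt : 4 * p.Z < 2 ^ p.N

/-- A lower bound for the mass that the Gaussian of width `t` retains after both truncations. -/
def massBound (p : RoundingParams) : ℝ :=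
  (1 - 4 * p.Z / 2 ^ p.N) * (1 - 8 * Real.exp (-Real.pi * p.t ^ 2))

theorem IsAccurate.one_le_t (hp : p.IsAccurate) : 1 ≤ p.t := by
  nlinarith [hp.t_pos, hp.four_pi_le_sq, Real.pi_gt_three]

theorem IsAccurate.N_pos (hp : p.IsAccurate) : 0 < p.N := by
  by_contra! hN
  have hZ : (1 : ℝ) ≤ p.Z := (one_le_pow₀ hp.one_le_t).trans hp.sq_le_Z
  have hlt := hp.four_mul_Z_lt
  rw [Nat.le_zero.1 hN, pow_zero] at hlt
  have : 1 ≤ p.Z := by exact_mod_cast hZ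
  omega

theorem IsAccurate.series_pos (hp : p.IsAccurate) : 0 < 1 - 4 * (p.Z : ℝ) / 2 ^ p.N := by
  rw [sub_pos, div_lt_one (by positivity)]
  exact_mod_cast hp.four_mul_Z_lt

theorem IsAccurate.massBound_pos (hp : p.IsAccurate) : 0 < p.massBound := by
  have hexp : Real.exp (-Real.pi * p.t ^ 2) < (1 / 2) ^ 3 := by
    calc Real.exp (-Real.pi * p.t ^ 2) ≤ Real.exp ((3 : ℕ) * -1) := by
          rw [Real.exp_le_exp]
          push_cast
          nlinarith [hp.four_pi_le_sq, Real.pi_gt_three]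
      _ = Real.exp (-1) ^ 3 := Real.exp_nat_mul _ _
      _ < (1 / 2) ^ 3 :=
          pow_lt_pow_left₀ Real.exp_neg_one_lt_half (Real.exp_pos _).le three_ne_zero
  exact mul_pos hp.series_pos (by linarith)

theorem weight_pos (j : ℕ) : 0 < p.weight j := Real.exp_pos _

theorem expTaylor_eq (c : ℝ) : p.expTaylor c =
    ∑ j ∈ Finset.range p.N, (2 * Real.pi / p.t ^ 2 * c) ^ j / j.factorial :=
  Finset.sum_congr rfl fun _ _ => inv_mul_eq_div _ _

theorem expTaylor_pos (hN : 0 < p.N) {c : ℝ} (hc : 0 ≤ c) : 0 < p.expTaylor c := by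
  have hnonneg (j : ℕ) : 0 ≤ (j.factorial : ℝ)⁻¹ * (2 * Real.pi / p.t ^ 2 * c) ^ j := by
    positivity
  refine zero_lt_one.trans_le (le_of_eq_of_le ?_
    (Finset.single_le_sum (fun j _ => hnonneg j) (Finset.mem_range.2 hN)))
  simp

theorem expTaylor_le_exp {c : ℝ} (hc : 0 ≤ c) :
    p.expTaylor c ≤ Real.exp (2 * Real.pi / p.t ^ 2 * c) := by
  rw [expTaylor_eq]
  exact Real.sum_le_exp_of_nonneg (by positivity) _

theorem IsAccurate.le_expTaylor (hp : p.IsAccurate) {c : ℝ} (hc0 : 0 ≤ c) (hc1 : c ≤ 1) :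
    (1 - 2 / 2 ^ p.N) * Real.exp (2 * Real.pi / p.t ^ 2 * c) ≤ p.expTaylor c := by
  have hκ : 2 * Real.pi / p.t ^ 2 ≤ 1 / 2 := by
    rw [div_le_iff₀ (pow_pos hp.t_pos 2)]
    linarith [hp.four_pi_le_sq]
  rw [expTaylor_eq]
  refine sum_pow_div_factorial_ge_mul_exp (by positivity) ?_ hp.N_pos
  exact (mul_le_of_le_one_right (by positivity) hc1).trans hκ

theorem monotone_cumWeight (hN : 0 < p.N) {c : ℝ} (hc : 0 ≤ c) : Monotone (p.cumWeight c) :=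
  monotone_nat_of_le_succ fun k => by
    rw [cumWeight, cumWeight, Finset.sum_range_succ]
    exact le_add_of_nonneg_right
      (mul_pos (weight_pos k) (pow_pos (expTaylor_pos hN hc) k)).le

theorem cumWeight_pos (hN : 0 < p.N) {c : ℝ} (hc : 0 ≤ c) {k : ℕ} (hk : k ≠ 0) :
    0 < p.cumWeight c k :=
  Finset.sum_pos (fun j _ => mul_pos (weight_pos j) (pow_pos (expTaylor_pos hN hc) j))
    (Finset.nonempty_range_iff.2 hk)

theorem weight_mul_exp (ht : p.t ≠ 0) (c : ℝ) (j : ℕ) :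
    p.weight j * Real.exp (2 * Real.pi / p.t ^ 2 * c) ^ j =
      Real.exp (Real.pi * (c ^ 2 + 2 * c * p.Z) / p.t ^ 2) * p.t *
        gaussDensity p.t (j - p.Z - c) := by
  rw [weight, gaussDensity, ← Real.exp_nat_mul, ← Real.exp_add, mul_assoc, mul_div_cancel₀ _ ht,
    ← Real.exp_add]
  congr 1
  field_simp
  ring

theorem IsAccurate.mul_exp_pow_le_expTaylor_pow (hp : p.IsAccurate) {c : ℝ} (hc0 : 0 ≤ c)
    (hc1 : c ≤ 1) {j : ℕ} (hj : j ≤ 2 * p.Z) :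
    (1 - 4 * p.Z / 2 ^ p.N) * Real.exp (2 * Real.pi / p.t ^ 2 * c) ^ j ≤ p.expTaylor c ^ j := by
  have hθ : (2 : ℝ) / 2 ^ p.N ≤ 1 := by
    rw [div_le_one (by positivity)]
    exact le_self_pow₀ one_le_two hp.N_pos.ne'
  have hθj : (j : ℝ) * (2 / 2 ^ p.N) ≤ (2 * p.Z : ℕ) * (2 / 2 ^ p.N) := by gcongr
  have hbernoulli := one_add_mul_le_pow (show -2 ≤ -((2 : ℝ) / 2 ^ p.N) by linarith) j
  calc (1 - 4 * p.Z / 2 ^ p.N) * Real.exp (2 * Real.pi / p.t ^ 2 * c) ^ j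
      ≤ (1 - 2 / 2 ^ p.N) ^ j * Real.exp (2 * Real.pi / p.t ^ 2 * c) ^ j := by
        gcongr
        refine le_trans ?_ hbernoulli
        push_cast at hθj
        linarith [show 2 * (p.Z : ℝ) * (2 / 2 ^ p.N) = 4 * p.Z / 2 ^ p.N by ring]
    _ = ((1 - 2 / 2 ^ p.N) * Real.exp (2 * Real.pi / p.t ^ 2 * c)) ^ j := (mul_pow _ _ _).symm
    _ ≤ p.expTaylor c ^ j :=
        pow_le_pow_left₀ (mul_nonneg (by linarith) (Real.exp_pos _).le)
          (hp.le_expTaylor hc0 hc1) j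

theorem IsAccurate.le_cumWeight (hp : p.IsAccurate) {c : ℝ} (hc0 : 0 ≤ c) (hc1 : c ≤ 1) :
    Real.exp (Real.pi * (c ^ 2 + 2 * c * p.Z) / p.t ^ 2) * p.t * p.massBound ≤
      p.cumWeight c (2 * p.Z + 1) := by
  set E := Real.exp (Real.pi * (c ^ 2 + 2 * c * p.Z) / p.t ^ 2) * p.t
  have hE : 0 < E := mul_pos (Real.exp_pos _) hp.t_pos
  calc E * p.massBound
      ≤ E * ((1 - 4 * p.Z / 2 ^ p.N) *
          ∑ j ∈ Finset.range (2 * p.Z + 1), gaussDensity p.t ((j : ℝ) - p.Z - c)) :=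
        mul_le_mul_of_nonneg_left (mul_le_mul_of_nonneg_left
          (sum_gaussDensity_ge hp.one_le_t hp.sq_le_Z hc0 hc1) hp.series_pos.le) hE.le
    _ = ∑ j ∈ Finset.range (2 * p.Z + 1), p.weight j *
          ((1 - 4 * p.Z / 2 ^ p.N) * Real.exp (2 * Real.pi / p.t ^ 2 * c) ^ j) := by
        rw [mul_left_comm, Finset.mul_sum, Finset.mul_sum]
        refine Finset.sum_congr rfl fun j _ => ?_
        rw [mul_left_comm (p.weight j), weight_mul_exp hp.t_pos.ne', mul_left_comm]
    _ ≤ p.cumWeight c (2 * p.Z + 1) :=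
        Finset.sum_le_sum fun j hj => mul_le_mul_of_nonneg_left
          (hp.mul_exp_pow_le_expTaylor_pow hc0 hc1 (Nat.lt_succ_iff.1 (Finset.mem_range.1 hj)))
          (weight_pos j).le

theorem IsAccurate.weight_mul_pow_div_cumWeight_le (hp : p.IsAccurate) {c : ℝ} (hc0 : 0 ≤ c)
    (hc1 : c ≤ 1) (j : ℕ) :
    p.weight j * p.expTaylor c ^ j / p.cumWeight c (2 * p.Z + 1) ≤
      p.massBound⁻¹ * gaussDensity p.t (j - p.Z - c) := by
  set E := Real.exp (Real.pi * (c ^ 2 + 2 * c * p.Z) / p.t ^ 2) * p.t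
  have hE : 0 < E := mul_pos (Real.exp_pos _) hp.t_pos
  have hnum : p.weight j * p.expTaylor c ^ j ≤ E * gaussDensity p.t (j - p.Z - c) := by
    rw [← weight_mul_exp hp.t_pos.ne']
    exact mul_le_mul_of_nonneg_left (pow_le_pow_left₀ (expTaylor_pos hp.N_pos hc0).le
      (expTaylor_le_exp hc0) j) (weight_pos j).le
  calc p.weight j * p.expTaylor c ^ j / p.cumWeight c (2 * p.Z + 1)
      ≤ E * gaussDensity p.t (j - p.Z - c) / (E * p.massBound) :=
        div_le_div₀ (mul_nonneg hE.le (gaussDensity_nonneg hp.t_pos.le _)) hnum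
          (mul_pos hE hp.massBound_pos) (hp.le_cumWeight hc0 hc1)
    _ = p.massBound⁻¹ * gaussDensity p.t (j - p.Z - c) := by
        rw [mul_div_mul_left _ _ hE.ne', div_eq_inv_mul]

theorem volume_select_le (hN : 0 < p.N) {c : ℝ} (hc : 0 ≤ c) (j : ℕ) :
    volume {u : unitInterval | p.select c u = j} ≤
      ENNReal.ofReal (p.weight j * p.expTaylor c ^ j / p.cumWeight c (2 * p.Z + 1)) := by
  have htotal : 0 < p.cumWeight c (2 * p.Z + 1) := cumWeight_pos hN hc (Nat.succ_ne_zero _)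
  have hsub : Subtype.val '' {u : unitInterval | p.select c u = j} ⊆
      Set.Icc (p.cumWeight c j / p.cumWeight c (2 * p.Z + 1))
        (p.cumWeight c (j + 1) / p.cumWeight c (2 * p.Z + 1)) := by
    rintro _ ⟨u, rfl, rfl⟩
    have hbounds := card_filter_range_le_bounds (monotone_cumWeight hN hc)
      (n := 2 * p.Z) (x := u * p.cumWeight c (2 * p.Z + 1))
      (by simpa [cumWeight] using mul_nonneg u.2.1 htotal.le)
      (mul_le_of_le_one_left htotal.le u.2.2)
    exact ⟨(div_le_iff₀ htotal).2 hbounds.1, (le_div_iff₀ htotal).2 hbounds.2⟩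
  rw [unitInterval.volume_apply]
  refine (measure_mono hsub).trans (le_of_eq ?_)
  rw [Real.volume_Icc, ← sub_div, cumWeight, cumWeight, Finset.sum_range_succ, add_sub_cancel_left]

theorem IsAccurate.volume_roundInt_eq_le (hp : p.IsAccurate) (a : ℝ) (z : ℤ) :
    volume {u : unitInterval | p.roundInt a u = z} ≤
      ENNReal.ofReal p.massBound⁻¹ * ENNReal.ofReal (gaussDensity p.t (p.q * p.τ * a - z)) := by
  set v := p.q * p.τ * a with hv
  by_cases hz : 0 ≤ z - ⌊v⌋ + p.Z
  · lift z - ⌊v⌋ + p.Z to ℕ using hz with j hj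
    have hsub : {u : unitInterval | p.roundInt a u = z} ⊆
        {u : unitInterval | p.select (Int.fract v) u = j} := fun u hu => by
      rw [Set.mem_ofPred_eq, roundInt, ← hv] at hu
      rw [Set.mem_ofPred_eq]
      omega
    have hcast : (z : ℝ) = ⌊v⌋ + j - p.Z := by exact_mod_cast (by omega : z = ⌊v⌋ + j - p.Z)
    have hdensity : gaussDensity p.t (j - p.Z - Int.fract v) = gaussDensity p.t (v - z) := by
      rw [gaussDensity, gaussDensity, ← neg_sq (v - z), hcast, Int.fract]
      ring_nf
    rw [← ENNReal.ofReal_mul (inv_nonneg.2 hp.massBound_pos.le), ← hdensity]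
    exact (measure_mono hsub).trans ((volume_select_le hp.N_pos (Int.fract_nonneg v) j).trans
      (ENNReal.ofReal_le_ofReal (hp.weight_mul_pow_div_cumWeight_le (Int.fract_nonneg v)
        (Int.fract_lt_one v).le j)))
  · have hempty : {u : unitInterval | p.roundInt a u = z} = ∅ :=
      Set.eq_empty_of_forall_notMem fun u hu => by
        rw [Set.mem_ofPred_eq, roundInt, ← hv] at hu
        omega
    rw [hempty, measure_empty]
    exact zero_le

end RoundingParams

theorem gaussianWidth_eq_withDensity {s : ℝ} (hs : 0 < s) :
    gaussianWidth s = volume.withDensity fun x => ENNReal.ofReal (gaussDensity s x) := by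
  have hv : (s ^ 2 / (2 * Real.pi)).toNNReal ≠ 0 := by
    rw [Ne, Real.toNNReal_eq_zero, not_le]
    positivity
  have h2π : 2 * Real.pi * (s ^ 2 / (2 * Real.pi)) = s ^ 2 := by field_simp
  rw [gaussianWidth, gaussianReal_of_var_ne_zero _ hv]
  congr 1
  funext x
  rw [gaussianPDF, gaussianPDFReal, gaussDensity, Real.coe_toNNReal _ (by positivity), h2π,
    Real.sqrt_sq hs.le, inv_mul_eq_div]
  congr 3
  field_simp
  ring

@[fun_prop]
theorem measurable_gaussDensity (s : ℝ) : Measurable (gaussDensity s) := by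
  unfold gaussDensity
  fun_prop

theorem lintegral_gaussianWidth {s : ℝ} (hs : 0 < s) {g : ℝ → ENNReal} (hg : Measurable g) :
    ∫⁻ x, g x ∂gaussianWidth s = ∫⁻ x, ENNReal.ofReal (gaussDensity s x) * g x := by
  rw [gaussianWidth_eq_withDensity hs,
    lintegral_withDensity_eq_lintegral_mul _ (measurable_gaussDensity s).ennreal_ofReal hg]
  rfl

theorem lintegral_gaussianWidth_eq_lintegral_mul (c : ℝ) {g : ℝ → ENNReal} (hg : Measurable g) :
    ∫⁻ x, g x ∂gaussianWidth c = ∫⁻ x, g (c * x) ∂gaussianWidth 1 := by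
  have hmap := lintegral_map (μ := gaussianWidth 1) hg (measurable_const_mul c)
  rwa [map_mul_gaussianWidth, mul_one] at hmap

theorem lintegral_uniformZMod (q : ℕ) (g : ℝ → ENNReal) :
    ∫⁻ x, g x ∂uniformZMod q = (q : ENNReal)⁻¹ * ∑ k ∈ Finset.range q, g k := by
  have hset : (fun k : ℕ => (k : ℝ)) '' Set.Iio q =
      ((Finset.range q).map Nat.castEmbedding : Finset ℝ) := by
    simp
  rw [uniformZMod, uniformOn, hset, ProbabilityTheory.cond, lintegral_smul_measure,
    lintegral_finset, Measure.count_apply_finset, Finset.card_map, Finset.card_range,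
    Finset.sum_map, smul_eq_mul]
  simp

theorem gaussDensity_mul_add {q τ : ℝ} (hq : q ≠ 0) (x : ℝ) (i : ℤ) :
    gaussDensity (q * τ) (x + q * i) = q⁻¹ * gaussDensity τ (x / q + i) := by
  have hexp : -Real.pi * (x + q * i) ^ 2 / (q * τ) ^ 2 =
      -Real.pi * (x / q + i) ^ 2 / τ ^ 2 := by
    field_simp
  rw [gaussDensity, gaussDensity, hexp, inv_mul_eq_div, div_div, mul_comm τ]

theorem tsum_gaussDensity_add_mul_int_le {q τ : ℝ} (hq : 0 < q) (hτ : 1 ≤ τ) (x : ℝ) :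
    ∑' i : ℤ, ENNReal.ofReal (gaussDensity (q * τ) (x + q * i)) ≤
      ENNReal.ofReal (1 + 4 * Real.exp (-Real.pi * τ ^ 2)) * (ENNReal.ofReal q)⁻¹ := by
  simp only [gaussDensity_mul_add hq.ne', ENNReal.ofReal_mul (inv_nonneg.2 hq.le)]
  rw [ENNReal.tsum_mul_left, ENNReal.ofReal_inv_of_pos hq, mul_comm,
    ← ENNReal.ofReal_tsum_of_nonneg (fun i => gaussDensity_nonneg (by linarith) _)
      (summable_gaussDensity (by linarith) _)]
  gcongr
  exact tsum_gaussDensity_le hτ _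

theorem lintegral_tsum_gaussDensity_sub_mul {s t : ℝ} (hs : 0 < s) (ht : 0 < t)
    {G : ℤ → ℝ → ENNReal} (hG : ∀ z, Measurable (G z)) :
    ∫⁻ v, ∑' z : ℤ, ENNReal.ofReal (gaussDensity t (v - z)) * G z (v - z) ∂gaussianWidth s =
      ∫⁻ δ, ∑' z : ℤ, ENNReal.ofReal (gaussDensity s (δ + z)) * G z δ ∂gaussianWidth t := by
  have hmeas (z : ℤ) : Measurable fun v : ℝ =>
      ENNReal.ofReal (gaussDensity t (v - z)) * G z (v - z) := by fun_prop
  have hmeas' (z : ℤ) : Measurable fun δ : ℝ =>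
      ENNReal.ofReal (gaussDensity s (δ + z)) * G z δ := by fun_prop
  rw [lintegral_tsum fun z => (hmeas z).aemeasurable,
    lintegral_tsum fun z => (hmeas' z).aemeasurable]
  refine tsum_congr fun z => ?_
  rw [lintegral_gaussianWidth hs (hmeas z), lintegral_gaussianWidth ht (hmeas' z),
    ← lintegral_add_right_eq_self _ (z : ℝ)]
  simp only [add_sub_cancel_right]
  exact lintegral_congr fun δ => mul_left_comm _ _ _

theorem tsum_gaussDensity_mul_realMod_le {q : ℕ} (hq : 0 < q) {τ : ℝ} (hτ : 1 ≤ τ) (δ : ℝ)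
    (g : ℝ → ENNReal) :
    ∑' z : ℤ, ENNReal.ofReal (gaussDensity (q * τ) (δ + z)) * g (realMod z q) ≤
      ENNReal.ofReal (1 + 4 * Real.exp (-Real.pi * τ ^ 2)) * ∫⁻ x, g x ∂uniformZMod q := by
  have : NeZero q := ⟨hq.ne'⟩
  have hq0 : (0 : ℝ) < q := Nat.cast_pos.2 hq
  have hres (i : ℤ) (k : Fin q) : realMod ((i * q + k : ℤ) : ℝ) q = (k : ℕ) := by
    rw [← realMod_eq_self (Nat.cast_nonneg (k : ℕ)) (Nat.cast_lt.2 k.2),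
      ← realMod_add_mul_int (k : ℕ) hq0.ne' i]
    push_cast
    ring_nf
  have hcast (i : ℤ) (k : Fin q) : δ + ((i * q + k : ℤ) : ℝ) = δ + (k : ℕ) + q * i := by
    push_cast
    ring
  rw [← (Int.divModEquiv q).symm.tsum_eq, ENNReal.tsum_prod', ENNReal.tsum_comm, tsum_fintype,
    lintegral_uniformZMod, Finset.sum_range, Finset.mul_sum, Finset.mul_sum]
  refine Finset.sum_le_sum fun k _ => ?_
  simp only [Int.divModEquiv_symm_apply, hres, hcast]
  rw [ENNReal.tsum_mul_right, ← mul_assoc, ← ENNReal.ofReal_natCast q]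
  gcongr
  exact tsum_gaussDensity_add_mul_int_le hq0 hτ _

namespace RoundingParams

variable {p : RoundingParams}

theorem IsAccurate.volume_residueError_preimage_le (hp : p.IsAccurate) (a : ℝ) (A : Set (ℝ × ℝ)) :
    volume {u : unitInterval | p.residueError (a, u) ∈ A} ≤ ENNReal.ofReal p.massBound⁻¹ *
      ∑' z : ℤ, ENNReal.ofReal (gaussDensity p.t (p.q * p.τ * a - z)) *
        A.indicator 1 (realMod z p.q, p.q * p.τ * a - z) := by
  have hsub : {u : unitInterval | p.residueError (a, u) ∈ A} ⊆
      ⋃ z : ℤ, {u | p.roundInt a u = z ∧ (realMod z p.q, p.q * p.τ * a - z) ∈ A} :=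
    fun u hu => Set.mem_iUnion.2 ⟨p.roundInt a u, rfl, hu⟩
  refine ((measure_mono hsub).trans (measure_iUnion_le _)).trans ?_
  rw [← ENNReal.tsum_mul_left]
  refine ENNReal.tsum_le_tsum fun z => ?_
  by_cases hz : (realMod z p.q, p.q * p.τ * a - z) ∈ A
  · simpa only [hz, and_true, Set.indicator_of_mem, Pi.one_apply, mul_one] using
      hp.volume_roundInt_eq_le a z
  · simp only [hz, and_false, Set.ofPred_false, measure_empty, zero_le]

theorem IsAccurate.idealUpTo (hp : p.IsAccurate) (hq : 0 < p.q) (hτ : 1 ≤ p.τ) :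
    p.IdealUpTo (ENNReal.ofReal
      (p.massBound⁻¹ * (1 + 4 * Real.exp (-Real.pi * p.τ ^ 2)))) := by
  have : NeZero p.q := ⟨hq.ne'⟩
  refine Measure.le_iff.2 fun A hA => ?_
  have hind : Measurable (A.indicator (1 : ℝ × ℝ → ENNReal)) := measurable_one.indicator hA
  set G : ℤ → ℝ → ENNReal := fun z δ => A.indicator 1 (realMod z p.q, δ)
  have hGmeas (z : ℤ) : Measurable (G z) := hind.comp measurable_prodMk_left
  have hsum : Measurable fun v : ℝ =>
      ∑' z : ℤ, ENNReal.ofReal (gaussDensity p.t (v - z)) * G z (v - z) :=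
    Measurable.tsum fun z => (by fun_prop : Measurable fun v : ℝ =>
      ENNReal.ofReal (gaussDensity p.t (v - z))).mul ((hGmeas z).comp (measurable_sub_const _))
  calc ((gaussianWidth 1).prod volume).map p.residueError A
      = ∫⁻ a, volume {u : unitInterval | p.residueError (a, u) ∈ A} ∂gaussianWidth 1 := by
        rw [Measure.map_apply p.measurable_residueError hA,
          Measure.prod_apply (p.measurable_residueError hA)]
        rfl
    _ ≤ ∫⁻ a, ENNReal.ofReal p.massBound⁻¹ * ∑' z : ℤ,
          ENNReal.ofReal (gaussDensity p.t (p.q * p.τ * a - z)) * G z (p.q * p.τ * a - z)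
          ∂gaussianWidth 1 :=
        lintegral_mono fun a => hp.volume_residueError_preimage_le a A
    _ = ENNReal.ofReal p.massBound⁻¹ * ∫⁻ v, ∑' z : ℤ,
          ENNReal.ofReal (gaussDensity p.t (v - z)) * G z (v - z) ∂gaussianWidth (p.q * p.τ) := by
        rw [lintegral_gaussianWidth_eq_lintegral_mul _ hsum]
        exact lintegral_const_mul _ (hsum.comp (measurable_const_mul _) :)
    _ = ENNReal.ofReal p.massBound⁻¹ * ∫⁻ δ, ∑' z : ℤ,
          ENNReal.ofReal (gaussDensity (p.q * p.τ) (δ + z)) * G z δ ∂gaussianWidth p.t := by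
        rw [lintegral_tsum_gaussDensity_sub_mul (by positivity) hp.t_pos hGmeas]
    _ ≤ ENNReal.ofReal p.massBound⁻¹ * ∫⁻ δ,
          ENNReal.ofReal (1 + 4 * Real.exp (-Real.pi * p.τ ^ 2)) *
            ∫⁻ x, A.indicator 1 (x, δ) ∂uniformZMod p.q ∂gaussianWidth p.t := by
        gcongr with δ
        exact tsum_gaussDensity_mul_realMod_le hq hτ δ fun x => A.indicator 1 (x, δ)
    _ = _ := by
        rw [lintegral_const_mul _ hind.lintegral_prod_left',
          ← lintegral_prod_symm _ hind.aemeasurable, lintegral_indicator_one hA, ← mul_assoc,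
          ← ENNReal.ofReal_mul (inv_nonneg.2 hp.massBound_pos.le)]
        rfl

end RoundingParams

/-! ### Error bounds -/

theorem inv_one_sub_le_exp_two_mul {y : ℝ} (h0 : 0 ≤ y) (h1 : y ≤ 1 / 2) :
    (1 - y)⁻¹ ≤ Real.exp (2 * y) := by
  rw [inv_le_iff_one_le_mul₀ (by linarith)]
  nlinarith [Real.add_one_le_exp (2 * y)]

theorem exp_le_one_add_two_mul {y : ℝ} (h0 : 0 ≤ y) (h1 : y ≤ 1) : Real.exp y ≤ 1 + 2 * y := by
  have h := (abs_le.1 (Real.abs_exp_sub_one_sub_id_le (x := y) (by rwa [abs_of_nonneg h0]))).2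
  nlinarith

theorem exp_le_two_pow {y : ℝ} {a : ℕ} (h : y ≤ a) : Real.exp y ≤ 2 ^ (2 * a) := by
  rw [← Real.le_log_iff_exp_le (by positivity), Real.log_pow]
  push_cast
  nlinarith [Real.log_two_gt_d9, Nat.cast_nonneg (α := ℝ) a]

theorem inv_two_pow_le_exp {h : ℝ} {a : ℕ} (hle : h ≤ a) :
    ((2 : ℝ) ^ a)⁻¹ ≤ Real.exp (-h / 2) := by
  rw [← Real.log_le_iff_le_exp (by positivity), Real.log_inv, Real.log_pow]
  nlinarith [Real.log_two_gt_d9, Nat.cast_nonneg (α := ℝ) a]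

theorem natCast_mul_le_two_pow (n m : ℕ) : (n : ℝ) * m ≤ 2 ^ (n + m) := by
  rw [pow_add]
  exact_mod_cast Nat.mul_le_mul Nat.lt_two_pow_self.le Nat.lt_two_pow_self.le

theorem log_le_natLog_add_one (l : ℕ) : Real.log l ≤ (Nat.log 2 l + 1 : ℕ) := by
  rcases Nat.eq_zero_or_pos l with rfl | hl
  · simp
  rw [Real.log_le_iff_le_exp (by exact_mod_cast hl)]
  calc (l : ℝ) ≤ 2 ^ (Nat.log 2 l + 1) := by
        exact_mod_cast (Nat.lt_pow_succ_log_self one_lt_two l).le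
    _ ≤ Real.exp 1 ^ (Nat.log 2 l + 1) := by
        gcongr
        linarith [Real.add_one_le_exp 1]
    _ = Real.exp (Nat.log 2 l + 1 : ℕ) := Real.exp_one_pow _

theorem gaussianWidth_one_abs_ge_le {c : ℝ} (hc : 0 < c) :
    gaussianWidth 1 {x | c ≤ |x|} ≤ ENNReal.ofReal (1 / c ^ 2) := by
  have hchebyshev := meas_ge_le_variance_div_sq (μ := gaussianWidth 1) (X := id)
    (memLp_id_gaussianReal 2) hc
  have hmean : ∫ x, id x ∂gaussianWidth 1 = 0 := integral_id_gaussianReal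
  rw [hmean] at hchebyshev
  simp only [id, sub_zero] at hchebyshev
  refine hchebyshev.trans (ENNReal.ofReal_le_ofReal ?_)
  gcongr
  have hvar : Var[id; gaussianWidth 1] = 1 ^ 2 / (2 * Real.pi) := by
    rw [gaussianWidth, variance_id_gaussianReal, Real.coe_toNNReal _ (by positivity)]
  rw [hvar, div_le_one (by positivity)]
  linarith [Real.pi_gt_three]

theorem natCast_mul_gaussianWidth_tail_le {m n Z a : ℕ} {c : ℝ} (hmn : (m : ℝ) * n ≤ 2 ^ Z)
    (hc : |c| ≤ 2 ^ a) :
    m * (n * gaussianWidth 1 {x | ¬ |c * x| + Z + 1 ≤ 2 ^ (Z + a + 1)}) ≤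
      ENNReal.ofReal ((2 : ℝ) ^ Z)⁻¹ := by
  have hsub : {x : ℝ | ¬ |c * x| + Z + 1 ≤ 2 ^ (Z + a + 1)} ⊆ {x | (2 : ℝ) ^ Z ≤ |x|} := by
    intro x hx
    by_contra hlarge
    have hx' : |x| ≤ 2 ^ Z := (not_le.1 hlarge).le
    refine hx ?_
    have hZ : (Z : ℝ) + 1 ≤ 2 ^ Z := by exact_mod_cast Nat.lt_two_pow_self (n := Z)
    have hpow : (2 : ℝ) ^ Z ≤ 2 ^ Z * 2 ^ a :=
      le_mul_of_one_le_right (by positivity) (one_le_pow₀ one_le_two)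
    have hcx : |c * x| ≤ 2 ^ a * 2 ^ Z := by
      rw [abs_mul]
      gcongr
    rw [pow_succ, pow_add]
    linarith
  calc m * (n * gaussianWidth 1 {x | ¬ |c * x| + Z + 1 ≤ 2 ^ (Z + a + 1)})
      ≤ m * (n * ENNReal.ofReal (1 / (2 ^ Z) ^ 2)) := by
        gcongr
        exact (measure_mono hsub).trans (gaussianWidth_one_abs_ge_le (by positivity))
    _ = ENNReal.ofReal (m * n * (1 / (2 ^ Z) ^ 2)) := by
        rw [mul_assoc, ENNReal.ofReal_mul (Nat.cast_nonneg _),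
          ENNReal.ofReal_mul (Nat.cast_nonneg _), ENNReal.ofReal_natCast, ENNReal.ofReal_natCast]
    _ ≤ ENNReal.ofReal (2 ^ Z * (1 / (2 ^ Z) ^ 2)) := by gcongr
    _ = ENNReal.ofReal ((2 : ℝ) ^ Z)⁻¹ := by
        congr 1
        field_simp

theorem mul_four_mul_natCast_div_le {x : ℝ} {Z : ℕ} (hx : x ≤ 2 ^ Z) :
    x * (4 * Z / 2 ^ (3 * Z)) ≤ 4 * ((2 : ℝ) ^ Z)⁻¹ := by
  have hZ : (Z : ℝ) ≤ 2 ^ Z := by exact_mod_cast (Nat.lt_two_pow_self (n := Z)).le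
  calc x * (4 * Z / 2 ^ (3 * Z)) ≤ 2 ^ Z * (4 * 2 ^ Z / 2 ^ (3 * Z)) := by gcongr
    _ = 4 * ((2 : ℝ) ^ Z)⁻¹ := by
        rw [mul_comm 3 Z, pow_mul]
        field_simp

theorem natCast_mul_exp_le {m n : ℕ} (hm : 1 ≤ m) (hn : 1 ≤ n) {h t : ℝ}
    (ht : t ^ 2 = Real.log m + Real.log n + h) :
    m * n * Real.exp (-Real.pi * t ^ 2) ≤ Real.exp (-h) := by
  have hm0 : (0 : ℝ) < m := by exact_mod_cast hm
  have hn0 : (0 : ℝ) < n := by exact_mod_cast hn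
  rw [← Real.exp_log (mul_pos hm0 hn0), ← Real.exp_add, Real.log_mul hm0.ne' hn0.ne', ht,
    Real.exp_le_exp]
  nlinarith [Real.pi_gt_three, Real.log_natCast_nonneg m, Real.log_natCast_nonneg n]

theorem RoundingParams.massBound_inv_mul_le_exp {p : RoundingParams}
    (hseries : 4 * p.Z / 2 ^ p.N ≤ (1 / 2 : ℝ))
    (htail : 8 * Real.exp (-Real.pi * p.t ^ 2) ≤ 1 / 2) (hτ : p.t ^ 2 ≤ p.τ ^ 2) :
    p.massBound⁻¹ * (1 + 4 * Real.exp (-Real.pi * p.τ ^ 2)) ≤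
      Real.exp (2 * (4 * p.Z / 2 ^ p.N) + 20 * Real.exp (-Real.pi * p.t ^ 2)) := by
  have hexp : Real.exp (-Real.pi * p.τ ^ 2) ≤ Real.exp (-Real.pi * p.t ^ 2) := by
    rw [Real.exp_le_exp]
    nlinarith [Real.pi_pos]
  have htail0 := Real.exp_pos (-Real.pi * p.t ^ 2)
  have hsmooth : 1 + 4 * Real.exp (-Real.pi * p.τ ^ 2) ≤
      Real.exp (4 * Real.exp (-Real.pi * p.t ^ 2)) := by
    linarith [Real.add_one_le_exp (4 * Real.exp (-Real.pi * p.t ^ 2))]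
  calc p.massBound⁻¹ * (1 + 4 * Real.exp (-Real.pi * p.τ ^ 2))
      = (1 - 4 * p.Z / 2 ^ p.N : ℝ)⁻¹ * (1 - 8 * Real.exp (-Real.pi * p.t ^ 2))⁻¹ *
          (1 + 4 * Real.exp (-Real.pi * p.τ ^ 2)) := by rw [massBound, mul_inv]
    _ ≤ Real.exp (2 * (4 * p.Z / 2 ^ p.N)) *
          Real.exp (2 * (8 * Real.exp (-Real.pi * p.t ^ 2))) *
          Real.exp (4 * Real.exp (-Real.pi * p.t ^ 2)) := by
        gcongr
        · exact inv_nonneg.2 (by linarith)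
        · exact inv_one_sub_le_exp_two_mul (by positivity) hseries
        · exact inv_one_sub_le_exp_two_mul (by positivity) htail
    _ = _ := by
        rw [← Real.exp_add, ← Real.exp_add]
        ring_nf

theorem ofReal_pow_pow_le_one_add {m n : ℕ} {c y : ℝ} (hc : c ≤ Real.exp y) (hy : 0 ≤ y)
    (hmn : m * n * y ≤ 1) :
    (ENNReal.ofReal c ^ n) ^ m ≤ 1 + ENNReal.ofReal (2 * (m * n * y)) := by
  have hmn0 : 0 ≤ m * n * y := by positivity
  calc (ENNReal.ofReal c ^ n) ^ m ≤ (ENNReal.ofReal (Real.exp y) ^ n) ^ m := by gcongr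
    _ = ENNReal.ofReal (Real.exp (m * n * y)) := by
        rw [← pow_mul, ← ENNReal.ofReal_pow (Real.exp_pos y).le, ← Real.exp_nat_mul]
        push_cast
        ring_nf
    _ ≤ ENNReal.ofReal (1 + 2 * (m * n * y)) :=
        ENNReal.ofReal_le_ofReal (exp_le_one_add_two_mul hmn0 hmn)
    _ = _ := by rw [ENNReal.ofReal_add zero_le_one (by positivity), ENNReal.ofReal_one]

/-! ### Reductions from CLWE to LWE -/

theorem HasDistinguisher.mono {m n T T' : ℕ} {ε ε' : ℝ} {D₁ D₂ : Measure (Samples m n)}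
    (h : HasDistinguisher D₁ D₂ T ε) (hT : T ≤ T') (hε : ε' ≤ ε) :
    HasDistinguisher D₁ D₂ T' ε' := by
  obtain ⟨P, hP, hadvantage⟩ := h
  exact ⟨P, hP.mono hT, hε.trans hadvantage⟩

theorem HasSearchSolver.mono {m n T T' : ℕ} {ε ε' : ℝ} {J : Measure ((Fin n → ℝ) × Samples m n)}
    (h : HasSearchSolver J T ε) (hT : T ≤ T') (hε : ε' ≤ ε) : HasSearchSolver J T' ε' := by
  obtain ⟨P, hP, hsuccess⟩ := h
  exact ⟨P, hP.mono hT, hε.trans hsuccess⟩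

/-- LWE with error width `σ` is at least as hard as CLWE with error width `β`, for secrets of norm
`r`, up to the additional running time `time` and the loss `loss` in the advantage. -/
def ClweReducesToLwe (m n q : ℕ) (r γ β σ : ℝ) (time : ℕ) (loss : ℝ) : Prop :=
  ∀ S : PMF (Fin n → ℤ), (∀ s ∈ S.support, ‖WithLp.toLp 2 (fun j => (s j : ℝ))‖ = r) →
    ∀ (T : ℕ) (ε : ℝ),
      (HasDistinguisher (lweDist m q (uniformZModVec n q) S (gaussianWidth σ))
          (nullDist m (uniformZModVec n q) q) T ε →
        HasDistinguisher (clweDist m (gaussianVec n 1) (scaledSecret (1 / r) S) γ β)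
          (nullDist m (gaussianVec n 1) 1) (T + time) (ε - loss)) ∧
      (HasSearchSolver (lweJoint m q (uniformZModVec n q) S (gaussianWidth σ)) T ε →
        HasSearchSolver (clweJoint m (gaussianVec n 1) (scaledSecret (1 / r) S) γ β)
          (T + time) (ε - loss))

theorem clweReducesToLwe_of_one_le_loss {m n q : ℕ} (hq : 1 ≤ q) (r γ β σ : ℝ) (time : ℕ)
    {loss : ℝ} (hloss : 1 ≤ loss) : ClweReducesToLwe m n q r γ β σ time loss := by
  have : NeZero q := ⟨by omega⟩
  have := isProbabilityMeasure_nullDist (m := m) (q := (q : ℝ)) (by positivity) (uniformZModVec n q)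
  intro S _ T ε
  have : IsProbabilityMeasure (lweDist m q (uniformZModVec n q) S (gaussianWidth σ)) :=
    Measure.isProbabilityMeasure_map measurable_snd.aemeasurable
  refine ⟨fun ⟨P, _, hε⟩ => ⟨[], ⟨Nat.zero_le _, fun _ _ => Nat.zero_le _⟩, ?_⟩,
    fun ⟨P, _, hε⟩ => ⟨[], ⟨Nat.zero_le _, fun _ _ => Nat.zero_le _⟩, ?_⟩⟩
  · have hε1 : ε ≤ 1 := hε.trans <| abs_sub_le_of_nonneg_of_le measureReal_nonneg
      measureReal_le_one measureReal_nonneg measureReal_le_one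
    exact (by linarith : ε - loss ≤ 0).trans (abs_nonneg _)
  · have hε1 : ε ≤ 1 := hε.trans measureReal_le_one
    exact (by linarith : ε - loss ≤ 0).trans measureReal_nonneg

/-- On `m` samples in dimension `n`, the transformation is within statistical distance `η` of the
ideal one: the entries that the program does not reduce modulo `q` contribute `δ`, and the deviation
of the law of the rounding error from the ideal law contributes `δ'`. -/
def RoundingParams.IdealWithin (p : RoundingParams) (m n : ℕ) (η : ℝ) : Prop :=
  ∃ C δ δ' : ENNReal, C ≠ ⊤ ∧ p.IdealUpTo C ∧
    m * (n * gaussianWidth 1 {a | ¬ |p.q * p.τ * a| + p.Z + 1 ≤ 2 ^ p.K}) ≤ δ ∧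
    (C ^ n) ^ m ≤ 1 + δ' ∧ δ + δ' ≤ ENNReal.ofReal η

theorem sum_sq_eq_of_norm_eq {n : ℕ} {s : Fin n → ℤ} {r : ℝ}
    (h : ‖WithLp.toLp 2 (fun j => (s j : ℝ))‖ = r) : ∑ j, (s j : ℝ) ^ 2 = r ^ 2 := by
  rw [← h, EuclideanSpace.real_norm_sq_eq]

theorem RoundingParams.IdealWithin.clweReducesToLwe {p : RoundingParams} {m n : ℕ} {η : ℝ}
    (h : p.IdealWithin m n η) (hη : 0 ≤ η) (hq : 0 < p.q) {r γ β σ : ℝ} (hr : r ≠ 0)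
    (hγ : γ = r * p.τ) (hσ : σ ^ 2 = (p.q * β) ^ 2 + (r * p.t) ^ 2) :
    ClweReducesToLwe m n p.q r γ β σ (p.transformTime m n + (n + 1)) (2 * η) := by
  obtain ⟨C, δ, δ', hC, hideal, hδ, hδ', hle⟩ := h
  have : NeZero p.q := ⟨hq.ne'⟩
  have := isProbabilityMeasure_nullDist (m := m) (q := (p.q : ℝ)) (by positivity)
    (uniformZModVec n p.q)
  have := isProbabilityMeasure_nullDist (m := m) one_pos (gaussianVec n 1)
  have hfinite : δ + δ' ≠ ⊤ := ne_top_of_le_ne_top ENNReal.ofReal_ne_top hle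
  have hreal : (δ + δ').toReal ≤ η := ENNReal.toReal_le_of_le_ofReal hη hle
  have hnull := p.tvClose_transformLaw_null hq hC hideal hδ hδ'
  intro S hS T ε
  have hclose := p.tvClose_transformJoint_clwe hq hC hideal hδ hδ' hr hγ hσ
    fun s hs => sum_sq_eq_of_norm_eq (hS s hs)
  refine ⟨fun hD => ?_, fun hsolver => ?_⟩
  · have : IsProbabilityMeasure (lweDist m p.q (uniformZModVec n p.q) S (gaussianWidth σ)) :=
      Measure.isProbabilityMeasure_map measurable_snd.aemeasurable
    have : IsProbabilityMeasure
        (clweDist m (gaussianVec n 1) (scaledSecret (1 / r) S) γ β) :=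
      Measure.isProbabilityMeasure_map measurable_snd.aemeasurable
    have hdist : TVClose
        (p.transformLaw (clweDist m (gaussianVec n 1) (scaledSecret (1 / r) S) γ β))
        (lweDist m p.q (uniformZModVec n p.q) S (gaussianWidth σ)) (δ + δ') := by
      rw [clweDist, p.transformLaw_map_snd r]
      exact hclose.map measurable_snd
    exact (p.hasDistinguisher_of_transformLaw (hD.of_tvClose hfinite hdist hnull)).mono
      (by omega) (by linarith)
  · exact (p.hasSearchSolver_of_transformJoint hr (hsolver.of_tvClose hfinite hclose)).mono
      (by omega) (by linarith)

/-! ### The choice of the parameters -/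

/-- The parameters of the reduction in dimension `n` with `m` samples and modulus `q`, where `l` is
the binary logarithm of the security parameter and `k` the degree in the quasi-polynomial bound for
`f`. The value of `K` leaves room for entries of size up to `2 ^ Z`. -/
def reductionParams (n m q l k : ℕ) (τ t : ℝ) : RoundingParams where
  q := q
  τ := τ
  t := t
  K := n + m + (l + 1) ^ 2 + (Nat.log 2 q + 1 + (n + m) + 2 * (l + 1) ^ k) + 1
  N := 3 * (n + m + (l + 1) ^ 2)
  Z := n + m + (l + 1) ^ 2

/-- The additional running time of the reduction, as a polynomial in `n`, `m` and the binary
logarithms of `q` and of the security parameter. -/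
def reductionPoly (k : ℕ) : MvPolynomial (Fin 4) ℕ :=
  let Z := .X 0 + .X 1 + (.X 3 + 1) ^ 2
  let K := Z + (.X 2 + 1 + (.X 0 + .X 1) + 2 * (.X 3 + 1) ^ k) + 1
  .X 1 * (.X 0 + 1) * (8 * K + 6 * (3 * Z) + 24 * Z + 51) + (.X 0 + 1)

theorem eval_reductionPoly (n m q l k : ℕ) (τ t : ℝ) :
    (reductionPoly k).eval ![n, m, Nat.log 2 q, l] =
      (reductionParams n m q l k τ t).transformTime m n + (n + 1) := by
  simp [reductionPoly, reductionParams, RoundingParams.transformTime]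

section ReductionParams

variable {n m q lam k : ℕ} {f h τ t : ℝ}

theorem le_two_pow_of_sq_eq_log_add (hτ1 : 1 ≤ τ) (hτ : τ ^ 2 = Real.log m + Real.log n + f)
    (hf : f ≤ Real.exp (Real.log lam ^ k)) :
    τ ≤ 2 ^ (n + m + 2 * (Nat.log 2 lam + 1) ^ k) := by
  set e := 2 * (Nat.log 2 lam + 1) ^ k
  have hfe : f ≤ 2 ^ e := by
    refine hf.trans (exp_le_two_pow ?_)
    exact_mod_cast pow_le_pow_left₀ (Real.log_natCast_nonneg lam) (log_le_natLog_add_one lam) k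
  have hnm : (n : ℝ) + m + 1 ≤ 2 ^ (n + m) := by
    exact_mod_cast Nat.lt_two_pow_self (n := n + m)
  have he : (1 : ℝ) ≤ 2 ^ e := one_le_pow₀ one_le_two
  calc τ ≤ τ ^ 2 := le_self_pow₀ hτ1 two_ne_zero
    _ ≤ m + n + 2 ^ e := by
        rw [hτ]
        gcongr <;> exact Real.log_le_self (Nat.cast_nonneg _)
    _ ≤ (n + m + 1) * 2 ^ e := by nlinarith [Nat.cast_nonneg (α := ℝ) n, Nat.cast_nonneg (α := ℝ) m]
    _ ≤ 2 ^ (n + m) * 2 ^ e := by gcongr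
    _ = 2 ^ (n + m + e) := (pow_add _ _ _).symm

theorem sq_le_Z_reductionParams (hlog : h ≤ Real.log lam ^ 2)
    (ht : t ^ 2 = Real.log m + Real.log n + h) :
    t ^ 2 ≤ (reductionParams n m q (Nat.log 2 lam) k τ t).Z := by
  have hlam : Real.log lam ^ 2 ≤ ((Nat.log 2 lam + 1 : ℕ) : ℝ) ^ 2 :=
    pow_le_pow_left₀ (Real.log_natCast_nonneg lam) (log_le_natLog_add_one lam) 2
  have hm := Real.log_le_self (Nat.cast_nonneg (α := ℝ) m)
  have hn := Real.log_le_self (Nat.cast_nonneg (α := ℝ) n)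
  rw [reductionParams]
  push_cast at hlam ⊢
  linarith

theorem isAccurate_reductionParams (hh : 100 ≤ h) (hlog : h ≤ Real.log lam ^ 2) (ht0 : 0 ≤ t)
    (ht : t ^ 2 = Real.log m + Real.log n + h) :
    (reductionParams n m q (Nat.log 2 lam) k τ t).IsAccurate := by
  have ht100 : 100 ≤ t ^ 2 := by linarith [Real.log_natCast_nonneg m, Real.log_natCast_nonneg n]
  refine ⟨ht0.lt_of_ne ?_, ?_, sq_le_Z_reductionParams hlog ht, ?_⟩
  · rintro rfl
    norm_num at ht100
  · change 4 * Real.pi ≤ t ^ 2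
    linarith [Real.pi_lt_four]
  · change 4 * (n + m + (Nat.log 2 lam + 1) ^ 2) < 2 ^ (3 * (n + m + (Nat.log 2 lam + 1) ^ 2))
    set Z := n + m + (Nat.log 2 lam + 1) ^ 2
    have hZ : 0 < Z := by positivity
    calc 4 * Z < 2 ^ 2 * 2 ^ Z := by
          have := Nat.lt_two_pow_self (n := Z)
          omega
      _ = 2 ^ (2 + Z) := (pow_add _ _ _).symm
      _ ≤ 2 ^ (3 * Z) := Nat.pow_le_pow_right two_pos (by omega)

theorem natCast_mul_le_two_pow_Z_reductionParams :
    (m : ℝ) * n ≤ 2 ^ (reductionParams n m q (Nat.log 2 lam) k τ t).Z :=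
  (natCast_mul_le_two_pow m n).trans <| pow_le_pow_right₀ one_le_two <| by
    rw [add_comm m n]
    exact Nat.le_add_right _ _

theorem inv_two_pow_Z_reductionParams_le (hlog : h ≤ Real.log lam ^ 2)
    (ht : t ^ 2 = Real.log m + Real.log n + h) :
    ((2 : ℝ) ^ (reductionParams n m q (Nat.log 2 lam) k τ t).Z)⁻¹ ≤ Real.exp (-h / 2) := by
  refine inv_two_pow_le_exp (le_trans ?_ (sq_le_Z_reductionParams hlog ht))
  linarith [Real.log_natCast_nonneg m, Real.log_natCast_nonneg n]

theorem natCast_mul_gaussianWidth_tail_reductionParams_le (hlog : h ≤ Real.log lam ^ 2)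
    (hτ1 : 1 ≤ τ) (hτ : τ ^ 2 = Real.log m + Real.log n + f)
    (ht : t ^ 2 = Real.log m + Real.log n + h) (hf : f ≤ Real.exp (Real.log lam ^ k)) :
    let p := reductionParams n m q (Nat.log 2 lam) k τ t
    m * (n * gaussianWidth 1 {a | ¬ |p.q * p.τ * a| + p.Z + 1 ≤ 2 ^ p.K}) ≤
      ENNReal.ofReal (Real.exp (-h / 2)) := by
  have hq : (q : ℝ) ≤ 2 ^ (Nat.log 2 q + 1) := by
    exact_mod_cast (Nat.lt_pow_succ_log_self one_lt_two q).le
  have hscale : |q * τ| ≤ 2 ^ (Nat.log 2 q + 1 + (n + m) + 2 * (Nat.log 2 lam + 1) ^ k) := by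
    rw [abs_of_nonneg (by positivity), add_assoc (Nat.log 2 q + 1), pow_add]
    gcongr
    exact le_two_pow_of_sq_eq_log_add hτ1 hτ hf
  exact (natCast_mul_gaussianWidth_tail_le natCast_mul_le_two_pow_Z_reductionParams hscale).trans
    (ENNReal.ofReal_le_ofReal (inv_two_pow_Z_reductionParams_le hlog ht))

theorem natCast_mul_series_reductionParams_le (hlog : h ≤ Real.log lam ^ 2)
    (ht : t ^ 2 = Real.log m + Real.log n + h) :
    let p := reductionParams n m q (Nat.log 2 lam) k τ t
    m * n * (4 * p.Z / 2 ^ p.N : ℝ) ≤ 4 * Real.exp (-h / 2) :=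
  (mul_four_mul_natCast_div_le natCast_mul_le_two_pow_Z_reductionParams).trans <| by
    gcongr
    exact inv_two_pow_Z_reductionParams_le hlog ht

theorem idealWithin_reductionParams (hn : 1 ≤ n) (hm : 1 ≤ m) (hq : 1 ≤ q) (hh : 100 ≤ h)
    (hlog : h ≤ Real.log lam ^ 2) (hhf : h ≤ f) (hτ0 : 0 ≤ τ) (ht0 : 0 ≤ t)
    (hτ : τ ^ 2 = Real.log m + Real.log n + f) (ht : t ^ 2 = Real.log m + Real.log n + h)
    (hf : f ≤ Real.exp (Real.log lam ^ k)) :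
    (reductionParams n m q (Nat.log 2 lam) k τ t).IdealWithin m n (57 * Real.exp (-h / 2)) := by
  set p := reductionParams n m q (Nat.log 2 lam) k τ t
  set E := Real.exp (-h / 2)
  have hτ1 : 1 ≤ τ := by
    nlinarith [Real.log_natCast_nonneg m, Real.log_natCast_nonneg n]
  have hmn : (1 : ℝ) ≤ m * n := by exact_mod_cast Nat.mul_pos hm hn
  have hE0 : 0 < E := Real.exp_pos _
  have hE : E ≤ 1 / 51 := by
    have hexp : E * Real.exp (h / 2) = 1 := by rw [← Real.exp_add]; simp [neg_div]
    nlinarith [Real.add_one_le_exp (h / 2)]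
  have hseries : m * n * (4 * p.Z / 2 ^ p.N : ℝ) ≤ 4 * E :=
    natCast_mul_series_reductionParams_le hlog ht
  have htail : m * n * Real.exp (-Real.pi * p.t ^ 2) ≤ E :=
    (natCast_mul_exp_le hm hn ht).trans (Real.exp_le_exp.2 (by linarith))
  have hbound := p.massBound_inv_mul_le_exp
    (by linarith [le_mul_of_one_le_left (by positivity : 0 ≤ (4 * p.Z / 2 ^ p.N : ℝ)) hmn])
    (by linarith [le_mul_of_one_le_left (Real.exp_pos (-Real.pi * p.t ^ 2)).le hmn])
    (show t ^ 2 ≤ τ ^ 2 by linarith)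
  refine ⟨_, ENNReal.ofReal E, ENNReal.ofReal (56 * E), ENNReal.ofReal_ne_top,
    (isAccurate_reductionParams hh hlog ht0 ht).idealUpTo hq hτ1,
    natCast_mul_gaussianWidth_tail_reductionParams_le hlog hτ1 hτ ht hf,
    (ofReal_pow_pow_le_one_add hbound (by positivity) (by linarith)).trans ?_, ?_⟩
  · exact add_le_add_right (ENNReal.ofReal_le_ofReal (by linarith)) 1
  · rw [← ENNReal.ofReal_add hE0.le (by positivity)]
    exact ENNReal.ofReal_le_ofReal (by linarith)

end ReductionParams

/-! ### Negligible loss -/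

theorem tendsto_log_natCast : Tendsto (fun l : ℕ => Real.log l) atTop atTop :=
  Real.tendsto_log_atTop.comp tendsto_natCast_atTop_atTop

theorem IsSuperLog.eventually_ge {f : ℕ → ℝ} (hf : IsSuperLog f) (A : ℝ) :
    ∀ᶠ l : ℕ in atTop, A * Real.log l ≤ f l := by
  filter_upwards [hf.eventually_ge_atTop A, eventually_gt_atTop 1] with l hl h1
  rwa [le_div_iff₀ (Real.log_pos (by exact_mod_cast h1))] at hl

theorem isSuperLog_log_sq : IsSuperLog fun l => Real.log l ^ 2 := by
  refine tendsto_log_natCast.congr fun l => ?_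
  change _ = Real.log l ^ 2 / Real.log l
  rw [sq, mul_self_div_self]

theorem IsSuperLog.min {f g : ℕ → ℝ} (hf : IsSuperLog f) (hg : IsSuperLog g) :
    IsSuperLog fun l => min (f l) (g l) :=
  tendsto_atTop.2 fun A => by
    filter_upwards [hf.eventually_ge_atTop A, hg.eventually_ge_atTop A] with l hfl hgl
    rw [← min_div_div_right (Real.log_natCast_nonneg l)]
    exact le_min hfl hgl

theorem IsSuperLog.tendsto_atTop {f : ℕ → ℝ} (hf : IsSuperLog f) : Tendsto f atTop atTop :=
  tendsto_atTop_mono' _ ((hf.eventually_ge 1).mono fun l hl => by rwa [one_mul] at hl)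
    tendsto_log_natCast

theorem IsSuperLog.isNegligible_exp {h : ℕ → ℝ} (hh : IsSuperLog h) :
    IsNegligible fun l => Real.exp (-h l / 2) := by
  refine (Asymptotics.superpolynomialDecay_iff_abs_isBoundedUnder _
    tendsto_natCast_atTop_atTop).2 fun d => ⟨1, eventually_map.2 ?_⟩
  filter_upwards [hh.eventually_ge (2 * d), eventually_gt_atTop 0] with l hl hl0
  have hl0' : (0 : ℝ) < l := by exact_mod_cast hl0
  rw [abs_of_nonneg (by positivity), ← Real.exp_log hl0', ← Real.exp_nat_mul, ← Real.exp_add,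
    Real.exp_le_one_iff]
  linarith

/-- The exponent `slack` in the loss `exp (-slack / 2)` of the reduction: it is at most `f` and `g`,
and the cap `log ² λ` keeps the running time polynomial. -/
def slack (f g : ℕ → ℝ) (l : ℕ) : ℝ :=
  min (f l) (min (g l) (Real.log l ^ 2))

theorem isSuperLog_slack {f g : ℕ → ℝ} (hf : IsSuperLog f) (hg : IsSuperLog g) :
    IsSuperLog (slack f g) :=
  hf.min (hg.min isSuperLog_log_sq)

open Classical in
/-- The loss in the advantage of the reduction at the security parameter `l`. It is trivial for the
finitely many `l` at which the slack is small or the quasi-polynomial bound for `f` fails. -/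
def advantageLoss (f g : ℕ → ℝ) (k l : ℕ) : ℝ :=
  if 100 ≤ slack f g l ∧ f l ≤ Real.exp (Real.log l ^ k) then
    2 * (57 * Real.exp (-slack f g l / 2))
  else 1

theorem isNegligible_advantageLoss {f g : ℕ → ℝ} {k : ℕ} (hf : IsSuperLog f) (hg : IsSuperLog g)
    (hfk : ∀ᶠ l : ℕ in atTop, f l ≤ Real.exp (Real.log l ^ k)) :
    IsNegligible (advantageLoss f g k) := by
  have hslack := isSuperLog_slack hf hg
  refine ((hslack.isNegligible_exp.const_mul 57).const_mul 2).congr' ?_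
  filter_upwards [hslack.tendsto_atTop.eventually_ge_atTop 100, hfk] with l h100 hl
  rw [advantageLoss, if_pos ⟨h100, hl⟩]

theorem sqrt_sq_add_sq_le_two_mul {a b : ℝ} (hb : 0 ≤ b) (h : 3 * b ≤ a) :
    √(a ^ 2 + b ^ 2) ≤ 2 * a := by
  rw [Real.sqrt_le_left (by linarith)]
  nlinarith

theorem exists_clweReducesToLwe_of_slack_ge (f g : ℕ → ℝ) {k lam n m q : ℕ} {r β γ : ℝ}
    (hslack : 100 ≤ slack f g lam) (hfk : f lam ≤ Real.exp (Real.log lam ^ k))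
    (hn : 1 ≤ n) (hm : 1 ≤ m) (hq : 1 ≤ q) (hr : 0 < r)
    (hγ : γ = r * √(Real.log m + Real.log n + f lam))
    (hβ : 3 * r * √(Real.log m + Real.log n + g lam) ≤ β * q) :
    ∃ σ : ℝ, β * q ≤ σ ∧ σ ≤ 2 * (β * q) ∧ ClweReducesToLwe m n q r γ β σ
      ((reductionPoly k).eval ![n, m, Nat.log 2 q, Nat.log 2 lam])
      (2 * (57 * Real.exp (-slack f g lam / 2))) := by
  have hlef : slack f g lam ≤ f lam := min_le_left _ _
  have hleg : slack f g lam ≤ g lam := (min_le_right _ _).trans (min_le_left _ _)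
  have hlelog : slack f g lam ≤ Real.log lam ^ 2 := (min_le_right _ _).trans (min_le_right _ _)
  have hlogs : 0 ≤ Real.log m + Real.log n :=
    add_nonneg (Real.log_natCast_nonneg m) (Real.log_natCast_nonneg n)
  set τ := √(Real.log m + Real.log n + f lam)
  set t := √(Real.log m + Real.log n + slack f g lam)
  have hτ : τ ^ 2 = Real.log m + Real.log n + f lam := Real.sq_sqrt (by linarith)
  have ht : t ^ 2 = Real.log m + Real.log n + slack f g lam := Real.sq_sqrt (by linarith)
  have hrt : 3 * (r * t) ≤ β * q := by
    have htg : t ≤ √(Real.log m + Real.log n + g lam) := Real.sqrt_le_sqrt (by linarith)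
    refine le_trans ?_ hβ
    rw [mul_assoc]
    gcongr
  have hσ : √((β * q) ^ 2 + (r * t) ^ 2) ^ 2 = (q * β) ^ 2 + (r * t) ^ 2 := by
    rw [Real.sq_sqrt (by positivity), mul_comm β]
  have hideal := idealWithin_reductionParams hn hm hq hslack hlelog hlef (Real.sqrt_nonneg _)
    (Real.sqrt_nonneg _) hτ ht hfk
  refine ⟨√((β * q) ^ 2 + (r * t) ^ 2), Real.le_sqrt_of_sq_le (by linarith [sq_nonneg (r * t)]),
    sqrt_sq_add_sq_le_two_mul (by positivity) hrt, ?_⟩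
  rw [eval_reductionPoly n m q (Nat.log 2 lam) k τ t]
  exact hideal.clweReducesToLwe (by positivity) hq hr.ne' hγ hσ

theorem exists_clweReducesToLwe (f g : ℕ → ℝ) (k lam : ℕ) {n m q : ℕ} {r β γ : ℝ}
    (hn : 1 ≤ n) (hm : 1 ≤ m) (hq : 1 ≤ q) (hr : 0 < r) (hβ0 : 0 < β)
    (hγ : γ = r * √(Real.log m + Real.log n + f lam))
    (hβ : 3 * r * √(Real.log m + Real.log n + g lam) ≤ β * q) :
    ∃ σ : ℝ, β * q ≤ σ ∧ σ ≤ 2 * (β * q) ∧ ClweReducesToLwe m n q r γ β σ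
      ((reductionPoly k).eval ![n, m, Nat.log 2 q, Nat.log 2 lam]) (advantageLoss f g k lam) := by
  rw [advantageLoss]
  split_ifs with hgood
  · exact exists_clweReducesToLwe_of_slack_ge f g hgood.1 hgood.2 hn hm hq hr hγ hβ
  · exact ⟨β * q, le_rfl, le_mul_of_one_le_left (by positivity) one_le_two,
      clweReducesToLwe_of_one_le_loss hq r γ β _ _ le_rfl⟩

end

theorem theoremC1 :
    ∃ C : ℝ, 1 ≤ C ∧
      ∀ f g : ℕ → ℝ, IsSuperLog f → IsQuasiPolyBounded f → IsSuperLog g →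
        ∃ (p : MvPolynomial (Fin 4) ℕ) (ν : ℕ → ℝ), IsNegligible ν ∧
          ∀ (lam n m q : ℕ) (r β γ : ℝ), 1 ≤ n → 1 ≤ m → 1 ≤ q → 1 ≤ r → 0 < β →
            γ = r * √(Real.log m + Real.log n + f lam) →
            3 * r * √(Real.log m + Real.log n + g lam) ≤ β * q →
            ∃ σ : ℝ, β * q ≤ σ ∧ σ ≤ C * (β * q) ∧
              ∀ S : PMF (Fin n → ℤ),
                (∀ s ∈ S.support, ‖WithLp.toLp 2 (fun j => (s j : ℝ))‖ = r) →
                ∀ (T : ℕ) (ε : ℝ),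
                  (¬ HasDistinguisher
                        (clweDist m (gaussianVec n 1) (scaledSecret (1 / r) S) γ β)
                        (nullDist m (gaussianVec n 1) 1)
                        (T + p.eval ![n, m, Nat.log 2 q, Nat.log 2 lam]) (ε - ν lam) →
                    ¬ HasDistinguisher
                        (lweDist m q (uniformZModVec n q) S (gaussianWidth σ))
                        (nullDist m (uniformZModVec n q) q) T ε) ∧
                  (¬ HasSearchSolver
                        (clweJoint m (gaussianVec n 1) (scaledSecret (1 / r) S) γ β)
                        (T + p.eval ![n, m, Nat.log 2 q, Nat.log 2 lam]) (ε - ν lam) →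
                    ¬ HasSearchSolver
                        (lweJoint m q (uniformZModVec n q) S (gaussianWidth σ)) T ε) := by
  refine ⟨2, one_le_two, fun f g hf ⟨k, hfk⟩ hg => ⟨reductionPoly k, advantageLoss f g k,
    isNegligible_advantageLoss hf hg hfk, fun lam n m q r β γ hn hm hq hr hβ0 hγ hβ => ?_⟩⟩
  obtain ⟨σ, hle, hge, hred⟩ := exists_clweReducesToLwe f g k lam hn hm hq (by positivity) hβ0 hγ hβ
  exact ⟨σ, hle, hge, fun S hS T ε => ⟨mt (hred S hS T ε).1, mt (hred S hS T ε).2⟩⟩
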